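/- Let $\mathcal G=(V,E)$ be either the nearest-neighbour lattice $\mathbb{Z}^d$ with $d\ge 2$ or the hexagonal lattice. For a finite graph $G=(V_G,E_G)$ let $\Omega_G$ be the set of spanning subgraphs $\kappa$ of $G$ in which every vertex has degree $0$ or $2$, so that every connected component of $\kappa$ is an isolated vertex or a loop. Let $o(\kappa)$ be the number of edges and $L(\kappa)$ the number of loops of $\kappa$. For $\lambda\ge 0$ and $n>0$ the loop $O(n)$ model on $G$ is the probability measure on $\Omega_G$ $$\mathbb{P}_{G,\lambda,n}(\kappa)=\frac{\lambda^{o(\kappa)}\,n^{L(\kappa)}}{\sum_{\kappa'\in\Omega_G}\lambda^{o(\kappa')}\,n^{L(\kappa')}}\qquad(0^0=1),$$ with expectation $\mathbb{E}_{G,\lambda,n}$. For $x\in V_G$ let $|\mathcal P_x(\kappa)|$ be the number of edges of the connected component of $\kappa$ containing $x$. For $\delta>0$ put $$\mathcal L(\delta,\lambda,n)=\sup_{G}\ \sup_{x\in V_G}\ \mathbb{E}_{G,\lambda,n}\big(e^{\delta|\mathcal P_x|}\big),$$ where $G$ runs over the finite domains of $\mathcal G$, i.e. the subgraphs of $\mathcal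 G$ induced by finite sets of vertices, and define the critical threshold $$\lambda_c(n)=\sup\{\lambda\in[0,\infty):\ \mathcal L(\delta,\lambda,n)<\infty\ \text{for some}\ \delta>0\}\in[0,\infty].$$ Let $\mu=\mu(\mathcal G)\in(0,\infty)$ be the connective constant, $\mu=\lim_{N\to\infty}|\mathrm{SAW}_x(N)|^{1/N}$, where $\mathrm{SAW}_x(N)$ is the set of self-avoiding walks of length $N$ in $\mathcal G$ starting at $x$ (the limit exists and does not depend on $x$). Then $\lambda_c(n)>1/\mu$ for every $n\in(0,\infty)$. Moreover there is a constant $c_0=c_0(\mathcal G)\in(0,\infty)$, depending only on $\mathcal G$, such that $$\lambda_c(n)\ \ge\ \frac1\mu+c_0\,n+O(n^2)\qquad\text{as } n\downarrow 0 .$$ -/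

import Mathlib

open Filter Topology Asymptotics

noncomputable section

/-- The cubic lattice `ℤ^d`: two sites are joined when their Euclidean distance is `1`. -/
def cubicLattice (d : ℕ) : SimpleGraph (Fin d → ℤ) where
  Adj x y := ∑ i, (x i - y i) ^ 2 = 1
  symm := ⟨fun x y h => by
    rw [← h]
    exact Finset.sum_congr rfl fun i _ => by ring⟩
  loopless := ⟨fun x h => by simp at h⟩

/-- The edges of the honeycomb lattice, directed from the sublattice `false` to the sublattice
`true`: the site `(a, b, false)` is joined to `(a, b, true)`, `(a - 1, b, true)` and
`(a, b - 1, true)`. -/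
def hexLink (u v : ℤ × ℤ × Bool) : Prop :=
  u.2.2 = false ∧ v.2.2 = true ∧
    ((v.1 = u.1 ∧ v.2.1 = u.2.1) ∨ (v.1 = u.1 - 1 ∧ v.2.1 = u.2.1) ∨
      (v.1 = u.1 ∧ v.2.1 = u.2.1 - 1))

/-- The hexagonal (honeycomb) lattice: two triangular sublattices, indexed by the Boolean
coordinate, each site being joined to its three nearest neighbours in the other one. -/
def hexagonalLattice : SimpleGraph (ℤ × ℤ × Bool) where
  Adj u v := hexLink u v ∨ hexLink v u
  symm := ⟨fun _ _ h => h.symm⟩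
  loopless := ⟨fun u h => by
    have h' : hexLink u u := h.elim id id
    have h1 := h'.1
    rw [h'.2.1] at h1
    exact Bool.noConfusion h1⟩

namespace LoopModel

/-- The self-avoiding walks of length `N` starting at `x`. -/
def selfAvoidingWalks {V : Type*} (G : SimpleGraph V) (x : V) (N : ℕ) : Set (Fin (N + 1) → V) :=
  {ω | ω 0 = x ∧ (∀ i : Fin N, G.Adj (ω i.castSucc) (ω i.succ)) ∧ Function.Injective ω}

/-- `μ` is the connective constant of `G`: whatever the starting point, the `N`-th root of the
number of self-avoiding walks of length `N` converges to `μ`. -/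
def IsConnectiveConstant {V : Type*} (G : SimpleGraph V) (μ : ℝ) : Prop :=
  ∀ x : V, Tendsto (fun N : ℕ => ((selfAvoidingWalks G x N).ncard : ℝ) ^ (1 / (N : ℝ)))
    atTop (𝓝 μ)

open Classical in
/-- The configurations of the loop model on a finite graph `H`: the spanning subgraphs of `H` in
which every vertex has degree zero or two. -/
def configs {W : Type*} [Fintype W] (H : SimpleGraph W) : Finset (SimpleGraph W) :=
  {κ : SimpleGraph W | κ ≤ H ∧
    ∀ v, (κ.neighborSet v).ncard = 0 ∨ (κ.neighborSet v).ncard = 2}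

/-- The total number of edges of `κ`. -/
def numEdges {W : Type*} (κ : SimpleGraph W) : ℕ := κ.edgeSet.ncard

/-- The number of loops of `κ`: the connected components which are not an isolated vertex. -/
def numLoops {W : Type*} (κ : SimpleGraph W) : ℕ :=
  {c : κ.ConnectedComponent | c.supp.Nontrivial}.ncard

/-- The number of edges of the connected component of `κ` that contains `x`. -/
def loopLength {W : Type*} (κ : SimpleGraph W) (x : W) : ℕ :=
  {e ∈ κ.edgeSet | ∀ v ∈ e, κ.Reachable x v}.ncard

/-- The weight `lam ^ #edges * n ^ #loops`. -/
def weight {W : Type*} (lam n : ℝ) (κ : SimpleGraph W) : ℝ :=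
  lam ^ numEdges κ * n ^ numLoops κ

/-- The partition function of the loop model on a finite graph. -/
def partitionFunction {W : Type*} [Fintype W] (H : SimpleGraph W) (lam n : ℝ) : ℝ :=
  ∑ κ ∈ configs H, weight lam n κ

/-- The probability of a configuration in the loop model on a finite graph. -/
def prob {W : Type*} [Fintype W] (H : SimpleGraph W) (lam n : ℝ) (κ : SimpleGraph W) : ℝ :=
  weight lam n κ / partitionFunction H lam n

/-- The expectation of an observable in the loop model on a finite graph. -/
def expectation {W : Type*} [Fintype W] (H : SimpleGraph W) (lam n : ℝ)
    (f : SimpleGraph W → ℝ) : ℝ :=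
  ∑ κ ∈ configs H, prob H lam n κ * f κ

/-- The supremum, over the finite domains of `G` (subgraphs induced by a finite set `S` of
vertices) and over the points `x` of the domain, of the exponential moment of order `δ` of the
length of the loop through `x`. -/
def expMoment {V : Type*} (G : SimpleGraph V) (δ lam n : ℝ) : EReal :=
  ⨆ (S : Finset V) (x : (S : Set V)),
    ((expectation (G.induce (S : Set V)) lam n
      (fun κ => Real.exp (δ * (loopLength κ x : ℝ))) : ℝ) : EReal)

/-- The critical threshold (possibly `⊤`): the supremum of the `lam ≥ 0` for which the loop length
has uniformly bounded exponential moments of some order `δ > 0`. -/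
def criticalThreshold {V : Type*} (G : SimpleGraph V) (n : ℝ) : EReal :=
  ⨆ (lam : ℝ) (_ : 0 ≤ lam ∧ ∃ δ : ℝ, 0 < δ ∧ expMoment G δ lam n < ⊤), (lam : EReal)

end LoopModel

end

/-!
The loop through a given vertex, cut open at that vertex, is a self-avoiding walk `l` with `m`
vertices. Erasing it from a configuration shows that it appears with probability at most
`lam ^ m * n * Z' / Z`, where `Z'` is the partition function of the configurations avoiding it. If a
block of `B` consecutive vertices of `l` has a *contact*, that is, if it is not an induced path,
then it contains the vertices of a cycle, which may be added to the configurations counted by `Z'`.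
When `k` of the disjoint blocks of `l` have a contact, this gives `Z ≥ (1 + n * ε) ^ k * Z'`, where
`ε = μ ^ (-B)` bounds from below the weight `lam ^ i` of a cycle of `i ≤ B` edges if `lam ≥ 1 / μ`
(`partialZ_mul_blockWeight_le`, `sum_weight_exp_le`). Exponential moments are therefore controlled
by the sum of `lam ^ m * (1 + n * ε) ^ (-k)` over the self-avoiding walks from a point.

Such a penalty lowers the growth rate of the walks provided that blocks without contact are scarce,
that is, provided that induced paths have a growth rate smaller than `μ`
(`exists_sum_blockWeight_le`). This holds as soon as there is a local surgery: a class of good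
blocks, each of which can be rerouted so as to create a contact, while the *poor* blocks, the
induced paths which are not good, are scarce. Indeed, a walk with few contacts either
consists mostly of poor blocks or admits a number of surgeries proportional to its length, whereas a
walk with few contacts is the result of few surgeries, as these are located by the contact that they
create; so each of a proportional number of successive surgeries at least doubles the number of
walks (`mul_card_fewMarked_le`, `growth_lt_of_surgery`, `exists_card_induced_lt`).

On the cubic lattice, all blocks of four vertices are good: their middle edge is pushed sideways
(`cubicLattice_hasSurgery`). On the hexagonal lattice, the good blocks are those with four
consecutive edges in directions `x, y, x, y`, along which two adjacent hexagons can be bypassed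
(`hexagonalLattice_hasSurgery`). Poor blocks are then coded by words in three letters with
forbidden factors, which grow more slowly than `(7 / 5) ^ N`, while `μ ≥ 8 / 5` by counting
walks directed to the right (`exists_card_poor_lt`, `le_connectiveConstant_hexagonalLattice`).

Finally, the dependence on `n` is obtained by interpolation: some fixed penalty `s₀` per block with
a contact lowers the growth rate from `μ` to `ρ`, so by Hölder's inequality the penalty `s₀ ^ p`
lowers it to `ρ ^ p * μ ^ (1 - p)`. With `p` proportional to `n * ε / (1 + n * ε)`, the penalty
`s₀ ^ p` is at least `1 / (1 + n * ε)`, and the resulting threshold exceeds `1 / μ` by a multiple of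
`n * ε / (1 + n * ε)`, hence by `c₀ * n` up to a term of order `n ^ 2`
(`criticalThreshold_bounds`).
-/

noncomputable section

namespace SAW

/-! ### Self-avoiding walks as lists of vertices -/

/-- A self-avoiding walk, given by the list of its successive vertices. -/
def IsSAW {V : Type*} (G : SimpleGraph V) (l : List V) : Prop :=
  l.IsChain G.Adj ∧ l.Nodup

open Classical in
/-- The walks with `n` steps from `x`, as lists of `n + 1` vertices. -/
def chains {V : Type*} (G : SimpleGraph V) [G.LocallyFinite] : ℕ → V → Finset (List V)
  | 0, x => {[x]}
  | n + 1, x => (G.neighborFinset x).biUnion fun y => (chains G n y).image (List.cons x)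

open Classical in
/-- The self-avoiding walks from `x` that visit `N` vertices (hence make `N - 1` steps; there is
none for `N = 0`). -/
def saws {V : Type*} (G : SimpleGraph V) [G.LocallyFinite] (x : V) (N : ℕ) : Finset (List V) :=
  {l ∈ chains G (N - 1) x | l.Nodup ∧ l.length = N}

lemma IsSAW.infix {V : Type*} {G : SimpleGraph V} {l l' : List V} (h : IsSAW G l)
    (h' : l' <:+: l) : IsSAW G l' :=
  ⟨h.1.infix h', h.2.sublist h'.sublist⟩

section

variable {V : Type*} {G : SimpleGraph V} [G.LocallyFinite]

lemma mem_chains {n : ℕ} {x : V} {l : List V} :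
    l ∈ chains G n x ↔ l.head? = some x ∧ l.length = n + 1 ∧ l.IsChain G.Adj := by
  induction n generalizing x l with
  | zero =>
    rcases l with _ | ⟨a, _ | ⟨b, l⟩⟩ <;> simp [chains]
  | succ n ih =>
    simp only [chains, Finset.mem_biUnion, SimpleGraph.mem_neighborFinset, Finset.mem_image]
    constructor
    · rintro ⟨y, hy, t, ht, rfl⟩
      obtain ⟨h1, h2, h3⟩ := ih.1 ht
      refine ⟨rfl, by simp [h2], ?_⟩
      rcases t with _ | ⟨a, t⟩
      · simp
      · simp only [List.head?_cons, Option.some.injEq] at h1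
        subst h1
        exact List.isChain_cons_cons.2 ⟨hy, h3⟩
    · rintro ⟨h1, h2, h3⟩
      rcases l with _ | ⟨a, _ | ⟨b, l⟩⟩
      · simp at h1
      · simp at h2
      · simp only [List.head?_cons, Option.some.injEq] at h1
        subst h1
        rw [List.isChain_cons_cons] at h3
        exact ⟨b, h3.1, b :: l, ih.2 ⟨rfl, by simpa using h2, h3.2⟩, rfl⟩

lemma mem_saws {N : ℕ} {x : V} {l : List V} :
    l ∈ saws G x N ↔ l.head? = some x ∧ l.length = N ∧ IsSAW G l := by
  simp only [saws, Finset.mem_filter, mem_chains, IsSAW]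
  constructor
  · rintro ⟨⟨h1, h2, h3⟩, h4, h5⟩
    exact ⟨h1, h5, h3, h4⟩
  · rintro ⟨h1, h2, h3, h4⟩
    rcases l with _ | ⟨a, l⟩
    · simp at h1
    · exact ⟨⟨h1, by simp at h2 ⊢; omega, h3⟩, h4, h2⟩

lemma card_saws_le_of_iso (φ : G ≃g G) (x : V) (N : ℕ) :
    (saws G x N).card ≤ (saws G (φ x) N).card := by
  refine Finset.card_le_card_of_injOn (List.map φ) ?_ ?_
  · intro l hl
    obtain ⟨h1, h2, h3, h4⟩ := mem_saws.1 hl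
    refine mem_saws.2 ⟨by simp [h1], by simpa using h2, ?_, h4.map φ.injective⟩
    rw [List.isChain_map]
    exact h3.imp fun a b h => φ.map_adj_iff.2 h
  · exact (List.map_injective_iff.2 φ.injective).injOn

lemma card_saws_eq (htr : ∀ x y : V, ∃ φ : G ≃g G, φ x = y) (x y : V) (N : ℕ) :
    (saws G x N).card = (saws G y N).card := by
  obtain ⟨φ, rfl⟩ := htr x y
  obtain ⟨ψ, h⟩ := htr (φ x) x
  refine le_antisymm (card_saws_le_of_iso φ x N) ?_
  simpa [h] using card_saws_le_of_iso ψ (φ x) N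

lemma card_saws_add_le (htr : ∀ x y : V, ∃ φ : G ≃g G, φ x = y) (x : V) (n m : ℕ) :
    (saws G x (n + m + 1)).card ≤ (saws G x (n + 1)).card * (saws G x (m + 1)).card := by
  classical
  have key : (saws G x (n + m + 1)).card ≤
      ((saws G x (n + 1)).sigma fun l => saws G (l.getLast?.getD x) (m + 1)).card := by
    refine Finset.card_le_card_of_injOn (fun l => ⟨l.take (n + 1), l.drop n⟩) ?_ ?_
    · intro l hl
      obtain ⟨h1, h2, h3⟩ := mem_saws.1 hl
      simp only [Finset.coe_sigma, Set.mem_sigma_iff, Finset.mem_coe]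
      refine ⟨mem_saws.2 ⟨?_, by simp; omega, h3.infix (List.take_prefix _ l).isInfix⟩,
        mem_saws.2 ⟨?_, by simp; omega, h3.infix (List.drop_suffix _ l).isInfix⟩⟩
      · rw [List.head?_take]
        simp [h1]
      · have hn : n < l.length := by omega
        rw [List.head?_drop, List.getLast?_take]
        simp [hn]
    · intro l hl l' hl' h
      simp only [Sigma.mk.injEq, heq_eq_eq] at h
      have e : ∀ l : List V, l = l.take (n + 1) ++ (l.drop n).drop 1 := fun l => by
        rw [List.drop_drop]; exact (List.take_append_drop (n + 1) l).symm
      rw [e l, e l', h.1, h.2]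
  refine key.trans ?_
  rw [Finset.card_sigma]
  rw [Finset.sum_congr rfl fun l _ => card_saws_eq htr (l.getLast?.getD x) x (m + 1)]
  simp

open LoopModel in
lemma ncard_selfAvoidingWalks (x : V) (N : ℕ) :
    (selfAvoidingWalks G x N).ncard = (saws G x (N + 1)).card := by
  have hinj : Function.Injective (List.ofFn : (Fin (N + 1) → V) → List V) :=
    List.ofFn_injective
  rw [← Set.ncard_image_of_injective _ hinj, ← Set.ncard_coe_finset]
  congr 1
  ext l
  simp only [Set.mem_image, Finset.mem_coe, mem_saws, selfAvoidingWalks, Set.mem_ofPred_eq]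
  constructor
  · rintro ⟨ω, ⟨h1, h2, h3⟩, rfl⟩
    refine ⟨by simp [h1], by simp, ?_, List.nodup_ofFn.2 h3⟩
    rw [List.isChain_iff_getElem]
    intro i hi
    have hi' : i < N := by simpa using hi
    simpa [-List.ofFn_succ] using h2 ⟨i, hi'⟩
  · rintro ⟨h1, h2, h3, h4⟩
    rw [List.isChain_iff_getElem] at h3
    refine ⟨fun i => l.get (i.cast h2.symm), ⟨?_, ?_, ?_⟩, ?_⟩
    · rw [List.head?_eq_getElem?, List.getElem?_eq_some_iff] at h1
      obtain ⟨h, h1⟩ := h1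
      simpa using h1
    · intro i
      simpa using h3 i (by omega)
    · intro i j hij
      have := h4.injective_get hij
      simpa [Fin.ext_iff] using this
    · apply List.ext_getElem <;> simp [h2, -List.ofFn_succ]

/-- Fekete's lemma for the number of self-avoiding walks on a transitive graph. -/
lemma exists_connectiveConstant [Nonempty V] (htr : ∀ x y : V, ∃ φ : G ≃g G, φ x = y)
    (hne : ∀ (x : V) (N : ℕ), (saws G x (N + 1)).Nonempty) :
    ∃ μ : ℝ, 1 ≤ μ ∧ LoopModel.IsConnectiveConstant G μ := by
  obtain ⟨o⟩ := ‹Nonempty V›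
  set u : ℕ → ℝ := fun n => Real.log ((saws G o (n + 1)).card) with hu
  have hpos : ∀ n, (1 : ℝ) ≤ ((saws G o (n + 1)).card : ℝ) := fun n => by
    exact_mod_cast Finset.card_pos.2 (hne o n)
  have hsub : Subadditive u := fun m n => by
    have h1 := hpos m
    have h2 := hpos n
    rw [hu]
    simp only
    rw [← Real.log_mul (by positivity) (by positivity)]
    refine Real.log_le_log (by linarith [hpos (m + n)]) ?_
    exact_mod_cast card_saws_add_le htr o m n
  have hbdd : BddBelow (Set.range fun n => u n / n) :=
    ⟨0, by rintro _ ⟨n, rfl⟩; exact div_nonneg (Real.log_nonneg (hpos n)) n.cast_nonneg⟩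
  have hlim := hsub.tendsto_lim hbdd
  have h0 : 0 ≤ hsub.lim := ge_of_tendsto' hlim fun n =>
    div_nonneg (Real.log_nonneg (hpos n)) n.cast_nonneg
  refine ⟨Real.exp hsub.lim, Real.one_le_exp h0, fun x => ?_⟩
  refine ((Real.continuous_exp.tendsto _).comp hlim).congr fun n => ?_
  rw [ncard_selfAvoidingWalks, card_saws_eq htr x o, Real.rpow_def_of_pos (by linarith [hpos n])]
  simp [hu, div_eq_mul_inv]

/-- Walks grow no faster than any rate larger than the connective constant. -/
lemma exists_card_saws_le (htr : ∀ x y : V, ∃ φ : G ≃g G, φ x = y) {μ δ : ℝ} (hδ : 0 < δ)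
    (hμ0 : 0 < μ) (hμ : LoopModel.IsConnectiveConstant G μ) :
    ∃ A : ℝ, 0 < A ∧ ∀ x N, ((saws G x N).card : ℝ) ≤ A * (μ + δ) ^ N := by
  rcases isEmpty_or_nonempty V with hV | ⟨⟨o⟩⟩
  · exact ⟨1, one_pos, fun x => (hV.false x).elim⟩
  have hp : 0 < μ + δ := by linarith
  have h1 := (hμ o).eventually_lt_const (show μ < μ + δ by linarith)
  obtain ⟨n₀, hn₀⟩ := (h1.and (eventually_ge_atTop 1)).exists_forall_of_atTop
  set A : ℝ := 1 + (μ + δ)⁻¹ +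
    ∑ i ∈ Finset.range (n₀ + 1), ((saws G o i).card : ℝ) / (μ + δ) ^ i with hA
  have hs : 0 ≤ ∑ i ∈ Finset.range (n₀ + 1), ((saws G o i).card : ℝ) / (μ + δ) ^ i :=
    Finset.sum_nonneg fun i _ => by positivity
  have hi : 0 < (μ + δ)⁻¹ := by positivity
  refine ⟨A, by linarith, fun x N => ?_⟩
  rw [card_saws_eq htr x o]
  by_cases hN : N ≤ n₀
  · have := Finset.single_le_sum (f := fun i => ((saws G o i).card : ℝ) / (μ + δ) ^ i)
      (fun i _ => by positivity) (Finset.mem_range.2 (Nat.lt_succ_of_le hN))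
    have h2 : ((saws G o N).card : ℝ) / (μ + δ) ^ N ≤ A := by linarith
    rwa [div_le_iff₀ (by positivity)] at h2
  · obtain ⟨n, rfl⟩ : ∃ n, N = n + 1 := ⟨N - 1, by omega⟩
    obtain ⟨h2, h3⟩ := hn₀ n (by omega)
    have hn1 : 1 ≤ n := h3
    rw [ncard_selfAvoidingWalks] at h2
    have h4 : ((saws G o (n + 1)).card : ℝ) ≤ (μ + δ) ^ n := by
      have h5 : ((saws G o (n + 1)).card : ℝ) =
          (((saws G o (n + 1)).card : ℝ) ^ (1 / (n : ℝ))) ^ n := by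
        rw [one_div, Real.rpow_inv_natCast_pow (Nat.cast_nonneg _) (by omega)]
      rw [h5]
      exact pow_le_pow_left₀ (Real.rpow_nonneg (Nat.cast_nonneg _) _) h2.le n
    calc ((saws G o (n + 1)).card : ℝ) ≤ (μ + δ) ^ n := h4
      _ = (μ + δ)⁻¹ * (μ + δ) ^ (n + 1) := by
        rw [pow_succ', inv_mul_cancel_left₀ hp.ne']
      _ ≤ A * (μ + δ) ^ (n + 1) := by gcongr; linarith

end

/-! ### Weighting a walk by the number of its blocks with a given property -/

section

lemma sum_le_sum_of_injOn {α β : Type*} {S : Finset α} {T : Finset β} (i : α → β)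
    (hi : ∀ a ∈ S, i a ∈ T) (inj : Set.InjOn i S) {f : α → ℝ} {g : β → ℝ}
    (hfg : ∀ a ∈ S, f a ≤ g (i a)) (hg : ∀ b ∈ T, 0 ≤ g b) :
    ∑ a ∈ S, f a ≤ ∑ b ∈ T, g b := by
  classical
  calc ∑ a ∈ S, f a ≤ ∑ a ∈ S, g (i a) := Finset.sum_le_sum hfg
    _ = ∑ b ∈ S.image i, g b := (Finset.sum_image inj).symm
    _ ≤ ∑ b ∈ T, g b := Finset.sum_le_sum_of_subset_of_nonneg
        (Finset.image_subset_iff.2 hi) fun b hb _ => hg b hb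

/-- The `i`-th block of `b` consecutive vertices of a walk. -/
def block {V : Type*} (b i : ℕ) (l : List V) : List V := (l.drop (b * i)).take b

open Classical in
/-- The weight `s ^ k`, where `k` is the number of those among the first `q` blocks of `b` vertices
of the walk `l` which satisfy `P`. -/
def blockWeight {V : Type*} (P : List V → Prop) (s : ℝ) (b q : ℕ) (l : List V) : ℝ :=
  ∏ i ∈ Finset.range q, if P (block b i l) then s else 1

lemma blockWeight_nonneg {V : Type*} (P : List V → Prop) {s : ℝ} (hs : 0 ≤ s) (b q : ℕ)
    (l : List V) : 0 ≤ blockWeight P s b q l :=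
  Finset.prod_nonneg fun i _ => by split_ifs <;> positivity

lemma blockWeight_pos {V : Type*} (P : List V → Prop) {s : ℝ} (hs : 0 < s) (b q : ℕ)
    (l : List V) : 0 < blockWeight P s b q l :=
  Finset.prod_pos fun i _ => by split_ifs <;> positivity

open Classical in
lemma blockWeight_succ {V : Type*} (P : List V → Prop) (s : ℝ) (b q : ℕ) (l : List V) :
    blockWeight P s b (q + 1) l =
      (if P (l.take b) then s else 1) * blockWeight P s b q (l.drop b) := by
  rw [blockWeight, Finset.prod_range_succ', mul_comm]
  simp [blockWeight, block, List.drop_drop, Nat.mul_succ, add_comm]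

variable {V : Type*} {G : SimpleGraph V} [G.LocallyFinite]

open Classical in
/-- Cutting walks into blocks: the weighted number of walks is at most the product of the weighted
numbers of blocks. -/
lemma sum_blockWeight_le {P : List V → Prop} {s Q T : ℝ} {b t D : ℕ} (hs : 0 ≤ s)
    (hb : 1 ≤ b) (ht : 1 ≤ t) (hD : ∀ v, G.degree v ≤ D)
    (hQ : ∀ x, D * ∑ X ∈ saws G x b, (if P X then s else 1) ≤ Q)
    (hT : ∀ x, ((saws G x t).card : ℝ) ≤ T) (hT0 : 0 ≤ T) (hQ0 : 0 ≤ Q) (q : ℕ) (x : V) :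
    ∑ l ∈ saws G x (b * q + t), blockWeight P s b q l ≤ Q ^ q * T := by
  induction q generalizing x with
  | zero => simpa [blockWeight] using hT x
  | succ q ih =>
    set w : List V → ℝ := fun X => if P X then s else 1 with hw
    have hw0 : ∀ X, 0 ≤ w X := fun X => by simp only [hw]; split_ifs <;> positivity
    have key : ∑ l ∈ saws G x (b * (q + 1) + t), blockWeight P s b (q + 1) l ≤
        ∑ z ∈ (saws G x b).sigma fun X => (G.neighborFinset (X.getLast?.getD x)).sigma
          fun y => saws G y (b * q + t), w z.1 * blockWeight P s b q z.2.2 := by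
      refine sum_le_sum_of_injOn
        (fun l => ⟨l.take b, ⟨(l.drop b).head?.getD x, l.drop b⟩⟩) ?_ ?_ ?_ ?_
      · intro l hl
        obtain ⟨h1, h2, h3⟩ := mem_saws.1 hl
        have hbl : b < l.length := by
          rw [h2, Nat.mul_succ]; omega
        have hd : (l.drop b).head? = some l[b] := by
          rw [List.head?_drop, List.getElem?_eq_getElem hbl]
        have hl' : (l.take b).getLast? = some l[b - 1] := by
          rw [List.getLast?_take, if_neg (by omega), List.getElem?_eq_getElem (by omega)]
          rfl
        simp only [Finset.mem_sigma]
        refine ⟨mem_saws.2 ⟨?_, ?_, h3.infix (List.take_prefix _ l).isInfix⟩, ?_,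
          mem_saws.2 ⟨?_, ?_, h3.infix (List.drop_suffix _ l).isInfix⟩⟩
        · rw [List.head?_take, if_neg (by omega), h1]
        · rw [List.length_take]; omega
        · rw [hd, hl', SimpleGraph.mem_neighborFinset]
          have := (List.isChain_iff_getElem.1 h3.1) (b - 1) (by omega)
          simpa [Nat.sub_add_cancel hb] using this
        · rw [hd]; rfl
        · rw [List.length_drop, h2, Nat.mul_succ]; omega
      · intro l _ l' _ h
        simp only [Sigma.mk.injEq] at h
        obtain ⟨h1, h2⟩ := h
        have h3 : l.drop b = l'.drop b := by
          have := eq_of_heq h2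
          simp only [Sigma.mk.injEq, heq_eq_eq] at this
          exact this.2
        rw [← List.take_append_drop b l, ← List.take_append_drop b l', h1, h3]
      · intro l _
        rw [blockWeight_succ]
      · intro z _
        exact mul_nonneg (hw0 _) (blockWeight_nonneg P hs _ _ _)
    refine key.trans ?_
    rw [Finset.sum_sigma]
    have h1 : ∀ X ∈ saws G x b, ∑ z ∈ (G.neighborFinset (X.getLast?.getD x)).sigma
          (fun y => saws G y (b * q + t)), w X * blockWeight P s b q z.2 ≤
          w X * (D * (Q ^ q * T)) := by
      intro X _
      rw [← Finset.mul_sum, Finset.sum_sigma]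
      refine mul_le_mul_of_nonneg_left ?_ (hw0 X)
      calc _ ≤ ∑ y ∈ G.neighborFinset (X.getLast?.getD x), Q ^ q * T :=
            Finset.sum_le_sum fun y _ => ih y
        _ = (G.degree (X.getLast?.getD x)) * (Q ^ q * T) := by simp
        _ ≤ D * (Q ^ q * T) := by
          gcongr
          exact hD _
    refine (Finset.sum_le_sum h1).trans ?_
    rw [← Finset.sum_mul]
    calc _ = (D * ∑ X ∈ saws G x b, w X) * (Q ^ q * T) := by ring
      _ ≤ Q * (Q ^ q * T) := by gcongr; exact hQ x
      _ = Q ^ (q + 1) * T := by ring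

open Classical in
/-- If the blocks which do not satisfy `P` are too few to sustain the growth rate `μ`, then giving
a small weight `s` to each block satisfying `P` lowers the growth rate. -/
lemma exists_sum_blockWeight_le (htr : ∀ x y : V, ∃ φ : G ≃g G, φ x = y) {μ : ℝ}
    (hμ0 : 0 < μ) (hμ : LoopModel.IsConnectiveConstant G μ) {P : List V → Prop} {b D r : ℕ}
    (hb : 1 ≤ b) (hD : ∀ v, G.degree v ≤ D)
    (hr : ∀ x, {X ∈ saws G x b | ¬ P X}.card ≤ r) (hrμ : (D * r : ℝ) < μ ^ b) {s₁ : ℝ}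
    (hs₁ : 0 < s₁) :
    ∃ s : ℝ, 0 < s ∧ s ≤ s₁ ∧ s ≤ 1 ∧ ∃ ρ : ℝ, 0 < ρ ∧ ρ < μ ∧ ∃ A : ℝ, 0 < A ∧
      ∀ x N, 1 ≤ N → ∑ l ∈ saws G x N, blockWeight P s b ((N - 1) / b) l ≤ A * ρ ^ N := by
  obtain ⟨A, hA, hcard⟩ := exists_card_saws_le htr one_pos hμ0 hμ
  set c : ℝ := A * (μ + 1) ^ b with hc
  have hc0 : 0 < c := by positivity
  set s : ℝ := min (min s₁ 1) ((μ ^ b - D * r) / (2 * (D * c + 1))) with hs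
  have hs0 : 0 < s := lt_min (lt_min hs₁ one_pos) (div_pos (by linarith) (by positivity))
  have hs2 : s * (D * c + 1) ≤ (μ ^ b - D * r) / 2 := by
    have : s ≤ (μ ^ b - D * r) / (2 * (D * c + 1)) := min_le_right _ _
    rw [le_div_iff₀ (by positivity)] at this
    linarith
  -- the weighted number of blocks times the number of ways to continue a walk; the second term
  -- only ensures positivity
  set Q : ℝ := max (D * (r + s * c)) (μ ^ b / 2) with hQ
  have hμb : 0 < μ ^ b := by positivity
  have hQlt : Q < μ ^ b := max_lt (by nlinarith) (by linarith)
  have hQ0 : 0 < Q := lt_of_lt_of_le (by positivity) (le_max_right _ _)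
  set ρ : ℝ := Q ^ (1 / (b : ℝ)) with hρ
  have hρb : ρ ^ b = Q := by
    rw [hρ, one_div, Real.rpow_inv_natCast_pow hQ0.le (by omega)]
  have hρ0 : 0 < ρ := Real.rpow_pos_of_pos hQ0 _
  have hρμ : ρ < μ := lt_of_pow_lt_pow_left₀ b hμ0.le (by rwa [hρb])
  refine ⟨s, hs0, (min_le_left _ _).trans (min_le_left _ _),
    (min_le_left _ _).trans (min_le_right _ _), ρ, hρ0, hρμ, (1 + ρ⁻¹) ^ b * c,
    by positivity, fun x N hN => ?_⟩
  set q := (N - 1) / b with hq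
  set t := N - b * q with ht
  have hdm := Nat.div_add_mod (N - 1) b
  have hlt := Nat.mod_lt (N - 1) (show 0 < b by omega)
  rw [← hq] at hdm
  have hNq : N = b * q + t := by omega
  have ht1 : 1 ≤ t := by omega
  have htb : t ≤ b := by omega
  have hT : ∀ x, ((saws G x t).card : ℝ) ≤ c := fun x => (hcard x t).trans (by
    rw [hc]; gcongr; linarith)
  have hQx : ∀ x, D * ∑ X ∈ saws G x b, (if P X then s else 1) ≤ Q := fun x => by
    refine le_trans ?_ (le_max_left _ _)
    gcongr
    rw [Finset.sum_ite, add_comm]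
    refine add_le_add ?_ ?_
    · simpa using hr x
    · rw [Finset.sum_const, nsmul_eq_mul, mul_comm]
      gcongr
      exact (Nat.cast_le.2 (Finset.card_filter_le _ _)).trans (hcard x b)
  have h1 := sum_blockWeight_le hs0.le hb ht1 hD hQx hT hc0.le hQ0.le q x
  rw [← hNq] at h1
  refine h1.trans ?_
  have h2 : Q ^ q = ρ ^ N * (ρ⁻¹) ^ t := by
    rw [← hρb, ← pow_mul, hNq, pow_add, inv_pow, mul_assoc, mul_inv_cancel₀ (by positivity),
      mul_one]
  have h3 : (ρ⁻¹) ^ t ≤ (1 + ρ⁻¹) ^ b := by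
    have h0 : 0 < ρ⁻¹ := by positivity
    calc (ρ⁻¹) ^ t ≤ (1 + ρ⁻¹) ^ t := by gcongr; linarith
      _ ≤ (1 + ρ⁻¹) ^ b := by gcongr; linarith
  rw [h2]
  calc ρ ^ N * (ρ⁻¹) ^ t * c ≤ ρ ^ N * (1 + ρ⁻¹) ^ b * c := by gcongr
    _ = (1 + ρ⁻¹) ^ b * c * ρ ^ N := by ring

end

/-! ### Contacts and local surgery -/

/-- `v` is a contact of the walk `l`: it has a neighbour on `l` which does not come right before or
right after it. A walk without contacts is an induced path of the graph. -/
def IsContact {V : Type*} (G : SimpleGraph V) (l : List V) (v : V) : Prop :=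
  v ∈ l ∧ ∃ w ∈ l, G.Adj v w ∧ ¬ [v, w] <:+: l ∧ ¬ [w, v] <:+: l

/-- `v` is at distance at most two from an endpoint of `l`. -/
def NearEnd {V : Type*} (G : SimpleGraph V) (l : List V) (v : V) : Prop :=
  ∃ e, (l.head? = some e ∨ l.getLast? = some e) ∧
    (v = e ∨ G.Adj v e ∨ ∃ w, G.Adj v w ∧ G.Adj w e)

open Classical in
/-- The vertices of `l` in whose neighbourhood no surgery is attempted: the contacts, and the
vertices close to the endpoints. -/
def marked {V : Type*} (G : SimpleGraph V) (l : List V) : Finset V :=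
  {v ∈ l.toFinset | IsContact G l v ∨ NearEnd G l v}

/-- A block is poor if it has no contact and does not belong to the class `good`. -/
def Poor {V : Type*} (G : SimpleGraph V) (good : List V → Prop) (X : List V) : Prop :=
  (∀ v, ¬ IsContact G X v) ∧ ¬ good X

/-- In any walk, a good block `X` of `b` vertices, all unmarked, can be replaced by a segment `X'`
with the same endpoints and at most `E` more vertices, which creates a contact. -/
def HasSurgery {V : Type*} (G : SimpleGraph V) (good : List V → Prop) (b E : ℕ) : Prop :=
  ∀ P X Q : List V, X.length = b → IsSAW G (P ++ X ++ Q) → good X →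
    (∀ v ∈ X, v ∉ marked G (P ++ X ++ Q)) →
    ∃ X' : List V, b < X'.length ∧ X'.length ≤ b + E ∧ X'.head? = X.head? ∧
      X'.getLast? = X.getLast? ∧ IsSAW G (P ++ X' ++ Q) ∧ ∃ v ∈ X', v ∈ marked G (P ++ X' ++ Q)

section Lists

variable {V : Type*}

lemma pair_infix_append {A B : List V} {v w : V} (h : [v, w] <:+: A ++ B) :
    [v, w] <:+: A ∨ [v, w] <:+: B ∨ (A.getLast? = some v ∧ B.head? = some w) := by
  induction A with
  | nil => exact Or.inr (Or.inl h)
  | cons a A ih =>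
    rw [List.cons_append, List.infix_cons_iff] at h
    rcases h with h | h
    · rw [List.cons_prefix_cons] at h
      obtain ⟨rfl, h⟩ := h
      rcases A with _ | ⟨c, A⟩
      · rcases B with _ | ⟨d, B⟩
        · simp at h
        · simp at h
          subst h
          simp
      · simp at h
        subst h
        exact Or.inl ⟨[], A, by simp⟩
    · rcases ih h with h | h | ⟨h, h'⟩
      · exact Or.inl (h.trans (List.suffix_cons a A).isInfix)
      · exact Or.inr (Or.inl h)
      · refine Or.inr (Or.inr ⟨?_, h'⟩)
        rw [List.getLast?_cons, h]
        rfl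

lemma pair_infix_of_mem {P X Q : List V} {v w : V} (hn : (P ++ X ++ Q).Nodup) (hv : v ∈ X)
    (hw : w ∈ X) (h : [v, w] <:+: P ++ X ++ Q) : [v, w] <:+: X := by
  have hP : ∀ u ∈ P, u ∉ X := fun u hu hX => by
    rw [List.append_assoc] at hn
    exact List.disjoint_of_nodup_append hn hu (by simp [hX])
  have hQ : ∀ u ∈ Q, u ∉ X := fun u hu hX =>
    List.disjoint_of_nodup_append hn (by simp [hX]) hu
  rcases pair_infix_append h with h | h | ⟨_, h⟩
  · rcases pair_infix_append h with h | h | ⟨h, _⟩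
    · exact (hP v (h.subset (by simp)) hv).elim
    · exact h
    · exact (hP v (List.mem_of_getLast? h) hv).elim
  · exact (hQ v (h.subset (by simp)) hv).elim
  · exact (hQ w (List.mem_of_head? h) hw).elim

lemma pair_infix_replace {P X X' Q : List V} {v w : V} (hX : X ≠ []) (hv : v ∉ X) (hw : w ∉ X)
    (h : [v, w] <:+: P ++ X ++ Q) : [v, w] <:+: P ++ X' ++ Q := by
  rcases pair_infix_append h with h | h | ⟨h, _⟩
  · rcases pair_infix_append h with h | h | ⟨_, h⟩
    · exact h.trans ⟨[], X' ++ Q, by simp⟩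
    · exact (hv (h.subset (by simp))).elim
    · exact (hw (List.mem_of_head? h)).elim
  · exact h.trans ⟨P ++ X', [], by simp⟩
  · rw [List.getLast?_append_of_ne_nil _ hX] at h
    exact (hv (List.mem_of_getLast? h)).elim

lemma idxOf_div_eq_of_mem_block [DecidableEq V] {b i : ℕ} {l : List V} {v : V} (hl : l.Nodup)
    (hv : v ∈ block b i l) : l.idxOf v / b = i := by
  rw [block, List.mem_iff_getElem] at hv
  obtain ⟨n, hn, rfl⟩ := hv
  simp only [List.length_take, List.length_drop] at hn
  rw [List.getElem_take, List.getElem_drop, hl.idxOf_getElem,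
    Nat.mul_add_div (by omega), Nat.div_eq_of_lt (by omega), add_zero]

lemma take_append_block_append_drop (b i : ℕ) (l : List V) :
    l.take (b * i) ++ block b i l ++ l.drop (b * i + b) = l := by
  rw [block, List.append_assoc, ← List.drop_drop, List.take_append_drop, List.take_append_drop]

end Lists

section

variable {V : Type*} {G : SimpleGraph V}

lemma mem_marked {l : List V} {v : V} :
    v ∈ marked G l ↔ v ∈ l ∧ (IsContact G l v ∨ NearEnd G l v) := by
  simp [marked]

lemma not_isContact_of_unmarked {P X Q : List V} (hs : IsSAW G (P ++ X ++ Q))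
    (h : ∀ v ∈ X, v ∉ marked G (P ++ X ++ Q)) (v : V) : ¬ IsContact G X v := by
  rintro ⟨hv, w, hw, hvw, h1, h2⟩
  refine h v hv (mem_marked.2 ⟨by simp [hv], Or.inl ⟨by simp [hv], w, by simp [hw], hvw, ?_, ?_⟩⟩)
  · exact fun h' => h1 (pair_infix_of_mem hs.2 hv hw h')
  · exact fun h' => h2 (pair_infix_of_mem hs.2 hw hv h')

open Classical in
lemma card_marked_blocks_le {l : List V} (hl : l.Nodup) (b q : ℕ) :
    {i ∈ Finset.range q | ∃ v ∈ block b i l, v ∈ marked G l}.card ≤ (marked G l).card := by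
  rcases isEmpty_or_nonempty V with hV | hV
  · simp
  choose! f hf hf' using fun (i : ℕ) (h : ∃ v ∈ block b i l, v ∈ marked G l) => h
  refine Finset.card_le_card_of_injOn f (fun i hi => hf' i (Finset.mem_filter.1 hi).2) ?_
  intro i hi j hj hij
  rw [← idxOf_div_eq_of_mem_block hl (hf i (Finset.mem_filter.1 hi).2), hij,
    idxOf_div_eq_of_mem_block hl (hf j (Finset.mem_filter.1 hj).2)]

open Classical in
/-- The number of those among the first `q` blocks of `b` vertices of `l` which are not poor. -/
def numNotPoor (G : SimpleGraph V) (good : List V → Prop) (b q : ℕ) (l : List V) : ℕ :=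
  {i ∈ Finset.range q | ¬ Poor G good (block b i l)}.card

open Classical in
/-- The indices of the blocks at which a surgery is possible. -/
def surgerySites (G : SimpleGraph V) (good : List V → Prop) (b q : ℕ) (l : List V) : Finset ℕ :=
  {i ∈ Finset.range q | good (block b i l) ∧ ∀ v ∈ block b i l, v ∉ marked G l}

lemma lt_card_surgerySites {good : List V → Prop} {b q k m : ℕ} {l : List V} (hl : IsSAW G l)
    (hk : (marked G l).card ≤ k) (hm : k + m < numNotPoor G good b q l) :
    m < (surgerySites G good b q l).card := by
  classical
  have h1 : {i ∈ Finset.range q | ¬ Poor G good (block b i l)} ⊆ surgerySites G good b q l ∪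
      {i ∈ Finset.range q | ∃ v ∈ block b i l, v ∈ marked G l} := by
    intro i hi
    obtain ⟨hiq, hp⟩ := Finset.mem_filter.1 hi
    rw [Finset.mem_union, surgerySites, Finset.mem_filter, Finset.mem_filter]
    by_cases hu : ∃ v ∈ block b i l, v ∈ marked G l
    · exact Or.inr ⟨hiq, hu⟩
    · push Not at hu
      refine Or.inl ⟨hiq, ?_, hu⟩
      by_contra hg
      have e := take_append_block_append_drop b i l
      refine hp ⟨not_isContact_of_unmarked (P := l.take (b * i)) (Q := l.drop (b * i + b)) ?_ ?_,
        hg⟩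
      · rwa [e]
      · rwa [e]
  have h2 := Finset.card_le_card h1
  have h3 := Finset.card_union_le (surgerySites G good b q l)
    {i ∈ Finset.range q | ∃ v ∈ block b i l, v ∈ marked G l}
  have h4 := card_marked_blocks_le (G := G) hl.2 b q
  unfold numNotPoor at hm
  omega

open Classical in
/-- The positions at most `M` steps before a marked vertex. -/
def beforeMarked (G : SimpleGraph V) (M : ℕ) (l : List V) : Finset ℕ :=
  (marked G l ×ˢ Finset.range M).image fun z => l.idxOf z.1 - z.2

lemma card_beforeMarked_le (M : ℕ) (l : List V) :
    (beforeMarked G M l).card ≤ (marked G l).card * M := by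
  classical
  refine Finset.card_image_le.trans ?_
  simp

variable [G.LocallyFinite]

open Classical in
/-- A surgery only creates marked vertices next to the new segment. -/
lemma marked_replace_subset {P X X' Q : List V} (hX : X ≠ []) (hs : IsSAW G (P ++ X ++ Q))
    (hh : X'.head? = X.head?) (hl : X'.getLast? = X.getLast?) :
    marked G (P ++ X' ++ Q) ⊆ marked G (P ++ X ++ Q) ∪
      (X'.toFinset ∪ X'.toFinset.biUnion fun v => G.neighborFinset v) := by
  intro v hv
  by_contra hcon
  simp only [Finset.mem_union, Finset.mem_biUnion, List.mem_toFinset, not_or, not_exists,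
    not_and, SimpleGraph.mem_neighborFinset] at hcon
  obtain ⟨h1, h2, h3⟩ := hcon
  have hmem : ∀ u ∈ P ++ X' ++ Q, u ∉ X' → u ∈ P ++ X ++ Q ∧ u ∉ X := by
    intro u hu hu'
    have hu2 : u ∈ P ∨ u ∈ Q := by simpa [hu'] using hu
    refine ⟨by rcases hu2 with h | h <;> simp [h], fun hX => ?_⟩
    rcases hu2 with h | h
    · have := hs.2
      rw [List.append_assoc] at this
      exact List.disjoint_of_nodup_append this h (by simp [hX])
    · exact List.disjoint_of_nodup_append hs.2 (by simp [hX]) h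
  obtain ⟨hv1, hv2⟩ := mem_marked.1 hv
  obtain ⟨hv3, hv4⟩ := hmem v hv1 h2
  refine h1 (mem_marked.2 ⟨hv3, ?_⟩)
  rcases hv2 with ⟨_, w, hw, hvw, ha, hb⟩ | ⟨e, he, hve⟩
  · have hw' : w ∉ X' := fun h => h3 w h hvw.symm
    obtain ⟨hw3, hw4⟩ := hmem w hw hw'
    exact Or.inl ⟨hv3, w, hw3, hvw, fun h => ha (pair_infix_replace hX hv4 hw4 h),
      fun h => hb (pair_infix_replace hX hw4 hv4 h)⟩
  · refine Or.inr ⟨e, ?_, hve⟩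
    simpa [List.head?_append, List.getLast?_append, hh, hl] using he

open Classical in
lemma card_marked_replace_le {P X X' Q : List V} (hX : X ≠ []) (hs : IsSAW G (P ++ X ++ Q))
    (hh : X'.head? = X.head?) (hl : X'.getLast? = X.getLast?) {D M : ℕ}
    (hD : ∀ v, G.degree v ≤ D) (hM : X'.length ≤ M) :
    (marked G (P ++ X' ++ Q)).card ≤ (marked G (P ++ X ++ Q)).card + M * (D + 1) := by
  refine (Finset.card_le_card (marked_replace_subset hX hs hh hl)).trans ?_
  refine (Finset.card_union_le _ _).trans ?_
  gcongr
  refine (Finset.card_union_le _ _).trans ?_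
  have h1 : X'.toFinset.card ≤ M := (List.toFinset_card_le X').trans hM
  have h2 : (X'.toFinset.biUnion fun v => G.neighborFinset v).card ≤ X'.toFinset.card * D :=
    Finset.card_biUnion_le_card_mul _ _ _ fun v _ => hD v
  nlinarith [Nat.mul_le_mul_right D h1]

open Classical in
/-- The walks from `x` with `N` vertices and at most `k` marked vertices. -/
def fewMarked (G : SimpleGraph V) [G.LocallyFinite] (x : V) (N k : ℕ) : Finset (List V) :=
  {l ∈ saws G x N | (marked G l).card ≤ k}

open Classical in
/-- The walks from `x` with `N` vertices of which at most `k` among the first `q` blocks are not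
poor. -/
def mostlyPoor (G : SimpleGraph V) [G.LocallyFinite] (good : List V → Prop) (b q : ℕ) (x : V)
    (N k : ℕ) : Finset (List V) :=
  {l ∈ saws G x N | numNotPoor G good b q l ≤ k}

/-- Double counting of surgeries: the walk before a surgery is determined by the walk after it, the
position of the new segment, which is close to a marked vertex, and the replaced block. -/
lemma mul_card_fewMarked_le {good : List V → Prop} {b E D c : ℕ} (hb : 1 ≤ b)
    (hsurg : HasSurgery G good b E) (hD : ∀ v, G.degree v ≤ D)
    (hc : ∀ x, (saws G x b).card ≤ c) (x : V) (N k m q : ℕ) (hq : b * q ≤ N) :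
    m * (fewMarked G x N k).card ≤ m * (mostlyPoor G good b q x N (k + m)).card +
      (k + (b + E) * (D + 1)) * (b + E) * c *
        ∑ e ∈ Finset.Icc 1 E, (fewMarked G x (N + e) (k + (b + E) * (D + 1))).card := by
  classical
  set C := (b + E) * (D + 1) with hC
  set S := fewMarked G x N k \ mostlyPoor G good b q x N (k + m) with hS
  have hSmem : ∀ l ∈ S, l ∈ saws G x N ∧ (marked G l).card ≤ k ∧
      k + m < numNotPoor G good b q l := by
    intro l hl
    simp only [hS, fewMarked, mostlyPoor, Finset.mem_sdiff, Finset.mem_filter] at hl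
    exact ⟨hl.1.1, hl.1.2, by by_contra h; exact hl.2 ⟨hl.1.1, by omega⟩⟩
  have h1 : (fewMarked G x N k).card ≤
      (mostlyPoor G good b q x N (k + m)).card + S.card := by
    rw [add_comm]; exact Finset.card_le_card_sdiff_add_card
  have h2 : m * S.card ≤ (S.sigma fun l => surgerySites G good b q l).card := by
    rw [Finset.card_sigma, mul_comm, ← smul_eq_mul]
    refine Finset.card_nsmul_le_sum _ _ _ fun l hl => ?_
    obtain ⟨h1, h2, h3⟩ := hSmem l hl
    exact (lt_card_surgerySites (mem_saws.1 h1).2.2 h2 h3).le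
  -- choice of a new segment for each surgery
  have hex : ∀ (l : List V) (i : ℕ), l ∈ S → i ∈ surgerySites G good b q l → ∃ X' : List V,
      b < X'.length ∧ X'.length ≤ b + E ∧ X'.head? = (block b i l).head? ∧
      X'.getLast? = (block b i l).getLast? ∧
      IsSAW G (l.take (b * i) ++ X' ++ l.drop (b * i + b)) ∧
      ∃ v ∈ X', v ∈ marked G (l.take (b * i) ++ X' ++ l.drop (b * i + b)) := by
    intro l i hl hi
    obtain ⟨h1, h2, h3⟩ := hSmem l hl
    obtain ⟨h4, h5, h6⟩ := mem_saws.1 h1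
    obtain ⟨hiq, hg, hu⟩ := Finset.mem_filter.1 hi
    have e := take_append_block_append_drop b i l
    have hib : b * i + b ≤ N := by
      have := Finset.mem_range.1 hiq
      nlinarith
    refine hsurg _ _ _ ?_ ?_ hg ?_
    · simp only [block, List.length_take, List.length_drop]; omega
    · rwa [e]
    · rwa [e]
  choose! X' hX1 hX2 hX3 hX4 hX5 hX6 using hex
  set new : List V → ℕ → List V := fun l i => l.take (b * i) ++ X' l i ++ l.drop (b * i + b)
    with hnew
  have hlen : ∀ l i, l ∈ S → i ∈ surgerySites G good b q l →
      (l.take (b * i)).length = b * i ∧ (block b i l).length = b ∧ l.length = N := by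
    intro l i hl hi
    obtain ⟨h1, h2, h3⟩ := hSmem l hl
    obtain ⟨h4, h5, h6⟩ := mem_saws.1 h1
    obtain ⟨hiq, hg, hu⟩ := Finset.mem_filter.1 hi
    have hib : b * i + b ≤ N := by
      have := Finset.mem_range.1 hiq
      nlinarith
    simp only [block, List.length_take, List.length_drop]
    omega
  -- the number of added vertices, the new walk, the position of the segment and the old block
  -- determine the surgery
  have h3 : (S.sigma fun l => surgerySites G good b q l).card ≤
      ((Finset.Icc 1 E).sigma fun e => (fewMarked G x (N + e) (k + C)).sigma fun ω =>
        (beforeMarked G (b + E) ω).sigma fun p => saws G (ω[p]?.getD x) b).card := by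
    refine Finset.card_le_card_of_injOn (fun z => ⟨(X' z.1 z.2).length - b,
      ⟨new z.1 z.2, ⟨b * z.2, block b z.2 z.1⟩⟩⟩) ?_ ?_
    · rintro ⟨l, i⟩ hz
      simp only [Finset.coe_sigma, Set.mem_sigma_iff, Finset.mem_coe] at hz
      obtain ⟨hl, hi⟩ := hz
      obtain ⟨g1, g2, g3⟩ := hSmem l hl
      obtain ⟨g4, g5, g6⟩ := mem_saws.1 g1
      obtain ⟨e1, e2, e3⟩ := hlen l i hl hi
      have e := take_append_block_append_drop b i l
      have hbl : (block b i l) ≠ [] := by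
        intro h; rw [h] at e2; simp at e2; omega
      have hX0 := hX1 l i hl hi
      have hXE := hX2 l i hl hi
      have hXne : X' l i ≠ [] := by
        intro h; rw [h] at hX0; simp at hX0
      have hib : b * i + b ≤ N := by
        have := Finset.mem_range.1 (Finset.mem_filter.1 hi).1
        nlinarith
      simp only [Finset.mem_coe, Finset.mem_sigma, Finset.mem_Icc]
      refine ⟨by omega, ?_, ?_, ?_⟩
      · refine Finset.mem_filter.2 ⟨mem_saws.2 ⟨?_, ?_, hX5 l i hl hi⟩, ?_⟩
        · rw [← g4]
          conv_rhs => rw [← e]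
          simp [hnew, List.head?_append, hX3 l i hl hi]
        · simp only [hnew, List.length_append, e1, List.length_drop]
          omega
        · have := card_marked_replace_le (G := G) hbl (by rwa [e]) (hX3 l i hl hi)
            (hX4 l i hl hi) hD hXE
          rw [e] at this
          exact this.trans (by omega)
      · obtain ⟨v, hv, hv'⟩ := hX6 l i hl hi
        obtain ⟨n, hn, rfl⟩ := List.mem_iff_getElem.1 hv
        refine Finset.mem_image.2 ⟨((X' l i)[n], n), ?_, ?_⟩
        · simp only [Finset.mem_product, Finset.mem_range]
          exact ⟨hv', by omega⟩
        · have h7 : (new l i)[b * i + n]'(by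
              simp only [hnew, List.length_append, e1]; omega) = (X' l i)[n] := by
            simp only [hnew]
            rw [List.getElem_append_left (by simp only [List.length_append, e1]; omega),
              List.getElem_append_right (by omega)]
            congr 1; omega
          simp only
          rw [← h7, (hX5 l i hl hi).2.idxOf_getElem]
          omega
      · refine mem_saws.2 ⟨?_, e2, (by rwa [e] : IsSAW G (l.take (b * i) ++ block b i l ++
          l.drop (b * i + b))).infix ⟨_, _, rfl⟩⟩
        have h8 : (new l i)[b * i]? = (X' l i).head? := by
          simp only [hnew]
          rw [List.append_assoc, List.getElem?_append_right (by omega), e1, Nat.sub_self,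
            ← List.head?_eq_getElem?, List.head?_append_of_ne_nil _ hXne]
        rw [h8, hX3 l i hl hi]
        obtain ⟨a, t, hat⟩ := List.exists_cons_of_ne_nil hbl
        rw [hat]; rfl
    · rintro ⟨l, i⟩ hz ⟨l', i'⟩ hz' heq
      simp only [Finset.coe_sigma, Set.mem_sigma_iff, Finset.mem_coe] at hz hz'
      simp only [Sigma.mk.injEq, heq_eq_eq] at heq
      obtain ⟨q1, q2, q3, q4⟩ := heq
      have hii : i = i' := Nat.eq_of_mul_eq_mul_left (by omega) q3
      subst hii
      obtain ⟨e1, e2, e3⟩ := hlen l i hz.1 hz.2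
      obtain ⟨e1', e2', e3'⟩ := hlen l' i hz'.1 hz'.2
      have l1 := hX1 l i hz.1 hz.2
      have l2 := hX1 l' i hz'.1 hz'.2
      have hXX : (X' l i).length = (X' l' i).length := by omega
      simp only [hnew] at q2
      have q5 := List.append_inj q2 (by simp [e1, e1', hXX])
      have q6 := List.append_inj q5.1 (by rw [e1, e1'])
      have hll : l = l' := by
        rw [← take_append_block_append_drop b i l, ← take_append_block_append_drop b i l',
          q4, q5.2, q6.1]
      subst hll
      rfl
  have h4 : ((Finset.Icc 1 E).sigma fun e => (fewMarked G x (N + e) (k + C)).sigma fun ω =>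
        (beforeMarked G (b + E) ω).sigma fun p => saws G (ω[p]?.getD x) b).card ≤
      (k + C) * (b + E) * c * ∑ e ∈ Finset.Icc 1 E, (fewMarked G x (N + e) (k + C)).card := by
    rw [Finset.card_sigma, Finset.mul_sum]
    refine Finset.sum_le_sum fun e _ => ?_
    rw [Finset.card_sigma, mul_comm, ← smul_eq_mul]
    refine Finset.sum_le_card_nsmul _ _ _ fun ω hω => ?_
    rw [Finset.card_sigma]
    calc ∑ p ∈ beforeMarked G (b + E) ω, (saws G (ω[p]?.getD x) b).card
        ≤ ∑ p ∈ beforeMarked G (b + E) ω, c := Finset.sum_le_sum fun p _ => hc _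
      _ = (beforeMarked G (b + E) ω).card * c := by simp
      _ ≤ (k + C) * (b + E) * c := by
        gcongr
        refine (card_beforeMarked_le _ _).trans ?_
        gcongr
        exact (Finset.mem_filter.1 hω).2
  calc m * (fewMarked G x N k).card
      ≤ m * ((mostlyPoor G good b q x N (k + m)).card + S.card) := Nat.mul_le_mul_left m h1
    _ = m * (mostlyPoor G good b q x N (k + m)).card + m * S.card := by ring
    _ ≤ _ := Nat.add_le_add_left (h2.trans (h3.trans h4)) _

end

/-! ### Induced paths grow more slowly than self-avoiding walks -/

section

/-- The iteration of the surgery inequality `h2`. Here `F N k` stands for the number of walks with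
`N` vertices of which at most `k` are marked, and `R N k` for the number of walks with few blocks
that are not poor. A number of surgeries proportional to `N` can be made, each of them at least
doubling the number of walks. -/
lemma growth_lt_of_surgery {F R : ℕ → ℕ → ℝ} {μ ε ρ A₁ : ℝ} {C K E : ℕ} (hμ : 1 ≤ μ)
    (h1 : ∀ δ : ℝ, 0 < δ → ∃ A : ℝ, 0 < A ∧ ∀ N k, F N k ≤ A * (μ + δ) ^ N)
    (h2 : ∀ N k m : ℕ, 1 ≤ N → m * F N k ≤ m * R N (k + m) +
      (k + C) * K * ∑ e ∈ Finset.Icc 1 E, F (N + e) (k + C))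
    (hε : 0 < ε) (hρ0 : 0 < ρ) (hρ : ρ < μ) (hA₁ : 0 < A₁)
    (hR : ∀ N M : ℕ, 1 ≤ N → (M : ℝ) ≤ ε * N → R N M ≤ A₁ * ρ ^ N) (C₀ : ℕ) :
    ∃ ρ' : ℝ, 0 < ρ' ∧ ρ' < μ ∧ ∃ A : ℝ, 0 < A ∧ ∀ N, 1 ≤ N → F N C₀ ≤ A * ρ' ^ N := by
  -- `Λ` bounds the cost of the additional vertices, and `η * N` surgeries are made
  set Λ : ℝ := E * (μ + 1) ^ E + 1 with hΛ
  have hΛ1 : 1 ≤ Λ := by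
    have : 0 ≤ (E : ℝ) * (μ + 1) ^ E := by positivity
    linarith
  set η : ℝ := ε / (8 * Λ * (C * K + C + 1)) with hη
  have hη0 : 0 < η := by positivity
  have hηeq : η * Λ * (C * K + C + 1) = ε / 8 := by rw [hη]; field_simp
  have hη1 : C * K * η * Λ ≤ ε / 8 := by
    rw [← hηeq]
    have h : 0 ≤ η * Λ * (C + 1) := by positivity
    linarith [h]
  have hη2 : C * η ≤ ε / 8 := by
    have h3 : C * η * Λ ≤ ε / 8 := by
      rw [← hηeq]
      have h : 0 ≤ η * Λ * (C * K + 1) := by positivity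
      linarith [h]
    have h4 : C * η * 1 ≤ C * η * Λ := by gcongr
    linarith
  have h2η : 1 < (2 : ℝ) ^ η := Real.one_lt_rpow (by norm_num) hη0
  -- `δ` is so small that the gain `2 ^ (η * N)` beats the error in the growth rate
  set δ : ℝ := min 1 (μ * (2 ^ η - 1) / 2) with hδ
  have hδ0 : 0 < δ := lt_min one_pos (by have : 0 < (2 : ℝ) ^ η - 1 := by linarith
                                         positivity)
  have hδ1 : δ ≤ 1 := min_le_left _ _
  have hδ2 : μ + δ < μ * 2 ^ η := by
    have : δ ≤ μ * (2 ^ η - 1) / 2 := min_le_right _ _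
    nlinarith
  obtain ⟨A, hA, hF⟩ := h1 δ hδ0
  set ρ₂ : ℝ := (μ + δ) / 2 ^ η with hρ₂
  have hρ₂0 : 0 < ρ₂ := by positivity
  have hρ₂μ : ρ₂ < μ := by rw [hρ₂, div_lt_iff₀ (by positivity)]; exact hδ2
  obtain ⟨N₀, hN₀⟩ := exists_nat_gt ((8 * Λ * C₀ * K + 8 * (C₀ + 1)) / ε)
  have hlarge : ∀ N : ℕ, N₀ ≤ N → 8 * Λ * C₀ * K + 8 * (C₀ + 1) ≤ ε * N := by
    intro N hN
    rw [div_lt_iff₀ hε] at hN₀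
    have : (N₀ : ℝ) ≤ N := by exact_mod_cast hN
    nlinarith
  -- the bound for large `N`
  have main : ∀ N : ℕ, 1 ≤ N → N₀ ≤ N → F N C₀ ≤ (2 * A₁ + 2 * A) * (max ρ ρ₂) ^ N := by
    intro N hN1 hN
    have hl := hlarge N hN
    set J := ⌊η * N⌋₊ with hJ
    have hJle : (J : ℝ) ≤ η * N := Nat.floor_le (by positivity)
    set m := ⌈ε * N / 2⌉₊ with hm
    have hmge : ε * N / 2 ≤ m := Nat.le_ceil _
    have hmle : (m : ℝ) ≤ ε * N / 2 + 1 := (Nat.ceil_lt_add_one (by positivity)).le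
    have hΛ0 : 0 ≤ 8 * Λ * C₀ * K := by positivity
    have hm0 : 0 < (m : ℝ) := by
      have : (0 : ℝ) ≤ C₀ := Nat.cast_nonneg _
      linarith
    have hCJ : (C : ℝ) * J ≤ ε / 8 * N := by
      calc (C : ℝ) * J ≤ C * (η * N) := by gcongr
        _ = (C * η) * N := by ring
        _ ≤ ε / 8 * N := by gcongr
    -- the multiplicity of a surgery is at most half of the number `m` of possible surgeries
    have hτ : ((C₀ + C * J : ℕ) : ℝ) * K * Λ ≤ m / 2 := by
      push_cast
      have : (C : ℝ) * J * K * Λ ≤ ε / 8 * N := by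
        calc (C : ℝ) * J * K * Λ ≤ C * (η * N) * K * Λ := by gcongr
          _ = (C * K * η * Λ) * N := by ring
          _ ≤ ε / 8 * N := by gcongr
      have h5 : (C₀ : ℝ) * K * Λ ≤ ε * N / 8 := by
        have : (0 : ℝ) ≤ C₀ := Nat.cast_nonneg _
        linarith
      calc ((C₀ : ℝ) + C * J) * K * Λ = C₀ * K * Λ + C * J * K * Λ := by ring
        _ ≤ m / 2 := by linarith
    have hsum : ∀ (x : ℝ) (n : ℕ), 0 < x → x ≤ μ + 1 →
        ∑ e ∈ Finset.Icc 1 E, x ^ (n + e) ≤ Λ * x ^ n := by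
      intro x n hx0 hx
      calc ∑ e ∈ Finset.Icc 1 E, x ^ (n + e) ≤ ∑ e ∈ Finset.Icc 1 E, x ^ n * (μ + 1) ^ E := by
            refine Finset.sum_le_sum fun e he => ?_
            rw [pow_add]
            gcongr
            calc x ^ e ≤ (μ + 1) ^ e := by gcongr
              _ ≤ (μ + 1) ^ E := by
                gcongr
                · linarith
                · exact (Finset.mem_Icc.1 he).2
        _ = (E * (μ + 1) ^ E) * x ^ n := by simp; ring
        _ ≤ Λ * x ^ n := by gcongr; linarith
    -- after `i` surgeries; the allowed number of marked vertices grows by `C` at each of them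
    have claim : ∀ i ≤ J, ∀ N', N ≤ N' → F N' (C₀ + C * (J - i)) ≤
        2 * A₁ * ρ ^ N' + (1 / 2) ^ i * (A * (μ + δ) ^ N') := by
      intro i
      induction i with
      | zero =>
        intro _ N' _
        have h := hF N' (C₀ + C * (J - 0))
        have : 0 < 2 * A₁ * ρ ^ N' := by positivity
        simp only [pow_zero, one_mul]
        linarith
      | succ i ih =>
        intro hi N' hN'
        set k := C₀ + C * (J - (i + 1)) with hk
        have hkC : k + C = C₀ + C * (J - i) := by
          obtain ⟨t, ht⟩ : ∃ t, J - i = t + 1 := ⟨J - i - 1, by omega⟩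
          have ht' : J - (i + 1) = t := by omega
          rw [hk, ht, ht']; ring
        have hkJ : k + C ≤ C₀ + C * J := by
          rw [hkC]; gcongr; omega
        have hNN : (N : ℝ) ≤ N' := by exact_mod_cast hN'
        have h3 := h2 N' k m (by omega)
        have h4 : R N' (k + m) ≤ A₁ * ρ ^ N' := by
          refine hR N' _ (by omega) ?_
          have : (k : ℝ) ≤ C₀ + C * J := by exact_mod_cast (by omega : k ≤ C₀ + C * J)
          push_cast
          have h5 : ε * N ≤ ε * N' := by gcongr
          linarith
        have h5 : ∑ e ∈ Finset.Icc 1 E, F (N' + e) (k + C) ≤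
            Λ * (2 * A₁ * ρ ^ N' + (1 / 2) ^ i * (A * (μ + δ) ^ N')) := by
          calc ∑ e ∈ Finset.Icc 1 E, F (N' + e) (k + C)
              ≤ ∑ e ∈ Finset.Icc 1 E, (2 * A₁ * ρ ^ (N' + e) +
                (1 / 2) ^ i * (A * (μ + δ) ^ (N' + e))) := by
                refine Finset.sum_le_sum fun e _ => ?_
                rw [hkC]
                exact ih (by omega) (N' + e) (by omega)
            _ = 2 * A₁ * ∑ e ∈ Finset.Icc 1 E, ρ ^ (N' + e) +
                (1 / 2) ^ i * (A * ∑ e ∈ Finset.Icc 1 E, (μ + δ) ^ (N' + e)) := by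
                rw [Finset.sum_add_distrib, Finset.mul_sum, Finset.mul_sum, Finset.mul_sum]
            _ ≤ 2 * A₁ * (Λ * ρ ^ N') + (1 / 2) ^ i * (A * (Λ * (μ + δ) ^ N')) := by
                have g1 := hsum ρ N' hρ0 (by linarith)
                have g2 := hsum (μ + δ) N' (by linarith) (by linarith)
                gcongr
            _ = _ := by ring
        set B := 2 * A₁ * ρ ^ N' + (1 / 2) ^ i * (A * (μ + δ) ^ N') with hB
        have hB0 : 0 < B := by positivity
        have h6 : ((k : ℝ) + C) * K * ∑ e ∈ Finset.Icc 1 E, F (N' + e) (k + C) ≤ m / 2 * B := by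
          calc ((k : ℝ) + C) * K * ∑ e ∈ Finset.Icc 1 E, F (N' + e) (k + C)
              ≤ ((k : ℝ) + C) * K * (Λ * B) := by gcongr
            _ ≤ ((C₀ + C * J : ℕ) : ℝ) * K * (Λ * B) := by
                gcongr
                exact_mod_cast hkJ
            _ = ((C₀ + C * J : ℕ) : ℝ) * K * Λ * B := by ring
            _ ≤ m / 2 * B := by gcongr
        have h7 : m * F N' k ≤ m * (A₁ * ρ ^ N' + B / 2) := by
          have : m * R N' (k + m) ≤ m * (A₁ * ρ ^ N') := by gcongr
          linarith
        have h8 := le_of_mul_le_mul_left h7 hm0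
        refine h8.trans (le_of_eq ?_)
        rw [hB, pow_succ]; ring
    have h9 := claim J le_rfl N le_rfl
    rw [Nat.sub_self, mul_zero, add_zero] at h9
    refine h9.trans ?_
    have h10 : ((1 : ℝ) / 2) ^ J ≤ 2 * ((2 : ℝ) ^ η)⁻¹ ^ N := by
      have h11 : η * N ≤ J + 1 := (Nat.lt_floor_add_one _).le
      have h12 : ((2 : ℝ) ^ η) ^ N ≤ 2 ^ (J + 1) := by
        rw [← Real.rpow_natCast ((2 : ℝ) ^ η), ← Real.rpow_mul (by norm_num), ← Real.rpow_natCast 2]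
        exact Real.rpow_le_rpow_of_exponent_le (by norm_num) (by push_cast; exact h11)
      rw [inv_pow, one_div, inv_pow, ← div_eq_mul_inv, le_div_iff₀ (by positivity),
        inv_mul_le_iff₀ (by positivity)]
      rw [pow_succ] at h12
      linarith
    calc 2 * A₁ * ρ ^ N + (1 / 2) ^ J * (A * (μ + δ) ^ N)
        ≤ 2 * A₁ * ρ ^ N + (2 * ((2 : ℝ) ^ η)⁻¹ ^ N) * (A * (μ + δ) ^ N) := by gcongr
      _ = 2 * A₁ * ρ ^ N + 2 * A * ρ₂ ^ N := by
          rw [hρ₂, div_eq_mul_inv, mul_pow]; ring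
      _ ≤ 2 * A₁ * (max ρ ρ₂) ^ N + 2 * A * (max ρ ρ₂) ^ N := by
          gcongr
          · exact le_max_left _ _
          · exact le_max_right _ _
      _ = _ := by ring
  -- the finitely many remaining values of `N`
  set ρ' := max ρ ρ₂ with hρ'
  have hρ'0 : 0 < ρ' := lt_max_of_lt_left hρ0
  have hr1 : 1 ≤ (μ + δ) / ρ' := by
    rw [one_le_div hρ'0]
    linarith [max_lt hρ hρ₂μ]
  refine ⟨ρ', hρ'0, max_lt hρ hρ₂μ, (2 * A₁ + 2 * A) + A * ((μ + δ) / ρ') ^ N₀, by positivity,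
    fun N hN1 => ?_⟩
  have e1 : 0 < (2 * A₁ + 2 * A) * ρ' ^ N := by positivity
  have e2 : 0 < A * ((μ + δ) / ρ') ^ N₀ * ρ' ^ N := by positivity
  rcases le_total N₀ N with h | h
  · have := main N hN1 h
    rw [add_mul]; linarith
  · have h3 : F N C₀ ≤ A * ((μ + δ) / ρ') ^ N₀ * ρ' ^ N := by
      calc F N C₀ ≤ A * (μ + δ) ^ N := hF N C₀
        _ = A * ((μ + δ) / ρ') ^ N * ρ' ^ N := by
          rw [div_pow, mul_assoc, div_mul_cancel₀ _ (by positivity)]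
        _ ≤ A * ((μ + δ) / ρ') ^ N₀ * ρ' ^ N := by gcongr
    rw [add_mul]; linarith

variable {V : Type*} {G : SimpleGraph V} [G.LocallyFinite]

open Classical in
lemma card_marked_le_of_no_contact {D : ℕ} (hD : ∀ v, G.degree v ≤ D) {l : List V}
    (h : ∀ v, ¬ IsContact G l v) : (marked G l).card ≤ 2 * (1 + D + D * D) := by
  rcases l with _ | ⟨a, l⟩
  · simp [marked]
  set z := (a :: l).getLast (List.cons_ne_nil a l) with hz
  set N2 : V → Finset V := fun e => ({e} ∪ G.neighborFinset e) ∪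
    (G.neighborFinset e).biUnion fun w => G.neighborFinset w with hN2
  have hc : ∀ e, (N2 e).card ≤ 1 + D + D * D := by
    intro e
    refine (Finset.card_union_le _ _).trans (add_le_add ((Finset.card_union_le _ _).trans ?_) ?_)
    · rw [Finset.card_singleton]
      exact Nat.add_le_add_left (hD e) 1
    · refine (Finset.card_biUnion_le_card_mul _ _ D fun w _ => hD w).trans ?_
      exact Nat.mul_le_mul_right D (hD e)
  have hsub : marked G (a :: l) ⊆ N2 a ∪ N2 z := by
    intro v hv
    obtain ⟨_, hv | ⟨e, he, hve⟩⟩ := mem_marked.1 hv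
    · exact (h v hv).elim
    · have hve' : v ∈ N2 e := by
        simp only [hN2, Finset.mem_union, Finset.mem_singleton, SimpleGraph.mem_neighborFinset,
          Finset.mem_biUnion]
        rcases hve with h | h | ⟨w, h1, h2⟩
        · exact Or.inl (Or.inl h)
        · exact Or.inl (Or.inr h.symm)
        · exact Or.inr ⟨w, h2.symm, h1.symm⟩
      rw [Finset.mem_union]
      rcases he with he | he
      · simp only [List.head?_cons, Option.some.injEq] at he
        exact Or.inl (he ▸ hve')
      · rw [List.getLast?_eq_getLast_of_ne_nil (List.cons_ne_nil a l), Option.some.injEq] at he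
        exact Or.inr (by rw [hz, he]; exact hve')
  refine (Finset.card_le_card hsub).trans ((Finset.card_union_le _ _).trans ?_)
  have := hc a
  have := hc z
  omega

open Classical in
/-- Walks almost all of whose blocks are poor are exponentially rare. -/
lemma exists_card_mostlyPoor_le (htr : ∀ x y : V, ∃ φ : G ≃g G, φ x = y) {μ : ℝ}
    (hμ0 : 0 < μ) (hμ : LoopModel.IsConnectiveConstant G μ) {good : List V → Prop} {b D r : ℕ}
    (hb : 1 ≤ b) (hD : ∀ v, G.degree v ≤ D)
    (hr : ∀ x, {X ∈ saws G x b | Poor G good X}.card ≤ r) (hrμ : (D * r : ℝ) < μ ^ b) :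
    ∃ ε : ℝ, 0 < ε ∧ ∃ ρ : ℝ, 0 < ρ ∧ ρ < μ ∧ ∃ A : ℝ, 0 < A ∧ ∀ (x : V) (N M : ℕ), 1 ≤ N →
      (M : ℝ) ≤ ε * N →
        ((mostlyPoor G good b ((N - 1) / b) x N M).card : ℝ) ≤ A * ρ ^ N := by
  obtain ⟨s, hs0, hs, -, ρ, hρ0, hρ, A, hA, hsum⟩ := exists_sum_blockWeight_le htr hμ0 hμ
    (P := fun X => ¬ Poor G good X) hb hD (by simpa using hr) hrμ
    (show (0 : ℝ) < 1 / 2 by norm_num)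
  set ρ₁ := (ρ + μ) / 2 with hρ₁
  have hρ₁0 : 0 < ρ₁ := by positivity
  have hL : 0 < Real.log s⁻¹ := Real.log_pos ((one_lt_inv₀ hs0).2 (by linarith))
  have hq1 : 0 < Real.log (ρ₁ / ρ) := Real.log_pos (by rw [one_lt_div hρ0]; linarith)
  refine ⟨Real.log (ρ₁ / ρ) / Real.log s⁻¹, by positivity, ρ₁, hρ₁0, by linarith, A, hA,
    fun x N M hN hM => ?_⟩
  have hw : ∀ l : List V, blockWeight (fun X => ¬ Poor G good X) s b ((N - 1) / b) l =
      s ^ numNotPoor G good b ((N - 1) / b) l := by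
    intro l
    rw [blockWeight, numNotPoor, Finset.card_filter, ← Finset.prod_pow_eq_pow_sum]
    exact Finset.prod_congr rfl fun i _ => by split_ifs <;> simp_all
  have h1 : s ^ M * ((mostlyPoor G good b ((N - 1) / b) x N M).card : ℝ) ≤ A * ρ ^ N := by
    refine le_trans ?_ (hsum x N hN)
    rw [mul_comm, ← nsmul_eq_mul]
    calc _ ≤ ∑ l ∈ mostlyPoor G good b ((N - 1) / b) x N M,
          blockWeight (fun X => ¬ Poor G good X) s b ((N - 1) / b) l := by
          refine Finset.card_nsmul_le_sum _ _ _ fun l hl => ?_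
          rw [hw]
          exact pow_le_pow_of_le_one hs0.le (by linarith) (Finset.mem_filter.1 hl).2
      _ ≤ _ := Finset.sum_le_sum_of_subset_of_nonneg (Finset.filter_subset _ _)
          fun l _ _ => blockWeight_nonneg _ hs0.le _ _ _
  have h2 : (s⁻¹) ^ M ≤ (ρ₁ / ρ) ^ N := by
    rw [div_mul_eq_mul_div, le_div_iff₀ hL] at hM
    rw [← Real.log_le_log_iff (by positivity) (by positivity), Real.log_pow, Real.log_pow]
    linarith
  calc ((mostlyPoor G good b ((N - 1) / b) x N M).card : ℝ)
      = (s⁻¹) ^ M * (s ^ M * ((mostlyPoor G good b ((N - 1) / b) x N M).card : ℝ)) := by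
        rw [← mul_assoc, ← mul_pow, inv_mul_cancel₀ hs0.ne', one_pow, one_mul]
    _ ≤ (ρ₁ / ρ) ^ N * (A * ρ ^ N) := by gcongr
    _ = A * ρ₁ ^ N := by rw [div_pow]; field_simp

open Classical in
/-- On a transitive graph with a local surgery, induced paths have a smaller growth rate than
self-avoiding walks. -/
lemma exists_card_induced_le (htr : ∀ x y : V, ∃ φ : G ≃g G, φ x = y) {μ : ℝ}
    (hμ1 : 1 ≤ μ) (hμ : LoopModel.IsConnectiveConstant G μ) {good : List V → Prop} {b E D r : ℕ}
    (hb : 1 ≤ b) (hD : ∀ v, G.degree v ≤ D) (hsurg : HasSurgery G good b E)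
    (hr : ∀ x, {X ∈ saws G x b | Poor G good X}.card ≤ r) (hrμ : (D * r : ℝ) < μ ^ b) :
    ∀ x : V, ∃ ρ : ℝ, 0 < ρ ∧ ρ < μ ∧ ∃ A : ℝ, 0 < A ∧ ∀ N : ℕ, 1 ≤ N →
      ({l ∈ saws G x N | ∀ v, ¬ IsContact G l v}.card : ℝ) ≤ A * ρ ^ N := by
  intro x
  have hμ0 : 0 < μ := by linarith
  obtain ⟨ε, hε, ρ, hρ0, hρ, A₁, hA₁, hR⟩ := exists_card_mostlyPoor_le htr hμ0 hμ hb hD hr hrμ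
  have hgrow : ∀ δ : ℝ, 0 < δ → ∃ A : ℝ, 0 < A ∧ ∀ N k : ℕ,
      ((fewMarked G x N k).card : ℝ) ≤ A * (μ + δ) ^ N := by
    intro δ hδ
    obtain ⟨A, hA, h⟩ := exists_card_saws_le htr hδ hμ0 hμ
    exact ⟨A, hA, fun N k => le_trans (by exact_mod_cast Finset.card_filter_le _ _) (h x N)⟩
  have hrec : ∀ N k m : ℕ, 1 ≤ N → (m : ℝ) * ((fewMarked G x N k).card : ℝ) ≤
      m * ((mostlyPoor G good b ((N - 1) / b) x N (k + m)).card : ℝ) +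
      ((k : ℝ) + ((b + E) * (D + 1) : ℕ)) * ((b + E) * (saws G x b).card : ℕ) *
        ∑ e ∈ Finset.Icc 1 E, ((fewMarked G x (N + e) (k + (b + E) * (D + 1))).card : ℝ) := by
    intro N k m hN
    have := mul_card_fewMarked_le hb hsurg hD (fun y => (card_saws_eq htr y x b).le) x N k m
      ((N - 1) / b) ((Nat.mul_div_le _ _).trans (Nat.sub_le _ _))
    rw [mul_assoc _ (b + E) (saws G x b).card] at this
    exact_mod_cast this
  obtain ⟨ρ', h0, h1, A, hA, h⟩ := growth_lt_of_surgery
    (F := fun N k => ((fewMarked G x N k).card : ℝ))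
    (R := fun N k => ((mostlyPoor G good b ((N - 1) / b) x N k).card : ℝ)) hμ1 hgrow hrec
    hε hρ0 hρ hA₁ (fun N M h1 h2 => hR x N M h1 h2) (2 * (1 + D + D * D))
  refine ⟨ρ', h0, h1, A, hA, fun N hN => le_trans ?_ (h N hN)⟩
  norm_cast
  refine Finset.card_le_card fun l hl => ?_
  rw [Finset.mem_filter] at hl
  exact Finset.mem_filter.2 ⟨hl.1, card_marked_le_of_no_contact hD hl.2⟩

open Classical in
lemma card_induced_le_of_iso (φ : G ≃g G) (x : V) (N : ℕ) :
    {l ∈ saws G x N | ∀ v, ¬ IsContact G l v}.card ≤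
      {l ∈ saws G (φ x) N | ∀ v, ¬ IsContact G l v}.card := by
  refine Finset.card_le_card_of_injOn (List.map φ) ?_ ?_
  · intro l hl
    obtain ⟨hl, hc⟩ := Finset.mem_filter.1 hl
    obtain ⟨h1, h2, h3, h4⟩ := mem_saws.1 hl
    refine Finset.mem_filter.2 ⟨mem_saws.2 ⟨by simp [h1], by simpa using h2, ?_,
      h4.map φ.injective⟩, ?_⟩
    · rw [List.isChain_map]
      exact h3.imp fun a b h => φ.map_adj_iff.2 h
    · rintro _ ⟨hv, w, hw, hvw, ha, hb⟩
      obtain ⟨v, hv', rfl⟩ := List.mem_map.1 hv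
      obtain ⟨w, hw', rfl⟩ := List.mem_map.1 hw
      refine hc v ⟨hv', w, hw', φ.map_adj_iff.1 hvw, fun h => ha ?_, fun h => hb ?_⟩
      · simpa using h.map φ
      · simpa using h.map φ
  · exact (List.map_injective_iff.2 φ.injective).injOn

open Classical in
/-- At some scale `B`, there are fewer than `μ ^ B / D` induced paths with `B` vertices. -/
lemma exists_card_induced_lt (htr : ∀ x y : V, ∃ φ : G ≃g G, φ x = y) {μ : ℝ}
    (hμ1 : 1 ≤ μ) (hμ : LoopModel.IsConnectiveConstant G μ) {good : List V → Prop} {b E D r : ℕ}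
    (hb : 1 ≤ b) (hD : ∀ v, G.degree v ≤ D) (hsurg : HasSurgery G good b E)
    (hr : ∀ x, {X ∈ saws G x b | Poor G good X}.card ≤ r) (hrμ : (D * r : ℝ) < μ ^ b) (o : V) :
    ∃ B r : ℕ, 1 ≤ B ∧ (D * r : ℝ) < μ ^ B ∧
      ∀ x, {X ∈ saws G x B | ∀ v, ¬ IsContact G X v}.card ≤ r := by
  have hμ0 : 0 < μ := by linarith
  obtain ⟨ρ, hρ0, hρ, A, hA, h⟩ := exists_card_induced_le htr hμ1 hμ hb hD hsurg hr hrμ o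
  have hlim : Tendsto (fun B : ℕ => D * A * (ρ / μ) ^ B) atTop (𝓝 (D * A * 0)) :=
    (tendsto_pow_atTop_nhds_zero_of_lt_one (by positivity) ((div_lt_one hμ0).2 hρ)).const_mul _
  rw [mul_zero] at hlim
  obtain ⟨B, hB, hB1⟩ := ((hlim.eventually_lt_const one_pos).and (eventually_ge_atTop 1)).exists
  refine ⟨B, {X ∈ saws G o B | ∀ v, ¬ IsContact G X v}.card, hB1, ?_, fun x => ?_⟩
  · rw [div_pow, mul_div_assoc', div_lt_one (by positivity)] at hB
    refine lt_of_le_of_lt ?_ hB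
    rw [mul_assoc]
    gcongr
    exact h B hB1
  · obtain ⟨φ, hφ⟩ := htr x o
    simpa [hφ] using card_induced_le_of_iso φ x B

end

/-! ### Configurations of the loop model with disjoint supports -/

section

open LoopModel

/-- All the edges of `κ` lie in `U`. -/
def SuppIn {W : Type*} (κ : SimpleGraph W) (U : Set W) : Prop := ∀ ⦃v w⦄, κ.Adj v w → v ∈ U

/-- The vertex sets of the loops of `κ`. -/
def loopSets {W : Type*} (κ : SimpleGraph W) : Set (Set W) :=
  {S | S.Nontrivial ∧ ∃ v, S = {w | κ.Reachable v w}}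

/-- The loop traced by a closed walk, as a spanning subgraph. -/
def loopOf {W : Type*} {H : SimpleGraph W} {v : W} (p : H.Walk v v) : SimpleGraph W :=
  p.toSubgraph.spanningCoe

section

variable {W : Type*} {H κ κ₁ κ₂ : SimpleGraph W} {U X : Set W}

lemma SuppIn.mem_right (h : SuppIn κ U) {v w : W} (hvw : κ.Adj v w) : w ∈ U := h hvw.symm

lemma SuppIn.mono (h : SuppIn κ U) (hUX : U ⊆ X) : SuppIn κ X := fun _ _ hvw => hUX (h hvw)

lemma numLoops_eq_ncard_loopSets (κ : SimpleGraph W) : numLoops κ = (loopSets κ).ncard := by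
  rw [numLoops, ← Set.ncard_image_of_injective _
    (SimpleGraph.ConnectedComponent.supp_injective (G := κ))]
  congr 1
  ext S
  simp only [Set.mem_image, Set.mem_ofPred_eq, loopSets]
  constructor
  · rintro ⟨c, hc, rfl⟩
    refine ⟨hc, ?_⟩
    induction c using SimpleGraph.ConnectedComponent.ind with
    | h v =>
      refine ⟨v, ?_⟩
      ext w
      simp only [SimpleGraph.ConnectedComponent.mem_supp_iff, SimpleGraph.ConnectedComponent.eq,
        Set.mem_ofPred_eq]
      exact SimpleGraph.reachable_comm
  · rintro ⟨hS, v, rfl⟩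
    have e : (κ.connectedComponentMk v).supp = {w | κ.Reachable v w} := by
      ext w
      simp only [SimpleGraph.ConnectedComponent.mem_supp_iff, SimpleGraph.ConnectedComponent.eq,
        Set.mem_ofPred_eq]
      exact SimpleGraph.reachable_comm
    exact ⟨κ.connectedComponentMk v, by rwa [e], e⟩

lemma exists_adj_of_nontrivial {v : W} (h : {w | κ.Reachable v w}.Nontrivial) :
    ∃ w, κ.Adj v w := by
  obtain ⟨w, hw, hne⟩ := h.exists_ne v
  obtain ⟨p⟩ := (hw : κ.Reachable v w)
  cases p with
  | nil => exact (hne rfl).elim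
  | cons h _ => exact ⟨_, h⟩

/-- Away from the support of `κ₂`, the connected components of the union are those of `κ₁`. -/
lemma reachable_sup_iff (h1 : SuppIn κ₁ U) (h2 : SuppIn κ₂ X) (hd : Disjoint U X) {v w : W}
    (hv : v ∉ X) : (κ₁ ⊔ κ₂).Reachable v w ↔ κ₁.Reachable v w := by
  constructor
  · rintro ⟨p⟩
    induction p with
    | nil => rfl
    | cons h p ih =>
      rcases h with h | h
      · exact (SimpleGraph.Adj.reachable h).trans
          (ih (Set.disjoint_left.1 hd (h1.mem_right h)))
      · exact (hv (h2 h)).elim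
  · exact fun h => h.mono le_sup_left

lemma loopSets_sup (h1 : SuppIn κ₁ U) (h2 : SuppIn κ₂ X) (hd : Disjoint U X) :
    loopSets (κ₁ ⊔ κ₂) = loopSets κ₁ ∪ loopSets κ₂ := by
  have e1 : ∀ v ∉ X, {w | (κ₁ ⊔ κ₂).Reachable v w} = {w | κ₁.Reachable v w} := fun v hv => by
    ext w; exact reachable_sup_iff h1 h2 hd hv
  have e2 : ∀ v ∉ U, {w | (κ₁ ⊔ κ₂).Reachable v w} = {w | κ₂.Reachable v w} := fun v hv => by
    ext w; rw [sup_comm]; exact reachable_sup_iff h2 h1 hd.symm hv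
  ext S
  constructor
  · rintro ⟨hS, v, rfl⟩
    by_cases hv : v ∈ X
    · have hvU : v ∉ U := fun h => Set.disjoint_left.1 hd h hv
      exact Or.inr ⟨hS, v, e2 v hvU⟩
    · exact Or.inl ⟨hS, v, e1 v hv⟩
  · rintro (⟨hS, v, rfl⟩ | ⟨hS, v, rfl⟩)
    · obtain ⟨w, hw⟩ := exists_adj_of_nontrivial hS
      exact ⟨hS, v, (e1 v (Set.disjoint_left.1 hd (h1 hw))).symm⟩
    · obtain ⟨w, hw⟩ := exists_adj_of_nontrivial hS
      exact ⟨hS, v, (e2 v (Set.disjoint_right.1 hd (h2 hw))).symm⟩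

lemma disjoint_loopSets (h1 : SuppIn κ₁ U) (h2 : SuppIn κ₂ X) (hd : Disjoint U X) :
    Disjoint (loopSets κ₁) (loopSets κ₂) := by
  rw [Set.disjoint_left]
  rintro S ⟨hS, v, rfl⟩ ⟨_, v', hv'⟩
  obtain ⟨w, hw⟩ := exists_adj_of_nontrivial hS
  have hv : κ₂.Reachable v' v := by
    have : v ∈ {w | κ₁.Reachable v w} := SimpleGraph.Reachable.refl v
    rw [hv'] at this
    exact this
  have e : {w | κ₂.Reachable v' w} = {w | κ₂.Reachable v w} := by
    ext u
    exact ⟨fun h => hv.symm.trans h, fun h => hv.trans h⟩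
  rw [hv', e] at hS
  obtain ⟨w', hw'⟩ := exists_adj_of_nontrivial hS
  exact Set.disjoint_left.1 hd (h1 hw) (h2 hw')

lemma numLoops_sup [Finite W] (h1 : SuppIn κ₁ U) (h2 : SuppIn κ₂ X) (hd : Disjoint U X) :
    numLoops (κ₁ ⊔ κ₂) = numLoops κ₁ + numLoops κ₂ := by
  simp only [numLoops_eq_ncard_loopSets]
  rw [loopSets_sup h1 h2 hd, Set.ncard_union_eq (disjoint_loopSets h1 h2 hd)
    (Set.toFinite _) (Set.toFinite _)]

lemma numEdges_sup [Finite W] (h1 : SuppIn κ₁ U) (h2 : SuppIn κ₂ X) (hd : Disjoint U X) :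
    numEdges (κ₁ ⊔ κ₂) = numEdges κ₁ + numEdges κ₂ := by
  rw [numEdges, SimpleGraph.edgeSet_sup, Set.ncard_union_eq _ (Set.toFinite _) (Set.toFinite _)]
  · rfl
  · rw [Set.disjoint_left]
    intro e
    induction e with
    | h u v => exact fun h h' => Set.disjoint_left.1 hd (h1 h) (h2 h')

lemma weight_sup [Finite W] (h1 : SuppIn κ₁ U) (h2 : SuppIn κ₂ X) (hd : Disjoint U X)
    (lam n : ℝ) : weight lam n (κ₁ ⊔ κ₂) = weight lam n κ₁ * weight lam n κ₂ := by
  rw [weight, numLoops_sup h1 h2 hd, numEdges_sup h1 h2 hd, weight, weight, pow_add, pow_add]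
  ring

lemma mem_configs [Fintype W] : κ ∈ configs H ↔ κ ≤ H ∧
    ∀ v, (κ.neighborSet v).ncard = 0 ∨ (κ.neighborSet v).ncard = 2 := by
  simp [configs]

lemma sup_mem_configs [Fintype W] (h1 : SuppIn κ₁ U) (h2 : SuppIn κ₂ X) (hd : Disjoint U X)
    (hc1 : κ₁ ∈ configs H) (hc2 : κ₂ ∈ configs H) : κ₁ ⊔ κ₂ ∈ configs H := by
  rw [mem_configs] at *
  refine ⟨sup_le hc1.1 hc2.1, fun v => ?_⟩
  by_cases hv : v ∈ X
  · have e : (κ₁ ⊔ κ₂).neighborSet v = κ₂.neighborSet v := by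
      ext w
      simp only [SimpleGraph.mem_neighborSet, SimpleGraph.sup_adj, or_iff_right_iff_imp]
      exact fun h => (Set.disjoint_left.1 hd (h1 h) hv).elim
    rw [e]; exact hc2.2 v
  · have e : (κ₁ ⊔ κ₂).neighborSet v = κ₁.neighborSet v := by
      ext w
      simp only [SimpleGraph.mem_neighborSet, SimpleGraph.sup_adj, or_iff_left_iff_imp]
      exact fun h => (hv (h2 h)).elim
    rw [e]; exact hc1.2 v

lemma sup_left_injective (h1 : SuppIn κ₁ U) {κ₁' : SimpleGraph W} (h1' : SuppIn κ₁' U)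
    (h2 : SuppIn κ₂ X) (hd : Disjoint U X) (h : κ₁ ⊔ κ₂ = κ₁' ⊔ κ₂) : κ₁ = κ₁' := by
  have key : ∀ {a b : SimpleGraph W}, SuppIn a U → a ⊔ κ₂ = b ⊔ κ₂ → a ≤ b := by
    intro a b ha hab v w hvw
    have : (b ⊔ κ₂).Adj v w := hab ▸ Or.inl hvw
    rcases this with h | h
    · exact h
    · exact (Set.disjoint_left.1 hd (ha hvw) (h2 h)).elim
  exact le_antisymm (key h1 h) (key h1' h.symm)

end

section

variable {W : Type*} {H : SimpleGraph W} {v : W} {p : H.Walk v v}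

lemma loopOf_adj {u w : W} : (loopOf p).Adj u w ↔ s(u, w) ∈ p.edges := by
  rw [loopOf, SimpleGraph.Subgraph.spanningCoe_adj, SimpleGraph.Walk.adj_toSubgraph_iff_mem_edges]

lemma suppIn_loopOf : SuppIn (loopOf p) {w | w ∈ p.support} := fun _ _ h =>
  p.fst_mem_support_of_mem_edges (loopOf_adj.1 h)

lemma loopOf_le : loopOf p ≤ H := fun _ _ h => p.adj_of_mem_edges (loopOf_adj.1 h)

lemma ncard_neighborSet_loopOf (hp : p.IsCycle) {w : W} (hw : w ∈ p.support) :
    ((loopOf p).neighborSet w).ncard = 2 := hp.ncard_neighborSet_toSubgraph_eq_two hw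

lemma loopOf_mem_configs [Fintype W] (hp : p.IsCycle) : loopOf p ∈ configs H := by
  refine mem_configs.2 ⟨loopOf_le, fun w => ?_⟩
  by_cases hw : w ∈ p.support
  · exact Or.inr (ncard_neighborSet_loopOf hp hw)
  · refine Or.inl ?_
    rw [Set.ncard_eq_zero]
    ext u
    simp only [SimpleGraph.mem_neighborSet, Set.mem_empty_iff_false, iff_false]
    exact fun h => hw (suppIn_loopOf h)

lemma numEdges_loopOf (hp : p.IsCycle) : numEdges (loopOf p) = p.length := by
  classical
  have e : (loopOf p).edgeSet = (p.edges.toFinset : Set (Sym2 W)) := by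
    ext e
    induction e with
    | h u w => simpa using loopOf_adj
  rw [numEdges, e, Set.ncard_coe_finset, List.toFinset_card_of_nodup hp.edges_nodup, p.length_edges]

lemma loopOf_reachable {u : W} (hu : u ∈ p.support) : (loopOf p).Reachable v u := by
  classical
  refine ⟨(p.takeUntil u hu).transfer (loopOf p) ?_⟩
  intro e he
  have := p.edges_takeUntil_subset_edges hu he
  induction e with
  | h a b => exact loopOf_adj.2 this

lemma setOf_loopOf_reachable {u : W} (hu : u ∈ p.support) :
    {w | (loopOf p).Reachable u w} = {w | w ∈ p.support} := by
  ext w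
  constructor
  · rintro ⟨q⟩
    induction q with
    | nil => exact hu
    | cons h q ih => exact ih (suppIn_loopOf.mem_right h)
  · exact fun h => (loopOf_reachable hu).symm.trans (loopOf_reachable h)

lemma numLoops_loopOf (hp : p.IsCycle) : numLoops (loopOf p) = 1 := by
  rw [numLoops_eq_ncard_loopSets, Set.ncard_eq_one]
  refine ⟨{w | w ∈ p.support}, ?_⟩
  ext S
  simp only [loopSets, Set.mem_ofPred_eq, Set.mem_singleton_iff]
  constructor
  · rintro ⟨hS, u, rfl⟩
    obtain ⟨w, hw⟩ := exists_adj_of_nontrivial hS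
    exact setOf_loopOf_reachable (suppIn_loopOf hw)
  · rintro rfl
    refine ⟨?_, v, (setOf_loopOf_reachable p.start_mem_support).symm⟩
    have h2 := ncard_neighborSet_loopOf hp p.start_mem_support
    obtain ⟨w, hw⟩ : ((loopOf p).neighborSet v).Nonempty :=
      Set.nonempty_of_ncard_ne_zero (by omega)
    exact ⟨v, p.start_mem_support, w, suppIn_loopOf.mem_right hw,
      (loopOf p).ne_of_adj hw⟩

lemma weight_loopOf (hp : p.IsCycle) (lam n : ℝ) :
    weight lam n (loopOf p) = lam ^ p.length * n := by
  rw [weight, numEdges_loopOf hp, numLoops_loopOf hp, pow_one]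

end

end

/-! ### The weight of a loop in the loop model -/

section

open LoopModel

open Classical in
/-- The partition function of the configurations supported in `U`. -/
def partialZ {W : Type*} [Fintype W] (H : SimpleGraph W) (lam n : ℝ) (U : Set W) : ℝ :=
  ∑ κ ∈ configs H with SuppIn κ U, weight lam n κ

lemma weight_nonneg {W : Type*} {lam n : ℝ} (hl : 0 ≤ lam) (hn : 0 ≤ n)
    (κ : SimpleGraph W) : 0 ≤ weight lam n κ := by
  unfold weight; positivity

/-- `X` has a contact, that is, it is not an induced path. -/
def HasContact {W : Type*} (H : SimpleGraph W) (X : List W) : Prop := ∃ v, IsContact H X v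

/-- A walk with a contact contains the vertices of a cycle. -/
lemma exists_cycle_of_isContact {W : Type*} {H : SimpleGraph W} {X : List W} (hX : IsSAW H X)
    {v : W} (h : IsContact H X v) :
    ∃ (u : W) (p : H.Walk u u), p.IsCycle ∧ (∀ w ∈ p.support, w ∈ X) ∧ p.length ≤ X.length := by
  obtain ⟨hv, w, hw, hvw, h1, h2⟩ := h
  -- order the two vertices along the walk
  obtain ⟨v, w, A, M, B, hvw, h1, rfl⟩ : ∃ (v w : W) (A M B : List W), H.Adj v w ∧
      ¬ [v, w] <:+: X ∧ X = A ++ v :: (M ++ w :: B) := by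
    obtain ⟨A, B, rfl⟩ := List.append_of_mem hv
    rcases List.mem_append.1 hw with hw | hw
    · obtain ⟨A, M, rfl⟩ := List.append_of_mem hw
      exact ⟨w, v, A, M, B, hvw.symm, h2, by simp⟩
    · rcases List.mem_cons.1 hw with rfl | hw
      · exact (H.loopless.irrefl _ hvw).elim
      · obtain ⟨M, B, rfl⟩ := List.append_of_mem hw
        exact ⟨v, w, A, M, B, hvw, h1, rfl⟩
  have hseg : v :: (M ++ [w]) <:+: A ++ v :: (M ++ w :: B) := ⟨A, B, by simp⟩
  obtain ⟨hc, hnd⟩ := hX.infix hseg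
  set q := SimpleGraph.Walk.ofSupport (G := H) (v :: (M ++ [w])) (by simp) hc with hq
  have hqs : q.support = v :: (M ++ [w]) := SimpleGraph.Walk.support_ofSupport _ _
  have ev : (v :: (M ++ [w])).head (by simp) = v := rfl
  have ew : (v :: (M ++ [w])).getLast (by simp) = w := by simp
  set q' : H.Walk v w := q.copy ev ew with hq'
  have hqs' : q'.support = v :: (M ++ [w]) := by rw [hq', SimpleGraph.Walk.support_copy, hqs]
  have hM : M ≠ [] := by
    rintro rfl
    exact h1 ⟨A, B, by simp⟩
  have hpath : q'.IsPath := by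
    rw [SimpleGraph.Walk.isPath_def, hqs']; exact hnd
  refine ⟨w, SimpleGraph.Walk.cons hvw.symm q', ?_, ?_, ?_⟩
  · rw [SimpleGraph.Walk.cons_isCycle_iff]
    refine ⟨hpath, fun he => ?_⟩
    rw [Sym2.eq_swap] at he
    have hs := hpath.snd_of_toSubgraph_adj
      (SimpleGraph.Walk.adj_toSubgraph_iff_mem_edges.2 he)
    obtain ⟨m, M, rfl⟩ := List.exists_cons_of_ne_nil hM
    have h3 : q'.snd = m := by
      rw [SimpleGraph.Walk.snd, SimpleGraph.Walk.getVert_eq_support_getElem]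
      · simp [hqs']
      · rw [← Nat.lt_succ_iff, Nat.succ_eq_add_one, ← SimpleGraph.Walk.length_support, hqs']
        simp
    have : m = w := h3.symm.trans hs
    subst this
    simp at hnd
  · intro u hu
    rw [SimpleGraph.Walk.support_cons, hqs'] at hu
    rcases List.mem_cons.1 hu with rfl | hu
    · simp
    · exact hseg.subset hu
  · rw [SimpleGraph.Walk.length_cons, ← SimpleGraph.Walk.length_support, hqs']
    simp; omega

section

variable {W : Type*} [Fintype W] {H : SimpleGraph W} {lam n : ℝ}

open Classical in
lemma partialZ_le_partitionFunction (hl : 0 ≤ lam) (hn : 0 ≤ n) (U : Set W) :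
    partialZ H lam n U ≤ partitionFunction H lam n :=
  Finset.sum_le_sum_of_subset_of_nonneg (Finset.filter_subset _ _)
    fun κ _ _ => weight_nonneg hl hn κ

open Classical in
lemma partialZ_mono (hl : 0 ≤ lam) (hn : 0 ≤ n) {U X : Set W} (h : U ⊆ X) :
    partialZ H lam n U ≤ partialZ H lam n X := by
  refine Finset.sum_le_sum_of_subset_of_nonneg ?_ fun κ _ _ => weight_nonneg hl hn κ
  intro κ hκ
  rw [Finset.mem_filter] at hκ ⊢
  exact ⟨hκ.1, hκ.2.mono h⟩

open Classical in
lemma partialZ_nonneg (hl : 0 ≤ lam) (hn : 0 ≤ n) (U : Set W) : 0 ≤ partialZ H lam n U :=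
  Finset.sum_nonneg fun κ _ => weight_nonneg hl hn κ

/-- A cycle in `X` may be added to any configuration supported in `U`. -/
lemma partialZ_mul_le (hl : 0 ≤ lam) (hn : 0 ≤ n) {U X : Set W} (hd : Disjoint U X) {v : W}
    {p : H.Walk v v} (hp : p.IsCycle) (hpX : ∀ w ∈ p.support, w ∈ X) :
    partialZ H lam n U * (1 + n * lam ^ p.length) ≤ partialZ H lam n (U ∪ X) := by
  classical
  set S : Finset (SimpleGraph W) := {κ ∈ configs H | SuppIn κ U} with hS
  have hpU : SuppIn (loopOf p) X := suppIn_loopOf.mono hpX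
  have hSU : ∀ κ ∈ S, κ ∈ configs H ∧ SuppIn κ U := fun κ hκ => Finset.mem_filter.1 hκ
  have hinj : Set.InjOn (fun κ => κ ⊔ loopOf p) (S : Set (SimpleGraph W)) := fun κ hκ κ' hκ' h =>
    sup_left_injective (hSU κ hκ).2 (hSU κ' hκ').2 hpU hd h
  have hdisj : Disjoint S (S.image fun κ => κ ⊔ loopOf p) := by
    rw [Finset.disjoint_left]
    intro κ hκ hκ'
    obtain ⟨κ', -, rfl⟩ := Finset.mem_image.1 hκ'
    have h2 := ncard_neighborSet_loopOf hp p.start_mem_support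
    obtain ⟨w, hw⟩ : ((loopOf p).neighborSet v).Nonempty :=
      Set.nonempty_of_ncard_ne_zero (by omega)
    exact Set.disjoint_left.1 hd ((hSU _ hκ).2 (Or.inr hw : (κ' ⊔ loopOf p).Adj v w))
      (hpX _ p.start_mem_support)
  have e : partialZ H lam n U * (1 + n * lam ^ p.length) =
      ∑ κ ∈ S ∪ S.image fun κ => κ ⊔ loopOf p, weight lam n κ := by
    rw [Finset.sum_union hdisj, Finset.sum_image hinj, mul_add, mul_one, partialZ,
      Finset.sum_mul]
    congr 1
    refine Finset.sum_congr rfl fun κ hκ => ?_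
    rw [weight_sup (hSU κ hκ).2 hpU hd, weight_loopOf hp]
    ring
  rw [e]
  refine Finset.sum_le_sum_of_subset_of_nonneg ?_ fun κ _ _ => weight_nonneg hl hn κ
  intro κ hκ
  rw [Finset.mem_filter]
  rcases Finset.mem_union.1 hκ with hκ | hκ
  · exact ⟨(hSU κ hκ).1, (hSU κ hκ).2.mono Set.subset_union_left⟩
  · obtain ⟨κ', hκ', rfl⟩ := Finset.mem_image.1 hκ
    refine ⟨sup_mem_configs (hSU κ' hκ').2 hpU hd (hSU κ' hκ').1 (loopOf_mem_configs hp), ?_⟩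
    rintro a b (h | h)
    · exact Or.inl ((hSU κ' hκ').2 h)
    · exact Or.inr (hpU h)

/-- Each block with a contact contributes a factor to the partition function. -/
lemma partialZ_mul_blockWeight_le (hl : 0 ≤ lam) (hn : 0 ≤ n) {ε : ℝ} (hε : 0 ≤ ε) {b : ℕ}
    (hb : ∀ i ≤ b, ε ≤ lam ^ i) (q : ℕ) {l : List W} (hs : IsSAW H l) {U : Set W}
    (hd : ∀ v ∈ l, v ∉ U) :
    partialZ H lam n U * blockWeight (HasContact H) (1 + n * ε) b q l ≤
      partialZ H lam n (U ∪ {v | v ∈ l}) := by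
  classical
  induction q generalizing l U with
  | zero =>
    simpa [blockWeight] using partialZ_mono hl hn Set.subset_union_left
  | succ q ih =>
    rw [blockWeight_succ, ← mul_assoc]
    have hdis : ∀ v ∈ l.drop b, v ∉ l.take b := fun v h1 h2 =>
      List.disjoint_take_drop hs.2 le_rfl h2 h1
    have h1 : partialZ H lam n U * (if HasContact H (l.take b) then 1 + n * ε else 1) ≤
        partialZ H lam n (U ∪ {v | v ∈ l.take b}) := by
      split_ifs with h
      · obtain ⟨v, hv⟩ := h
        obtain ⟨u, p, hp, hpX, hlen⟩ :=
          exists_cycle_of_isContact (hs.infix (List.take_prefix b l).isInfix) hv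
        refine le_trans ?_ (partialZ_mul_le hl hn ?_ hp hpX)
        · refine mul_le_mul_of_nonneg_left ?_ (partialZ_nonneg hl hn U)
          have := hb p.length (hlen.trans (by simp))
          nlinarith
        · rw [Set.disjoint_right]
          exact fun v hv => hd v (List.mem_of_mem_take hv)
      · rw [mul_one]; exact partialZ_mono hl hn Set.subset_union_left
    have h2 := ih (l := l.drop b) (U := U ∪ {v | v ∈ l.take b})
      (hs.infix (List.drop_suffix b l).isInfix) (fun v hv => by
        rintro (h | h)
        · exact hd v (List.mem_of_mem_drop hv) h
        · exact hdis v hv h)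
    calc _ ≤ partialZ H lam n (U ∪ {v | v ∈ l.take b}) *
          blockWeight (HasContact H) (1 + n * ε) b q (l.drop b) :=
          mul_le_mul_of_nonneg_right h1 (blockWeight_nonneg _ (by positivity) _ _ _)
      _ ≤ _ := h2
      _ ≤ _ := partialZ_mono hl hn (by
          rintro v ((h | h) | h)
          · exact Or.inl h
          · exact Or.inr (List.mem_of_mem_take h)
          · exact Or.inr (List.mem_of_mem_drop h))

lemma loopOf_adj_of_mem_support {v : W} {p : H.Walk v v} (hp : p.IsCycle) {κ : SimpleGraph W}
    (hκ : κ ∈ configs H) (hle : loopOf p ≤ κ) {a b : W} (ha : a ∈ p.support) (hab : κ.Adj a b) :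
    (loopOf p).Adj a b := by
  have h2 := ncard_neighborSet_loopOf hp ha
  have hsub : (loopOf p).neighborSet a ⊆ κ.neighborSet a := fun c hc => hle hc
  have h3 : (κ.neighborSet a).ncard = 2 := by
    rcases (mem_configs.1 hκ).2 a with h | h
    · rw [Set.ncard_eq_zero] at h
      have : b ∈ κ.neighborSet a := hab
      rw [h] at this
      exact this.elim
    · exact h
  have := Set.eq_of_subset_of_ncard_le hsub (by omega) (Set.toFinite _)
  exact (this ▸ hab : b ∈ (loopOf p).neighborSet a)

open Classical in
/-- The configurations which contain a given loop `p` are those which avoid its vertices, with the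
loop added. -/
lemma sum_weight_loopOf_le (hl : 0 ≤ lam) (hn : 0 ≤ n) {v : W} {p : H.Walk v v}
    (hp : p.IsCycle) :
    ∑ κ ∈ configs H with loopOf p ≤ κ, weight lam n κ ≤
      lam ^ p.length * n * partialZ H lam n {w | w ∉ p.support} := by
  -- the configuration with the loop erased
  set er : SimpleGraph W → SimpleGraph W := fun κ =>
    { Adj := fun a b => κ.Adj a b ∧ a ∉ p.support ∧ b ∉ p.support
      symm := ⟨fun a b h => ⟨h.1.symm, h.2.2, h.2.1⟩⟩
      loopless := ⟨fun a h => κ.loopless.irrefl a h.1⟩ } with her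
  have hsupp : ∀ κ, SuppIn (er κ) {w | w ∉ p.support} := fun κ a b h => h.2.1
  have hdis : Disjoint {w | w ∉ p.support} {w | w ∈ p.support} :=
    Set.disjoint_left.2 fun w h h' => h h'
  have hdec : ∀ κ ∈ configs H, loopOf p ≤ κ → er κ ⊔ loopOf p = κ := by
    intro κ hκ hle
    refine le_antisymm (sup_le (fun a b h => h.1) hle) fun a b hab => ?_
    by_cases ha : a ∈ p.support
    · exact Or.inr (loopOf_adj_of_mem_support hp hκ hle ha hab)
    · by_cases hb : b ∈ p.support
      · exact Or.inr (loopOf_adj_of_mem_support hp hκ hle hb hab.symm).symm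
      · exact Or.inl ⟨hab, ha, hb⟩
  rw [partialZ, Finset.mul_sum]
  refine sum_le_sum_of_injOn er ?_ ?_ ?_ fun κ _ =>
    mul_nonneg (by positivity) (weight_nonneg hl hn κ)
  · intro κ hκ
    obtain ⟨hκ, hle⟩ := Finset.mem_filter.1 hκ
    refine Finset.mem_filter.2 ⟨mem_configs.2 ⟨fun a b h => (mem_configs.1 hκ).1 h.1, ?_⟩,
      hsupp κ⟩
    intro a
    by_cases ha : a ∈ p.support
    · left
      rw [Set.ncard_eq_zero]
      ext b
      simp only [SimpleGraph.mem_neighborSet, Set.mem_empty_iff_false, iff_false]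
      exact fun h => h.2.1 ha
    · have e : (er κ).neighborSet a = κ.neighborSet a := by
        ext b
        refine ⟨fun h => h.1, fun h => ⟨h, ha, fun hb => ha ?_⟩⟩
        exact suppIn_loopOf.mem_right (loopOf_adj_of_mem_support hp hκ hle hb
          (SimpleGraph.Adj.symm h))
      rw [e]
      exact (mem_configs.1 hκ).2 a
  · intro κ hκ κ' hκ' h
    obtain ⟨hκ, hle⟩ := Finset.mem_filter.1 hκ
    obtain ⟨hκ', hle'⟩ := Finset.mem_filter.1 hκ'
    rw [← hdec κ hκ hle, ← hdec κ' hκ' hle', h]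
  · intro κ hκ
    obtain ⟨hκ, hle⟩ := Finset.mem_filter.1 hκ
    conv_lhs => rw [← hdec κ hκ hle]
    rw [weight_sup (hsupp κ) suppIn_loopOf hdis, weight_loopOf hp]
    exact le_of_eq (by ring)

end

end

/-! ### Exponential moments of the loop length -/

section

open LoopModel

section

variable {W : Type*} [Fintype W] {H : SimpleGraph W}

/-- The loop of a configuration through a vertex which is not isolated. -/
lemma exists_loop {κ : SimpleGraph W} (hκ : κ ∈ configs H) {x y : W} (hxy : κ.Adj x y) :
    ∃ p : H.Walk x x, p.IsCycle ∧ loopOf p ≤ κ ∧ loopLength κ x = p.length := by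
  have hcyc : κ.IsCycles := by
    intro v hv
    rcases (mem_configs.1 hκ).2 v with h | h
    · rw [Set.ncard_eq_zero] at h
      exact (hv.ne_empty h).elim
    · exact h
  obtain ⟨q, hq, hqv⟩ := hcyc.exists_cycle_toSubgraph_verts_eq_connectedComponentSupp
    (c := κ.connectedComponentMk x) (v := x) rfl ⟨y, hxy⟩
  set p : H.Walk x x := q.mapLe (mem_configs.1 hκ).1 with hp
  have hpc : p.IsCycle := hq.mapLe _
  have hsup : p.support = q.support := by simp [hp]
  have hle : loopOf p ≤ κ := by
    intro a b hab
    rw [loopOf_adj, hp, SimpleGraph.Walk.edges_mapLe_eq_edges] at hab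
    exact q.adj_of_mem_edges hab
  refine ⟨p, hpc, hle, ?_⟩
  rw [← numEdges_loopOf hpc, numEdges, loopLength]
  congr 1
  ext e
  induction e with
  | h a b =>
    simp only [Set.mem_ofPred_eq, SimpleGraph.mem_edgeSet, Sym2.mem_iff, forall_eq_or_imp,
      forall_eq]
    constructor
    · rintro ⟨hab, ha, -⟩
      refine loopOf_adj_of_mem_support hpc hκ hle ?_ hab
      rw [hsup, ← q.mem_verts_toSubgraph, hqv]
      exact SimpleGraph.ConnectedComponent.eq.2 ha.symm
    · intro hab
      refine ⟨hle hab, ?_, ?_⟩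
      · exact (loopOf_reachable (suppIn_loopOf hab)).mono hle
      · exact (loopOf_reachable (suppIn_loopOf.mem_right hab)).mono hle

lemma loopLength_eq_zero {κ : SimpleGraph W} {x : W} (h : ∀ y, ¬ κ.Adj x y) :
    loopLength κ x = 0 := by
  rw [loopLength, Set.ncard_eq_zero]
  ext e
  induction e with
  | h a b =>
    simp only [Set.mem_ofPred_eq, SimpleGraph.mem_edgeSet, Sym2.mem_iff, forall_eq_or_imp,
      forall_eq, Set.mem_empty_iff_false, iff_false, not_and]
    rintro hab ⟨p⟩
    cases p with
    | nil => exact (h b hab).elim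
    | cons h' _ => exact (h _ h').elim

end

lemma blockWeight_inv {V : Type*} (P : List V → Prop) (s : ℝ) (b q : ℕ) (l : List V) :
    blockWeight P s⁻¹ b q l = (blockWeight P s b q l)⁻¹ := by
  rw [blockWeight, blockWeight, ← Finset.prod_inv_distrib]
  exact Finset.prod_congr rfl fun i _ => by split_ifs <;> simp

lemma hasContact_map_iff {V : Type*} {G : SimpleGraph V} {S : Set V} (X : List S) :
    HasContact G (X.map Subtype.val) ↔ HasContact (G.induce S) X := by
  have hpair : ∀ v w : S, [v.1, w.1] <:+: X.map Subtype.val ↔ [v, w] <:+: X := by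
    intro v w
    refine ⟨fun h => ?_, fun h => by simpa using h.map Subtype.val⟩
    obtain ⟨A, B, h⟩ := h
    obtain ⟨l₁, l₂, rfl, h1, h2⟩ := List.map_eq_append_iff.1 h.symm
    obtain ⟨l₃, l₄, rfl, h3, h4⟩ := List.map_eq_append_iff.1 h1
    have : l₄ = [v, w] := by
      rw [show [v.1, w.1] = [v, w].map Subtype.val from rfl] at h4
      exact List.map_injective_iff.2 Subtype.val_injective h4
    exact ⟨l₃, l₂, by rw [this]⟩
  constructor
  · rintro ⟨_, hv, w, hw, hvw, h1, h2⟩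
    obtain ⟨v, hv', rfl⟩ := List.mem_map.1 hv
    obtain ⟨w, hw', rfl⟩ := List.mem_map.1 hw
    exact ⟨v, hv', w, hw', hvw, fun h => h1 ((hpair _ _).2 h), fun h => h2 ((hpair _ _).2 h)⟩
  · rintro ⟨v, hv, w, hw, hvw, h1, h2⟩
    exact ⟨v, List.mem_map_of_mem hv, w, List.mem_map_of_mem hw, hvw,
      fun h => h1 ((hpair _ _).1 h), fun h => h2 ((hpair _ _).1 h)⟩

lemma blockWeight_map {V : Type*} {G : SimpleGraph V} {S : Set V} (s : ℝ) (b q : ℕ)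
    (l : List S) : blockWeight (HasContact G) s b q (l.map Subtype.val) =
      blockWeight (HasContact (G.induce S)) s b q l := by
  classical
  rw [blockWeight, blockWeight]
  refine Finset.prod_congr rfl fun i _ => ?_
  have : HasContact G (block b i (l.map Subtype.val)) ↔
      HasContact (G.induce S) (block b i l) := by
    rw [← hasContact_map_iff, block, block, List.map_take, List.map_drop]
  simp only [this]

section

variable {V : Type*} {G : SimpleGraph V} [G.LocallyFinite]

/-- The walk along a loop that stops one step before closing the loop. -/
lemma dropLast_support_mem_saws {S : Set V} {x : S} {p : (G.induce S).Walk x x}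
    (hp : p.IsCycle) :
    IsSAW (G.induce S) p.support.dropLast ∧ p.support.dropLast.length = p.length ∧
      p.support.dropLast.map Subtype.val ∈ saws G x.1 p.length := by
  have hlen : p.support.dropLast.length = p.length := by simp
  have hsaw : IsSAW (G.induce S) p.support.dropLast :=
    ⟨p.isChain_adj_support.infix (List.dropLast_prefix _).isInfix, hp.nodup_dropLast_support⟩
  have h3 := hp.three_le_length
  refine ⟨hsaw, hlen, mem_saws.2 ⟨?_, by simp, ?_, ?_⟩⟩
  · rw [List.head?_map, List.head?_dropLast, if_pos (by simp; omega),
      ← p.cons_tail_support]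
    rfl
  · rw [List.isChain_map]
    exact hsaw.1.imp fun a b h => h
  · exact hsaw.2.map Subtype.val_injective

open Classical in
/-- A loop through `x` visits the vertices of a self-avoiding walk `l`, and each block of `l` with a
contact could carry a small loop instead, which lowers the probability of the large loop. -/
lemma sum_weight_exp_le {S : Finset V} (x : (S : Set V)) {lam n ε δ : ℝ} (hl : 0 ≤ lam)
    (hn : 0 ≤ n) (hε : 0 ≤ ε) {b : ℕ} (hb : ∀ i ≤ b, ε ≤ lam ^ i) :
    ∑ κ ∈ configs (G.induce (S : Set V)),
        weight lam n κ * Real.exp (δ * (loopLength κ x : ℝ)) ≤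
      partitionFunction (G.induce (S : Set V)) lam n *
        (1 + n * ∑ N ∈ Finset.range (S.card + 1), (lam * Real.exp δ) ^ N *
          ∑ l ∈ saws G x.1 N, blockWeight (HasContact G) (1 + n * ε)⁻¹ b ((N - 1) / b) l) := by
  set H := G.induce (S : Set V) with hH
  set Z := partitionFunction H lam n with hZ
  have hZ0 : 0 ≤ Z := Finset.sum_nonneg fun κ _ => weight_nonneg hl hn κ
  set s : ℝ := (1 + n * ε)⁻¹ with hs
  have hs0 : 0 < s := by positivity
  set f : SimpleGraph (S : Set V) → ℝ := fun κ =>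
    weight lam n κ * Real.exp (δ * (loopLength κ x : ℝ)) with hf
  have hf0 : ∀ κ, 0 ≤ f κ := fun κ => mul_nonneg (weight_nonneg hl hn κ) (Real.exp_pos _).le
  set A := {κ ∈ configs H | ∃ y, κ.Adj x y} with hA
  rw [← Finset.sum_filter_add_sum_filter_not (configs H) (fun κ => ∃ y, κ.Adj x y), add_comm,
    mul_add, mul_one]
  refine add_le_add ?_ ?_
  · -- `x` is isolated
    calc ∑ κ ∈ configs H with ¬ ∃ y, κ.Adj x y, f κ
        = ∑ κ ∈ configs H with ¬ ∃ y, κ.Adj x y, weight lam n κ := by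
          refine Finset.sum_congr rfl fun κ hκ => ?_
          have h := (Finset.mem_filter.1 hκ).2
          push Not at h
          simp [hf, loopLength_eq_zero h]
      _ ≤ Z := Finset.sum_le_sum_of_subset_of_nonneg (Finset.filter_subset _ _)
          fun κ _ _ => weight_nonneg hl hn κ
  · have hex : ∀ κ, ∃ l : List V, κ ∈ A → ∃ p : H.Walk x x, p.IsCycle ∧ loopOf p ≤ κ ∧
        loopLength κ x = p.length ∧ l = p.support.dropLast.map Subtype.val := by
      intro κ
      by_cases hκ : κ ∈ A
      · obtain ⟨h1, y, hy⟩ := Finset.mem_filter.1 hκ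
        obtain ⟨p, h2, h3, h4⟩ := exists_loop h1 hy
        exact ⟨_, fun _ => ⟨p, h2, h3, h4, rfl⟩⟩
      · exact ⟨[], fun h => (hκ h).elim⟩
    choose L hL using hex
    set T := (Finset.range (S.card + 1)).sigma fun N => saws G x.1 N with hT
    have hmaps : ∀ κ ∈ A, (⟨(L κ).length, L κ⟩ : Σ _ : ℕ, List V) ∈ T := by
      intro κ hκ
      obtain ⟨p, hp, -, -, hLp⟩ := hL κ hκ
      obtain ⟨g1, g2, g3⟩ := dropLast_support_mem_saws hp
      rw [hT, Finset.mem_sigma, hLp, List.length_map]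
      simp only
      rw [g2]
      refine ⟨Finset.mem_range.2 (Nat.lt_succ_of_le ?_), g3⟩
      rw [← g2]
      simpa using g1.2.length_le_card
    have hfib : ∀ z ∈ T, ∑ κ ∈ A with (⟨(L κ).length, L κ⟩ : Σ _ : ℕ, List V) = z, f κ ≤
        Z * (n * ((lam * Real.exp δ) ^ z.1 *
          blockWeight (HasContact G) s b ((z.1 - 1) / b) z.2)) := by
      intro z hz
      have hrhs : 0 ≤ Z * (n * ((lam * Real.exp δ) ^ z.1 *
          blockWeight (HasContact G) s b ((z.1 - 1) / b) z.2)) := by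
        have := blockWeight_nonneg (HasContact G) hs0.le b ((z.1 - 1) / b) z.2
        positivity
      rcases Finset.eq_empty_or_nonempty
        {κ ∈ A | (⟨(L κ).length, L κ⟩ : Σ _ : ℕ, List V) = z} with he | ⟨κ₀, hκ₀⟩
      · rw [he, Finset.sum_empty]; exact hrhs
      · obtain ⟨hκA, rfl⟩ := Finset.mem_filter.1 hκ₀
        obtain ⟨p, hp, -, -, hLp⟩ := hL κ₀ hκA
        obtain ⟨g1, g2, g3⟩ := dropLast_support_mem_saws hp
        have hlen : (L κ₀).length = p.length := by rw [hLp, List.length_map, g2]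
        have hle : ∑ κ ∈ A with (⟨(L κ).length, L κ⟩ : Σ _ : ℕ, List V) =
            ⟨(L κ₀).length, L κ₀⟩, f κ ≤
            ∑ κ ∈ configs H with loopOf p ≤ κ, weight lam n κ * Real.exp (δ * p.length) := by
          have hsame : ∀ κ ∈ A, L κ = L κ₀ → loopOf p ≤ κ ∧ loopLength κ x = p.length := by
            intro κ hκ hLL
            obtain ⟨p', hp', h1, h2, hLp'⟩ := hL κ hκ
            have e1 : p'.support.dropLast = p.support.dropLast :=
              List.map_injective_iff.2 Subtype.val_injective (by rw [← hLp', ← hLp, hLL])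
            have e2 : ∀ p : H.Walk x x, p.support = p.support.dropLast ++ [x] := fun p => by
              conv_lhs => rw [← List.dropLast_append_getLast p.support_ne_nil]
              rw [p.getLast_support]
            have e3 : p' = p := SimpleGraph.Walk.ext_support (by rw [e2 p', e2 p, e1])
            subst e3
            exact ⟨h1, h2⟩
          calc _ = ∑ κ ∈ A with (⟨(L κ).length, L κ⟩ : Σ _ : ℕ, List V) =
                ⟨(L κ₀).length, L κ₀⟩, weight lam n κ * Real.exp (δ * p.length) := by
                refine Finset.sum_congr rfl fun κ hκ => ?_
                obtain ⟨hκ, hLL⟩ := Finset.mem_filter.1 hκ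
                simp only [Sigma.mk.injEq, heq_eq_eq] at hLL
                rw [hf]
                simp only
                rw [(hsame κ hκ hLL.2).2]
            _ ≤ _ := by
                refine Finset.sum_le_sum_of_subset_of_nonneg ?_ fun κ _ _ =>
                  mul_nonneg (weight_nonneg hl hn κ) (Real.exp_pos _).le
                intro κ hκ
                obtain ⟨hκ, hLL⟩ := Finset.mem_filter.1 hκ
                simp only [Sigma.mk.injEq, heq_eq_eq] at hLL
                exact Finset.mem_filter.2 ⟨(Finset.mem_filter.1 hκ).1, (hsame κ hκ hLL.2).1⟩
        refine hle.trans ?_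
        rw [← Finset.sum_mul]
        simp only
        rw [hlen, hLp, blockWeight_map]
        set q := (p.length - 1) / b with hq
        have hbl := partialZ_mul_blockWeight_le (n := n) hl hn hε hb q g1
          (U := {w | w ∉ p.support}) (fun v hv h => h (List.mem_of_mem_dropLast hv))
        have hbl2 := hbl.trans (partialZ_le_partitionFunction hl hn _)
        have hinv : blockWeight (HasContact H) (1 + n * ε) b q p.support.dropLast =
            (blockWeight (HasContact H) s b q p.support.dropLast)⁻¹ := by
          rw [← blockWeight_inv, hs, inv_inv]
        have hbp := blockWeight_pos (HasContact H) hs0 b q p.support.dropLast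
        rw [hinv, ← div_eq_mul_inv, div_le_iff₀ hbp] at hbl2
        calc (∑ κ ∈ configs H with loopOf p ≤ κ, weight lam n κ) * Real.exp (δ * p.length)
            ≤ (lam ^ p.length * n * partialZ H lam n {w | w ∉ p.support}) *
              Real.exp (δ * p.length) := by
              gcongr
              exact sum_weight_loopOf_le hl hn hp
          _ ≤ (lam ^ p.length * n *
              (Z * blockWeight (HasContact H) s b q p.support.dropLast)) *
              Real.exp (δ * p.length) := by gcongr
          _ = _ := by
              rw [mul_pow, ← Real.exp_nat_mul, mul_comm (p.length : ℝ) δ]; ring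
    rw [← Finset.sum_fiberwise_of_maps_to hmaps]
    refine (Finset.sum_le_sum hfib).trans (le_of_eq ?_)
    rw [hT, Finset.sum_sigma, Finset.mul_sum, Finset.mul_sum]
    refine Finset.sum_congr rfl fun N _ => ?_
    rw [Finset.mul_sum, Finset.mul_sum, Finset.mul_sum]

end

end

/-! ### The lower bound on the critical threshold -/

section

open LoopModel

/-- Interpolation between the weighted and the unweighted number of walks, with the free
parameter `y`. -/
lemma rpow_le_interpolate {a y p : ℝ} (ha : 0 ≤ a) (hy : 0 < y) (hp0 : 0 < p) (hp1 : p < 1) :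
    a ^ p ≤ y ^ (p - 1) * (a + y) := by
  have h := Real.geom_mean_le_arith_mean2_weighted hp0.le (by linarith : 0 ≤ 1 - p) ha hy.le
    (by ring)
  have h2 : p * a + (1 - p) * y ≤ a + y := by nlinarith
  calc a ^ p = y ^ (p - 1) * (a ^ p * y ^ (1 - p)) := by
        rw [mul_left_comm, ← Real.rpow_add hy]; simp
    _ ≤ y ^ (p - 1) * (a + y) := by gcongr; exact h.trans h2

lemma blockWeight_le_rpow {V : Type*} (P : List V → Prop) {s s₀ p : ℝ} (hs₀ : 0 ≤ s₀)
    (hs0 : 0 ≤ s) (hs : s ≤ s₀ ^ p) (b q : ℕ) (l : List V) :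
    blockWeight P s b q l ≤ blockWeight P s₀ b q l ^ p := by
  classical
  rw [blockWeight, blockWeight, ← Real.finsetProd_rpow _ _ fun i _ => by
    split_ifs <;> positivity]
  refine Finset.prod_le_prod (fun i _ => by split_ifs <;> positivity) fun i _ => ?_
  split_ifs
  · exact hs
  · simp

variable {V : Type*} {G : SimpleGraph V} [G.LocallyFinite]

/-- Summability over the lengths of the weighted walks implies finiteness of the exponential
moments. -/
lemma expMoment_lt_top {δ lam n ε θ C : ℝ} (hl : 0 < lam) (hn : 0 < n) (hε : 0 ≤ ε) {b : ℕ}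
    (hb : ∀ i ≤ b, ε ≤ lam ^ i) (hθ0 : 0 ≤ θ) (hθ1 : θ < 1) (hC : 0 ≤ C)
    (hsum : ∀ x N, (lam * Real.exp δ) ^ N *
      ∑ l ∈ saws G x N, blockWeight (HasContact G) (1 + n * ε)⁻¹ b ((N - 1) / b) l ≤
        C * θ ^ N) :
    expMoment G δ lam n < ⊤ := by
  have key : expMoment G δ lam n ≤ ((1 + n * (C * (1 - θ)⁻¹) : ℝ) : EReal) := by
    refine iSup_le fun S => iSup_le fun x => EReal.coe_le_coe_iff.2 ?_
    set H := G.induce (S : Set V) with hH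
    have hbot : (⊥ : SimpleGraph (S : Set V)) ∈ configs H :=
      mem_configs.2 ⟨bot_le, fun v => Or.inl (by simp [SimpleGraph.neighborSet])⟩
    have hZ : 0 < partitionFunction H lam n :=
      Finset.sum_pos (fun κ _ => by unfold weight; positivity) ⟨_, hbot⟩
    have h1 := sum_weight_exp_le (G := G) x (δ := δ) hl.le hn.le hε hb
    have h2 : expectation H lam n (fun κ => Real.exp (δ * (loopLength κ x : ℝ))) =
        (∑ κ ∈ configs H, weight lam n κ * Real.exp (δ * (loopLength κ x : ℝ))) /
          partitionFunction H lam n := by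
      rw [expectation, Finset.sum_div]
      exact Finset.sum_congr rfl fun κ _ => by rw [prob]; ring
    rw [h2, div_le_iff₀ hZ, mul_comm]
    refine h1.trans ?_
    gcongr
    calc _ ≤ ∑ N ∈ Finset.range (S.card + 1), C * θ ^ N :=
          Finset.sum_le_sum fun N _ => hsum x.1 N
      _ = C * ∑ N ∈ Finset.range (S.card + 1), θ ^ N := by rw [Finset.mul_sum]
      _ ≤ C * (1 - θ)⁻¹ := by
        gcongr
        rw [← tsum_geometric_of_lt_one hθ0 hθ1]
        exact (summable_geometric_of_lt_one hθ0 hθ1).sum_le_tsum _ fun i _ => by positivity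
  exact key.trans_lt (EReal.coe_lt_top _)

open Classical in
/-- If at some scale induced paths are too few to sustain the growth rate `μ`, then the critical
threshold exceeds `1 / μ` by at least a constant times `n` for small `n`. -/
theorem criticalThreshold_bounds (htr : ∀ x y : V, ∃ φ : G ≃g G, φ x = y) {μ : ℝ}
    (hμ1 : 1 ≤ μ) (hμ : IsConnectiveConstant G μ) {D B r : ℕ} (hB : 1 ≤ B)
    (hD : ∀ v, G.degree v ≤ D) (hrμ : (D * r : ℝ) < μ ^ B)
    (hr : ∀ x, {X ∈ saws G x B | ∀ v, ¬ IsContact G X v}.card ≤ r) :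
    (∀ n : ℝ, 0 < n → ((1 / μ : ℝ) : EReal) < criticalThreshold G n) ∧
      ∃ c₀ : ℝ, 0 < c₀ ∧ ∃ R : ℝ → ℝ, R =O[𝓝[>] (0 : ℝ)] (fun n : ℝ => n ^ 2) ∧
        ∀ n : ℝ, 0 < n → ((1 / μ + c₀ * n + R n : ℝ) : EReal) ≤ criticalThreshold G n := by
  have hμ0 : 0 < μ := by linarith
  obtain ⟨s₀, hs₀, hs₀e, -, ρ, hρ0, hρ, A, hA, hsum⟩ := exists_sum_blockWeight_le htr hμ0 hμ
    (P := HasContact G) hB hD (by simpa [HasContact] using hr) hrμ (Real.exp_pos (-1))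
  set K := Real.log s₀⁻¹ with hK
  have hK1 : 1 ≤ K := by
    rw [hK, Real.log_inv]
    have := (Real.log_le_log_iff hs₀ (Real.exp_pos _)).2 hs₀e
    rw [Real.log_exp] at this
    linarith
  have hs₀K : s₀ = Real.exp (-K) := by rw [hK, Real.log_inv, neg_neg, Real.exp_log hs₀]
  set L := Real.log (μ / ρ) with hL
  have hL0 : 0 < L := Real.log_pos (by rwa [one_lt_div hρ0])
  -- a lower bound for the weight of the edges of a cycle in a block
  set ε : ℝ := (1 / μ) ^ B with hε
  have hε0 : 0 < ε := by positivity
  set f : ℝ → ℝ := fun n => 1 / μ + L / (μ * K) * (n * ε / (1 + n * ε)) with hf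
  -- all `lam` between `1 / μ` and `f n` are subcritical
  have hsub : ∀ n : ℝ, 0 < n → ∀ lam : ℝ, 1 / μ ≤ lam → lam < f n →
      ∃ δ : ℝ, 0 < δ ∧ expMoment G δ lam n < ⊤ := by
    intro n hn lam hlam hlamf
    have hlam0 : 0 < lam := lt_of_lt_of_le (by positivity) hlam
    have hx : 0 < n * ε := by positivity
    set p : ℝ := n * ε / (1 + n * ε) / K with hp
    have hp0 : 0 < p := by positivity
    have hp1 : p < 1 := by
      rw [hp, div_lt_one (by linarith)]
      refine lt_of_lt_of_le ?_ hK1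
      rw [div_lt_one (by linarith)]; linarith
    have hpK : p * K = n * ε / (1 + n * ε) := by rw [hp]; field_simp
    have hs : (1 + n * ε)⁻¹ ≤ s₀ ^ p := by
      rw [hs₀K, ← Real.exp_mul, show -K * p = -(n * ε / (1 + n * ε)) by rw [← hpK]; ring,
        Real.exp_neg]
      refine inv_anti₀ (Real.exp_pos _) ?_
      have h1 := Real.add_one_le_exp (-(n * ε / (1 + n * ε)))
      have h2 : -(n * ε / (1 + n * ε)) + 1 = (1 + n * ε)⁻¹ := by field_simp; ring
      rw [h2, Real.exp_neg] at h1
      exact (inv_le_inv₀ (by linarith) (Real.exp_pos _)).1 h1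
    -- the interpolated growth rate
    have hrate : lam * (ρ ^ p * μ ^ (1 - p)) < 1 := by
      have h1 : f n ≤ 1 / μ * (μ / ρ) ^ p := by
        have h2 : f n = 1 / μ * (L * p + 1) := by
          rw [hf]; simp only; rw [← hpK]; field_simp; ring
        rw [h2, Real.rpow_def_of_pos (by positivity)]
        gcongr
        exact Real.add_one_le_exp _
      have h3 : ρ ^ p * μ ^ (1 - p) = μ / (μ / ρ) ^ p := by
        rw [Real.div_rpow hμ0.le hρ0.le, Real.rpow_sub hμ0, Real.rpow_one]
        field_simp
      rw [h3]
      have h4 : 0 < (μ / ρ) ^ p := by positivity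
      have h5 : lam < (μ / ρ) ^ p / μ := by
        refine (hlamf.trans_le h1).trans_eq ?_
        ring
      rw [lt_div_iff₀ hμ0] at h5
      rwa [mul_div_assoc', div_lt_one h4]
    -- `t` is both the order of the exponential moment and the error in the growth rate of walks
    obtain ⟨t, ht0, ht⟩ : ∃ t : ℝ, 0 < t ∧
        lam * Real.exp t * (ρ ^ p * (μ + t) ^ (1 - p)) < 1 := by
      have hcont : ContinuousAt
          (fun t : ℝ => lam * Real.exp t * (ρ ^ p * (μ + t) ^ (1 - p))) 0 := by
        refine ((continuous_const.mul Real.continuous_exp).continuousAt).mul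
          (continuousAt_const.mul ?_)
        refine ContinuousAt.rpow_const (by fun_prop) (Or.inl ?_)
        simp; linarith
      have h0 := hcont.eventually_lt_const (by simpa using hrate :
        lam * Real.exp 0 * (ρ ^ p * (μ + 0) ^ (1 - p)) < 1)
      obtain ⟨t, h1, h2⟩ := ((h0.filter_mono nhdsWithin_le_nhds).and
        (self_mem_nhdsWithin (s := Set.Ioi (0 : ℝ)))).exists
      exact ⟨t, h2, h1⟩
    obtain ⟨A', hA', hcard⟩ := exists_card_saws_le htr ht0 hμ0 hμ
    set m := μ + t with hm
    have hm0 : 0 < m := by linarith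
    refine ⟨t, ht0, expMoment_lt_top (θ := lam * Real.exp t * (ρ ^ p * m ^ (1 - p)))
      (C := A + A') hlam0 hn hε0.le (b := B) ?_ (by positivity) ht (by positivity) ?_⟩
    · intro i hi
      calc ε ≤ (1 / μ) ^ i := by
            refine pow_le_pow_of_le_one (by positivity) ?_ hi
            rwa [div_le_one hμ0]
        _ ≤ lam ^ i := by gcongr
    · intro x N
      rw [mul_pow _ (ρ ^ p * m ^ (1 - p)), mul_left_comm]
      refine mul_le_mul_of_nonneg_left ?_ (by positivity)
      rcases Nat.eq_zero_or_pos N with rfl | hN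
      · simp only [saws, pow_zero, mul_one]
        refine le_trans (le_of_eq ?_) (show (0 : ℝ) ≤ A + A' by positivity)
        refine Finset.sum_eq_zero fun l hl => ?_
        have := mem_saws.1 (show l ∈ saws G x 0 from hl)
        obtain ⟨h1, h2, -⟩ := this
        rw [List.length_eq_zero_iff] at h2
        simp [h2] at h1
      -- the ratio of the bounds on the weighted and the unweighted number of walks
      set y : ℝ := (ρ / m) ^ N with hy
      have hy0 : 0 < y := by positivity
      have hpow : y ^ (p - 1) * ρ ^ N = (ρ ^ p * m ^ (1 - p)) ^ N := by
        rw [hy, ← Real.rpow_natCast (ρ / m), ← Real.rpow_mul (by positivity), mul_comm (N : ℝ),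
          Real.rpow_mul (by positivity), Real.rpow_natCast, ← mul_pow]
        congr 1
        rw [Real.div_rpow hρ0.le hm0.le, Real.rpow_sub hρ0, Real.rpow_one,
          show (1 - p) = -(p - 1) by ring, Real.rpow_neg hm0.le]
        field_simp
      calc ∑ l ∈ saws G x N, blockWeight (HasContact G) (1 + n * ε)⁻¹ B ((N - 1) / B) l
          ≤ ∑ l ∈ saws G x N, y ^ (p - 1) *
            (blockWeight (HasContact G) s₀ B ((N - 1) / B) l + y) := by
            refine Finset.sum_le_sum fun l _ => ?_
            exact (blockWeight_le_rpow _ hs₀.le (by positivity) hs _ _ _).trans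
              (rpow_le_interpolate (blockWeight_nonneg _ hs₀.le _ _ _) hy0 hp0 hp1)
        _ = y ^ (p - 1) * (∑ l ∈ saws G x N,
            blockWeight (HasContact G) s₀ B ((N - 1) / B) l + (saws G x N).card * y) := by
            rw [← Finset.mul_sum, Finset.sum_add_distrib, Finset.sum_const, nsmul_eq_mul]
        _ ≤ y ^ (p - 1) * (A * ρ ^ N + A' * m ^ N * y) := by
            gcongr
            · exact hsum x N hN
            · exact hcard x N
        _ = (A + A') * (y ^ (p - 1) * ρ ^ N) := by
            rw [hy, div_pow, mul_assoc A', mul_div_cancel₀ _ (by positivity)]; ring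
        _ = (A + A') * (ρ ^ p * m ^ (1 - p)) ^ N := by rw [hpow]
  have hfμ : ∀ n : ℝ, 0 < n → 1 / μ < f n := fun n hn => by
    have : 0 < L / (μ * K) * (n * ε / (1 + n * ε)) := by positivity
    simp only [hf]; linarith
  have hge : ∀ n : ℝ, 0 < n → ((f n : ℝ) : EReal) ≤ criticalThreshold G n := by
    intro n hn
    by_contra hcon
    obtain ⟨z, hz1, hz2⟩ := EReal.lt_iff_exists_real_btwn.1 (not_le.1 hcon)
    have hz3 : max z (1 / μ) < f n := max_lt (EReal.coe_lt_coe_iff.1 hz2) (hfμ n hn)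
    have h1 : ((max z (1 / μ) : ℝ) : EReal) ≤ criticalThreshold G n :=
      le_iSup₂_of_le (f := fun (lam : ℝ) (_ : 0 ≤ lam ∧ ∃ δ : ℝ, 0 < δ ∧
        expMoment G δ lam n < ⊤) => (lam : EReal)) (max z (1 / μ))
        ⟨le_trans (by positivity) (le_max_right z (1 / μ)),
          hsub n hn _ (le_max_right _ _) hz3⟩ le_rfl
    have h2 : (z : EReal) ≤ ((max z (1 / μ) : ℝ) : EReal) :=
      EReal.coe_le_coe_iff.2 (le_max_left _ _)
    exact absurd (h2.trans h1) (not_le.2 hz1)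
  refine ⟨fun n hn => (EReal.coe_lt_coe_iff.2 (hfμ n hn)).trans_le (hge n hn),
    L / (μ * K) * ε, by positivity,
    fun n => -(L / (μ * K) * ((n * ε) ^ 2 / (1 + n * ε))), ?_, fun n hn => ?_⟩
  · refine IsBigO.of_bound (L / (μ * K) * ε ^ 2) ?_
    filter_upwards [self_mem_nhdsWithin] with n hn
    have hn' : 0 < n := hn
    rw [norm_neg, Real.norm_of_nonneg (by positivity), Real.norm_of_nonneg (by positivity),
      mul_assoc]
    gcongr
    rw [div_le_iff₀ (by positivity)]
    have : 0 ≤ ε ^ 2 * n ^ 2 * (n * ε) := by positivity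
    nlinarith
  · refine le_trans (le_of_eq ?_) (hge n hn)
    congr 1
    simp only [hf]
    have : 1 + n * ε ≠ 0 := by positivity
    field_simp
    ring

end

/-! ### Criteria for a surgery -/

section

variable {V : Type*} {G : SimpleGraph V}

lemma eq_of_pair_infix {l : List V} (hl : l.Nodup) {v a b : V} (ha : [v, a] <:+: l)
    (hb : [v, b] <:+: l) : a = b := by
  obtain ⟨S, T, rfl⟩ := ha
  obtain ⟨S', T', h⟩ := hb
  simp only [List.append_assoc, List.cons_append, List.nil_append] at hl h
  have hv : S.length < (S ++ v :: a :: T).length := by simp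
  have hv' : S'.length < (S ++ v :: a :: T).length := by rw [← h]; simp
  have e1 : (S ++ v :: a :: T)[S.length] = v := by simp
  have e2 : (S ++ v :: a :: T)[S'.length] = v := by simp [← h]
  have e3 : S'.length = S.length := (hl.getElem_inj_iff).1 (e2.trans e1.symm)
  have h4 := (List.append_inj h e3).2
  simp only [List.cons.injEq, true_and] at h4
  exact h4.1.symm

lemma eq_of_pair_infix' {l : List V} (hl : l.Nodup) {v a b : V} (ha : [a, v] <:+: l)
    (hb : [b, v] <:+: l) : a = b := by
  have e : ∀ x : V, [x, v].reverse = [v, x] := fun x => rfl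
  refine eq_of_pair_infix (v := v) (List.nodup_reverse.2 hl) ?_ ?_
  · rw [← e]; exact List.reverse_infix.2 ha
  · rw [← e]; exact List.reverse_infix.2 hb

/-- The only neighbours on the walk of an unmarked vertex are the previous one and the next one. -/
lemma eq_or_eq_of_not_mem_marked {l : List V} (hl : l.Nodup) {p v q y : V}
    (h : [p, v, q] <:+: l) (hv : v ∉ marked G l) (hvy : G.Adj v y) (hy : y ∈ l) :
    y = p ∨ y = q := by
  have hvl : v ∈ l := h.subset (by simp)
  have hpv : [p, v] <:+: l := List.IsInfix.trans ⟨[], [q], rfl⟩ h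
  have hvq : [v, q] <:+: l := List.IsInfix.trans ⟨[p], [], rfl⟩ h
  by_contra hcon
  push Not at hcon
  refine hv (mem_marked.2 ⟨hvl, Or.inl ⟨hvl, y, hy, hvy, fun h' => hcon.2 ?_,
    fun h' => hcon.1 ?_⟩⟩)
  · exact eq_of_pair_infix hl h' hvq
  · exact eq_of_pair_infix' hl h' hpv

lemma isChain_replace {R : V → V → Prop} {P X X' Q : List V} (hX : X ≠ []) (hX' : X' ≠ [])
    (h : (P ++ X ++ Q).IsChain R) (hc : X'.IsChain R) (hh : X'.head? = X.head?)
    (hl : X'.getLast? = X.getLast?) : (P ++ X' ++ Q).IsChain R := by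
  rw [List.isChain_append, List.isChain_append] at h ⊢
  obtain ⟨⟨h1, -, h3⟩, h4, h5⟩ := h
  refine ⟨⟨h1, hc, by rwa [hh]⟩, h4, ?_⟩
  rw [List.getLast?_append_of_ne_nil _ hX', hl]
  rwa [List.getLast?_append_of_ne_nil _ hX] at h5

lemma nodup_replace {P X X' Q : List V} (h : (P ++ X ++ Q).Nodup) (hn : X'.Nodup)
    (hX' : ∀ v ∈ X', v ∈ X ∨ v ∉ P ++ X ++ Q) : (P ++ X' ++ Q).Nodup := by
  rw [List.append_assoc] at h ⊢
  simp only [List.nodup_append', List.disjoint_append_right] at h ⊢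
  obtain ⟨h1, ⟨h2, h3, h4⟩, h5, h6⟩ := h
  refine ⟨h1, ⟨hn, h3, fun v hv hq => ?_⟩, fun v hv hv' => ?_, h6⟩
  · rcases hX' v hv with h | h
    · exact h4 h hq
    · exact h (by simp [hq])
  · rcases hX' v hv' with h | h
    · exact h5 hv h
    · exact h (by simp [hv])

/-- To check a surgery, it is enough to look at the new segment. -/
lemma isSAW_replace {P X X' Q : List V} (hs : IsSAW G (P ++ X ++ Q)) (hX : X ≠ [])
    (hh : X'.head? = X.head?) (hl : X'.getLast? = X.getLast?) (hc : X'.IsChain G.Adj)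
    (hn : X'.Nodup) (hX' : ∀ v ∈ X', v ∈ X ∨ v ∉ P ++ X ++ Q) (hcon : HasContact G X') :
    IsSAW G (P ++ X' ++ Q) ∧ ∃ v ∈ X', v ∈ marked G (P ++ X' ++ Q) := by
  have hne : X' ≠ [] := by
    rintro rfl
    obtain ⟨a, t, rfl⟩ := List.exists_cons_of_ne_nil hX
    simp at hh
  have hnd := nodup_replace hs.2 hn hX'
  refine ⟨⟨isChain_replace hX hne hs.1 hc hh hl, hnd⟩, ?_⟩
  obtain ⟨v, hv, w, hw, hvw, h1, h2⟩ := hcon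
  refine ⟨v, hv, mem_marked.2 ⟨by simp [hv], Or.inl ⟨by simp [hv], w, by simp [hw], hvw, ?_, ?_⟩⟩⟩
  · exact fun h => h1 (pair_infix_of_mem hnd hv hw h)
  · exact fun h => h2 (pair_infix_of_mem hnd hw hv h)

/-- A contact between two vertices of an explicitly given segment. -/
lemma hasContact_of_infix {X : List V} (hX : X.Nodup) {v w p q : V} (h : [p, v, q] <:+: X)
    (hw : w ∈ X) (hvw : G.Adj v w) (hp : w ≠ p) (hq : w ≠ q) : HasContact G X := by
  have hpv : [p, v] <:+: X := List.IsInfix.trans ⟨[], [q], rfl⟩ h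
  have hvq : [v, q] <:+: X := List.IsInfix.trans ⟨[p], [], rfl⟩ h
  exact ⟨v, h.subset (by simp), w, hw, hvw, fun h' => hq (eq_of_pair_infix hX h' hvq),
    fun h' => hp (eq_of_pair_infix' hX h' hpv)⟩

lemma exists_degree_le [G.LocallyFinite] (htr : ∀ x y : V, ∃ φ : G ≃g G, φ x = y) :
    ∃ D, ∀ v, G.degree v ≤ D := by
  rcases isEmpty_or_nonempty V with hV | ⟨⟨o⟩⟩
  · exact ⟨0, fun v => (hV.false v).elim⟩
  · refine ⟨G.degree o, fun v => ?_⟩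
    obtain ⟨φ, rfl⟩ := htr o v
    exact (φ.degree_eq o).le

end

/-! ### The cubic lattice -/

section

variable {d : ℕ}

lemma cubicLattice_adj {x y : Fin d → ℤ} :
    (cubicLattice d).Adj x y ↔ ∑ i, (x i - y i) ^ 2 = 1 := Iff.rfl

instance : (cubicLattice d).LocallyFinite := fun x => by
  refine (Set.Finite.subset (Set.finite_Icc (x - 1) (x + 1)) fun y hy => ?_).fintype
  have h : ∑ i, (x i - y i) ^ 2 = 1 := hy
  have hi : ∀ i, (x i - y i) ^ 2 ≤ 1 := fun i => by
    rw [← h]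
    exact Finset.single_le_sum (f := fun i => (x i - y i) ^ 2) (fun i _ => sq_nonneg _)
      (Finset.mem_univ i)
  refine ⟨fun i => ?_, fun i => ?_⟩
  · have := hi i
    simp only [Pi.sub_apply, Pi.one_apply]
    nlinarith
  · have := hi i
    simp only [Pi.add_apply, Pi.one_apply]
    nlinarith

lemma cubicLattice_transitive (x y : Fin d → ℤ) :
    ∃ φ : cubicLattice d ≃g cubicLattice d, φ x = y :=
  ⟨⟨Equiv.addRight (y - x), by simp [cubicLattice_adj]⟩, by simp⟩

lemma cubicLattice_adj_add_right {x y f : Fin d → ℤ} :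
    (cubicLattice d).Adj (x + f) (y + f) ↔ (cubicLattice d).Adj x y := by
  simp [cubicLattice_adj]

lemma cubicLattice_adj_add {x f : Fin d → ℤ} (hf : ∑ i, f i ^ 2 = 1) :
    (cubicLattice d).Adj x (x + f) := by
  simp [cubicLattice_adj, hf]

lemma cubicLattice_saws_nonempty (hd : 2 ≤ d) (x : Fin d → ℤ) (N : ℕ) :
    (saws (cubicLattice d) x (N + 1)).Nonempty := by
  set e : Fin d → ℤ := Pi.single ⟨0, by omega⟩ 1 with he
  refine ⟨(List.range (N + 1)).map fun k : ℕ => x + (k : ℤ) • e, mem_saws.2 ⟨?_, by simp, ?_, ?_⟩⟩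
  · simp [List.range_succ_eq_map]
  · rw [List.isChain_iff_getElem]
    intro i hi
    simp only [List.getElem_map, List.getElem_range]
    have h : x + ((i + 1 : ℕ) : ℤ) • e = x + (i : ℤ) • e + e := by
      push_cast
      rw [add_smul, one_smul, add_assoc]
    rw [h]
    refine cubicLattice_adj_add ?_
    rw [Finset.sum_eq_single ⟨0, by omega⟩]
    · simp [he]
    · intro b _ hb
      simp [he, hb]
    · simp
  · refine List.nodup_range.map fun a b hab => ?_
    have := congrFun hab ⟨0, by omega⟩
    simpa [he] using this

/-- In dimension at least two, some unit vector is orthogonal to a given edge. -/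
lemma exists_orthogonal (hd : 2 ≤ d) {s : Fin d → ℤ} (hs : ∑ i, s i ^ 2 = 1) : ∃ j, s j = 0 := by
  by_contra hcon
  push Not at hcon
  have h : ∑ _i : Fin d, (1 : ℤ) ≤ ∑ i, s i ^ 2 := Finset.sum_le_sum fun i _ => by
    have := sq_pos_of_ne_zero (hcon i)
    omega
  simp at h
  omega

/-- Three consecutive steps whose vertices have no contact can be replaced: the middle edge `p₁p₂`
is pushed in an orthogonal direction `f`. If both directions `f` and `-f` are blocked by `p₀` and
`p₃`, the three steps form a staircase, which is replaced by the two squares that it cuts. -/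
lemma cubicLattice_hasSurgery (hd : 2 ≤ d) :
    HasSurgery (cubicLattice d) (fun _ => True) 4 2 := by
  intro P X Q hlen hs _ hun
  obtain ⟨p₀, p₁, p₂, p₃, rfl⟩ : ∃ p₀ p₁ p₂ p₃, X = [p₀, p₁, p₂, p₃] := by
    rcases X with _ | ⟨a, _ | ⟨b, _ | ⟨c, _ | ⟨e, _ | ⟨g, t⟩⟩⟩⟩⟩ <;> simp at hlen
    exact ⟨a, b, c, e, rfl⟩
  set l := P ++ [p₀, p₁, p₂, p₃] ++ Q with hl
  have hinf : [p₀, p₁, p₂, p₃] <:+: l := ⟨P, Q, rfl⟩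
  obtain ⟨hc, hn⟩ := hs.infix hinf
  simp only [List.isChain_cons_cons, List.isChain_singleton, and_true] at hc
  obtain ⟨h01, h12, h23⟩ := hc
  have hn' := hn
  simp only [List.nodup_cons, List.mem_cons, List.not_mem_nil, or_false, not_or, List.nodup_nil,
    not_false_eq_true, and_true] at hn'
  obtain ⟨⟨n01, n02, n03⟩, ⟨n12, n13⟩, n23⟩ := hn'
  have hp₁ : ∀ y, (cubicLattice d).Adj p₁ y → y ∈ l → y = p₀ ∨ y = p₂ := fun y =>
    eq_or_eq_of_not_mem_marked hs.2 (List.IsInfix.trans ⟨[], [p₃], rfl⟩ hinf)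
      (hun p₁ (by simp))
  have hp₂ : ∀ y, (cubicLattice d).Adj p₂ y → y ∈ l → y = p₁ ∨ y = p₃ := fun y =>
    eq_or_eq_of_not_mem_marked hs.2 (List.IsInfix.trans ⟨[p₀], [], rfl⟩ hinf)
      (hun p₂ (by simp))
  have hpl : p₀ ∈ l ∧ p₁ ∈ l ∧ p₂ ∈ l ∧ p₃ ∈ l := by simp [hl]
  obtain ⟨l0, l1, l2, l3⟩ := hpl
  obtain ⟨j, hj⟩ := exists_orthogonal hd (s := fun i => p₁ i - p₂ i) h12
  have hj' : p₁ j = p₂ j := by simpa [sub_eq_zero] using hj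
  -- pushing the middle edge
  have push : ∀ f : Fin d → ℤ, ∑ i, f i ^ 2 = 1 → f j ≠ 0 → p₁ + f ≠ p₀ → p₂ + f ≠ p₃ →
      ∃ X' : List (Fin d → ℤ), 4 < X'.length ∧ X'.length ≤ 4 + 2 ∧
      X'.head? = [p₀, p₁, p₂, p₃].head? ∧ X'.getLast? = [p₀, p₁, p₂, p₃].getLast? ∧
      IsSAW (cubicLattice d) (P ++ X' ++ Q) ∧
      ∃ v ∈ X', v ∈ marked (cubicLattice d) (P ++ X' ++ Q) := by
    intro f hf hfj h0 h3
    have a1 : p₁ + f ∉ l := fun h => by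
      rcases hp₁ _ (cubicLattice_adj_add hf) h with h | h
      · exact h0 h
      · apply hfj; have := congrFun h j; simp at this; omega
    have a2 : p₂ + f ∉ l := fun h => by
      rcases hp₂ _ (cubicLattice_adj_add hf) h with h | h
      · apply hfj; have := congrFun h j; simp at this; omega
      · exact h3 h
    have hne : p₁ + f ≠ p₂ + f := fun h => n12 (add_right_cancel h)
    have hnd : [p₀, p₁, p₁ + f, p₂ + f, p₂, p₃].Nodup := by
      simp only [List.nodup_cons, List.mem_cons, List.not_mem_nil, or_false, not_or,
        List.nodup_nil, not_false_eq_true, and_true]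
      refine ⟨⟨n01, ?_, ?_, n02, n03⟩, ⟨?_, ?_, n12, n13⟩, ⟨hne, ?_, ?_⟩, ⟨?_, ?_⟩, n23⟩ <;>
        first
        | exact ne_of_mem_of_not_mem (s := l) (by assumption) (by assumption)
        | exact (ne_of_mem_of_not_mem (s := l) (by assumption) (by assumption)).symm
    refine ⟨[p₀, p₁, p₁ + f, p₂ + f, p₂, p₃], by simp, by simp, rfl, rfl, ?_⟩
    refine isSAW_replace hs (by simp) rfl rfl ?_ hnd ?_ ?_
    · simp only [List.isChain_cons_cons, List.isChain_singleton, and_true]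
      exact ⟨h01, cubicLattice_adj_add hf, cubicLattice_adj_add_right.2 h12,
        (cubicLattice_adj_add hf).symm, h23⟩
    · intro v hv
      simp only [List.mem_cons, List.not_mem_nil, or_false] at hv ⊢
      rcases hv with rfl | rfl | rfl | rfl | rfl | rfl
      · simp
      · simp
      · exact Or.inr a1
      · exact Or.inr a2
      · simp
      · simp
    · exact hasContact_of_infix hnd (v := p₁) (w := p₂) (p := p₀) (q := p₁ + f)
        ⟨[], [p₂ + f, p₂, p₃], rfl⟩ (by simp) h12 (fun h => n02 h.symm) (fun h => a1 (h ▸ l2))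
  -- replacing a staircase
  have stair : ∀ g : Fin d → ℤ, ∑ i, g i ^ 2 = 1 → g j ≠ 0 → p₁ + g = p₀ → p₂ - g = p₃ →
      ∃ X' : List (Fin d → ℤ), 4 < X'.length ∧ X'.length ≤ 4 + 2 ∧
      X'.head? = [p₀, p₁, p₂, p₃].head? ∧ X'.getLast? = [p₀, p₁, p₂, p₃].getLast? ∧
      IsSAW (cubicLattice d) (P ++ X' ++ Q) ∧
      ∃ v ∈ X', v ∈ marked (cubicLattice d) (P ++ X' ++ Q) := by
    intro g hg hgj h0 h3
    have hg' : ∑ i, (-g) i ^ 2 = 1 := by simpa using hg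
    have a1 : p₂ + g ∉ l := fun h => by
      rcases hp₂ _ (cubicLattice_adj_add hg) h with h | h
      · apply hgj; have := congrFun h j; simp at this; omega
      · rw [← h3] at h
        apply hgj; have := congrFun h j; simp at this; omega
    have a2 : p₁ + -g ∉ l := fun h => by
      rcases hp₁ _ (cubicLattice_adj_add hg') h with h | h
      · rw [← h0] at h
        apply hgj; have := congrFun h j; simp at this; omega
      · apply hgj; have := congrFun h j; simp at this; omega
    have hne : p₂ + g ≠ p₁ + -g := fun h => by
      apply hgj; have := congrFun h j; simp at this; omega
    have hnd : [p₀, p₂ + g, p₂, p₁, p₁ + -g, p₃].Nodup := by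
      simp only [List.nodup_cons, List.mem_cons, List.not_mem_nil, or_false, not_or,
        List.nodup_nil, not_false_eq_true, and_true]
      refine ⟨⟨?_, n02, n01, ?_, n03⟩, ⟨?_, ?_, hne, ?_⟩, ⟨fun h => n12 h.symm, ?_, n23⟩,
        ⟨?_, n13⟩, ?_⟩ <;>
        first
        | exact ne_of_mem_of_not_mem (s := l) (by assumption) (by assumption)
        | exact (ne_of_mem_of_not_mem (s := l) (by assumption) (by assumption)).symm
    refine ⟨[p₀, p₂ + g, p₂, p₁, p₁ + -g, p₃], by simp, by simp, rfl, rfl, ?_⟩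
    refine isSAW_replace hs (by simp) rfl rfl ?_ hnd ?_ ?_
    · simp only [List.isChain_cons_cons, List.isChain_singleton, and_true]
      refine ⟨?_, (cubicLattice_adj_add hg).symm, h12.symm, cubicLattice_adj_add hg', ?_⟩
      · rw [← h0]; exact cubicLattice_adj_add_right.2 h12
      · rw [← h3, sub_eq_add_neg]; exact cubicLattice_adj_add_right.2 h12
    · intro v hv
      simp only [List.mem_cons, List.not_mem_nil, or_false] at hv ⊢
      rcases hv with rfl | rfl | rfl | rfl | rfl | rfl
      · simp
      · exact Or.inr a1
      · simp
      · simp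
      · exact Or.inr a2
      · simp
    · exact hasContact_of_infix hnd (v := p₁) (w := p₀) (p := p₂) (q := p₁ + -g)
        ⟨[p₀, p₂ + g], [p₃], rfl⟩ (by simp) h01.symm n02 (fun h => a2 (h ▸ l0))
  -- one of the two constructions applies
  set f : Fin d → ℤ := Pi.single j 1 with hf
  have hf1 : ∑ i, f i ^ 2 = 1 := by
    rw [Finset.sum_eq_single j]
    · simp [hf]
    · intro b _ hb
      simp [hf, hb]
    · simp
  have hf2 : ∑ i, (-f) i ^ 2 = 1 := by simpa using hf1
  have hfj : f j ≠ 0 := by simp [hf]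
  have hfj2 : (-f) j ≠ 0 := by simp [hf]
  have hff : ∀ p q : Fin d → ℤ, p + f = q → p + -f ≠ q := fun p q h h' => by
    apply hfj; have := congrFun (h.trans h'.symm) j; simp at this; omega
  by_cases c1 : p₁ + f = p₀
  · by_cases c2 : p₂ + -f = p₃
    · exact stair f hf1 hfj c1 (by rwa [sub_eq_add_neg])
    · exact push (-f) hf2 hfj2 (hff _ _ c1) c2
  · by_cases c2 : p₂ + f = p₃
    · by_cases c3 : p₁ + -f = p₀
      · exact stair (-f) hf2 hfj2 c3 (by rwa [sub_neg_eq_add])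
      · exact push (-f) hf2 hfj2 c3 (hff _ _ c2)
    · exact push f hf1 hfj c1 c2

end

/-! ### The hexagonal lattice -/

/-- The sites of the hexagonal lattice. -/
abbrev Hex : Type := ℤ × ℤ × Bool

/-- The neighbour of a site along the edge with direction `k`. The six edges of a hexagon have the
directions `x, y, z, x, y, z` in cyclic order, for distinct `x, y, z`. -/
def nb (k : Fin 3) : Hex → Hex
  | (a, b, false) => ![(a, b, true), (a - 1, b, true), (a, b - 1, true)] k
  | (a, b, true) => ![(a, b, false), (a + 1, b, false), (a, b + 1, false)] k

lemma hexagonalLattice_adj {u v : Hex} : hexagonalLattice.Adj u v ↔ ∃ k, v = nb k u := by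
  obtain ⟨a, b, s⟩ := u
  obtain ⟨c, e, t⟩ := v
  change hexLink _ _ ∨ hexLink _ _ ↔ _
  rw [Fin.exists_fin_succ, Fin.exists_fin_two]
  cases s <;> cases t <;> simp [hexLink, nb, eq_sub_iff_add_eq]
  grind

@[simp] lemma nb_nb (k : Fin 3) (u : Hex) : nb k (nb k u) = u := by
  obtain ⟨a, b, s⟩ := u
  fin_cases k <;> cases s <;> simp [nb]

lemma nb_inj {i j : Fin 3} {u : Hex} : nb i u = nb j u ↔ i = j := by
  refine ⟨fun h => ?_, fun h => by rw [h]⟩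
  obtain ⟨a, b, s⟩ := u
  fin_cases i <;> fin_cases j <;> cases s <;> simp [nb] at h ⊢ <;> omega

lemma adj_nb (k : Fin 3) (u : Hex) : hexagonalLattice.Adj u (nb k u) :=
  hexagonalLattice_adj.2 ⟨k, rfl⟩

lemma adj_nb' (k : Fin 3) (u : Hex) : hexagonalLattice.Adj (nb k u) u := (adj_nb k u).symm

/-- Going around a hexagon in both directions. -/
lemma nb_hexagon {x y z : Fin 3} (hxy : x ≠ y) (hyz : y ≠ z) (hxz : x ≠ z) (u : Hex) :
    nb x (nb y (nb z u)) = nb z (nb y (nb x u)) := by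
  obtain ⟨a, b, s⟩ := u
  fin_cases x <;> fin_cases y <;> fin_cases z <;> cases s <;> simp [nb] at hxy hyz hxz ⊢

lemma exists_third (x y : Fin 3) : ∃ w, w ≠ x ∧ w ≠ y := by
  revert x y; decide

lemma eq_third {x y w k : Fin 3} (hxy : x ≠ y) (hwx : w ≠ x) (hwy : w ≠ y) :
    k = x ∨ k = y ∨ k = w := by
  revert x y w k; decide

instance : hexagonalLattice.LocallyFinite := fun u => by
  refine (Set.Finite.subset (Set.finite_range fun k => nb k u) fun v hv => ?_).fintype
  obtain ⟨k, rfl⟩ := hexagonalLattice_adj.1 hv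
  exact ⟨k, rfl⟩

lemma exists_iso_of_nb (φ : Hex ≃ Hex) (h : ∀ k u, φ (nb k u) = nb k (φ u)) :
    ∃ ψ : hexagonalLattice ≃g hexagonalLattice, ∀ u, ψ u = φ u := by
  refine ⟨⟨φ, ?_⟩, fun u => rfl⟩
  intro u v
  simp only [hexagonalLattice_adj, ← h, φ.injective.eq_iff]

lemma hexagonalLattice_transitive (u v : Hex) :
    ∃ φ : hexagonalLattice ≃g hexagonalLattice, φ u = v := by
  obtain ⟨a, b, s⟩ := u
  obtain ⟨c, e, t⟩ := v
  by_cases hst : s = t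
  · subst hst
    obtain ⟨ψ, hψ⟩ := exists_iso_of_nb
      ⟨fun z => (z.1 + (c - a), z.2.1 + (e - b), z.2.2),
        fun z => (z.1 - (c - a), z.2.1 - (e - b), z.2.2),
        fun z => by simp, fun z => by simp⟩ (fun k z => by
          obtain ⟨m, n, r⟩ := z
          fin_cases k <;> cases r <;> simp [nb] <;> ring)
    exact ⟨ψ, by rw [hψ]; simp⟩
  · have hts : t = !s := by cases s <;> cases t <;> simp_all
    subst hts
    obtain ⟨ψ, hψ⟩ := exists_iso_of_nb
      ⟨fun z => (a + c - z.1, b + e - z.2.1, !z.2.2), fun z => (a + c - z.1, b + e - z.2.1, !z.2.2),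
        fun z => by simp, fun z => by simp⟩ (fun k z => by
          obtain ⟨m, n, r⟩ := z
          fin_cases k <;> cases r <;> simp [nb] <;> ring)
    exact ⟨ψ, by rw [hψ]; simp⟩

/-! ### Growth of self-avoiding walks on the hexagonal lattice -/

/-- A coordinate which is constant along the edges of direction `2` and varies by one along the
other edges. -/
def height (u : Hex) : ℤ := 2 * u.1 + u.2.1 + if u.2.2 then 1 else 0

/-- The neighbour with a larger height. -/
def rightNb (u : Hex) : Hex := if u.2.2 then nb 1 u else nb 0 u

lemma height_rightNb (u : Hex) : height (rightNb u) = height u + 1 := by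
  obtain ⟨a, b, s⟩ := u
  cases s <;> simp [rightNb, height, nb]
  ring

lemma height_nb_two (u : Hex) : height (nb 2 u) = height u := by
  obtain ⟨a, b, s⟩ := u
  cases s <;> simp [height, nb] <;> ring

lemma adj_rightNb (u : Hex) : hexagonalLattice.Adj u (rightNb u) := by
  unfold rightNb; split_ifs <;> exact adj_nb _ _

/-- Walks of nondecreasing height are counted by a Fibonacci recursion: each step to the right may
be preceded by a step at constant height. -/
lemma pow_le_card_saws (n : ℕ) (v : Hex) :
    ((8 : ℝ) / 5) ^ n ≤ ({l ∈ saws hexagonalLattice v (n + 1) |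
      ∀ u ∈ l, height v ≤ height u}.card : ℝ) := by
  set S : ℕ → Hex → Finset (List Hex) := fun n v => {l ∈ saws hexagonalLattice v n |
      ∀ u ∈ l, height v ≤ height u} with hS
  change _ ≤ ((S (n + 1) v).card : ℝ)
  have hmem : ∀ {n v l}, l ∈ S n v ↔ l ∈ saws hexagonalLattice v n ∧
      ∀ u ∈ l, height v ≤ height u := fun {n v l} => by simp [hS]
  have hcons : ∀ {n v l}, l ∈ S n (rightNb v) → v :: l ∈ S (n + 1) v := by
    intro n v l hl
    obtain ⟨h1, h2⟩ := hmem.1 hl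
    obtain ⟨h3, h4, h5, h6⟩ := mem_saws.1 h1
    rw [height_rightNb] at h2
    refine hmem.2 ⟨mem_saws.2 ⟨rfl, by simp [h4], ?_, ?_⟩, ?_⟩
    · rw [List.isChain_cons, h3]
      refine ⟨fun y hy => ?_, h5⟩
      simp only [Option.mem_def, Option.some.injEq] at hy
      subst hy
      exact adj_rightNb v
    · exact List.nodup_cons.2 ⟨fun h => by have := h2 v h; omega, h6⟩
    · intro u hu
      rcases List.mem_cons.1 hu with rfl | hu
      · exact le_rfl
      · have := h2 u hu; omega
  have hcons2 : ∀ {n v l}, l ∈ S n (rightNb (nb 2 v)) → v :: nb 2 v :: l ∈ S (n + 2) v := by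
    intro n v l hl
    have h0 := hcons hl
    obtain ⟨h1, h2⟩ := hmem.1 h0
    obtain ⟨h3, h4, h5, h6⟩ := mem_saws.1 h1
    have h7 := (hmem.1 hl).2
    rw [height_rightNb, height_nb_two] at h7
    refine hmem.2 ⟨mem_saws.2 ⟨rfl, by simpa using h4, ?_, ?_⟩, ?_⟩
    · exact List.isChain_cons_cons.2 ⟨adj_nb 2 v, h5⟩
    · refine List.nodup_cons.2 ⟨fun h => ?_, h6⟩
      rcases List.mem_cons.1 h with h | h
      · exact (adj_nb 2 v).ne h
      · have := h7 v h; omega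
    · intro u hu
      rcases List.mem_cons.1 hu with rfl | hu
      · exact le_rfl
      · rw [height_nb_two] at h2
        exact h2 u hu
  have hrec : ∀ n v, (S (n + 2) (rightNb v)).card + (S (n + 1) (rightNb (nb 2 v))).card ≤
      (S (n + 3) v).card := by
    intro n v
    have hi1 : Function.Injective (List.cons v) := List.cons_injective
    have hi2 : Function.Injective fun l => v :: nb 2 v :: l :=
      List.cons_injective.comp List.cons_injective
    rw [← Finset.card_image_of_injective _ hi1, ← Finset.card_image_of_injective (S (n + 1) _) hi2,
      ← Finset.card_union_of_disjoint]
    · refine Finset.card_le_card fun l hl => ?_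
      rcases Finset.mem_union.1 hl with h | h
      · obtain ⟨l', hl', rfl⟩ := Finset.mem_image.1 h
        exact hcons hl'
      · obtain ⟨l', hl', rfl⟩ := Finset.mem_image.1 h
        exact hcons2 hl'
    · rw [Finset.disjoint_left]
      rintro _ h1 h2
      obtain ⟨l, hl, rfl⟩ := Finset.mem_image.1 h1
      obtain ⟨l', hl', h⟩ := Finset.mem_image.1 h2
      simp only [List.cons.injEq, true_and] at h
      subst h
      have := (mem_saws.1 (hmem.1 hl).1).1
      simp only [List.head?_cons, Option.some.injEq] at this
      have h3 := height_rightNb v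
      rw [← this, height_nb_two] at h3
      omega
  have h1 : ∀ v, [v] ∈ S 1 v := fun v => hmem.2 ⟨mem_saws.2 ⟨rfl, rfl, by simp [IsSAW]⟩, by simp⟩
  have key : ∀ n, (∀ v, ((8 : ℝ) / 5) ^ n ≤ ((S (n + 1) v).card : ℝ)) ∧
      ∀ v, ((8 : ℝ) / 5) ^ (n + 1) ≤ ((S (n + 2) v).card : ℝ) := by
    intro n
    induction n with
    | zero =>
      constructor
      · intro v
        have := Finset.card_pos.2 ⟨_, h1 v⟩
        simp only [pow_zero]
        exact_mod_cast this
      · intro v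
        have h2 : [v, nb 2 v] ∈ S 2 v := by
          refine hmem.2 ⟨mem_saws.2 ⟨rfl, rfl, ?_, ?_⟩, ?_⟩
          · simpa using adj_nb 2 v
          · simpa using (adj_nb 2 v).ne
          · simp [height_nb_two]
        have h3 : [v, rightNb v] ∈ S 2 v := hcons (h1 _)
        have hne : [v, nb 2 v] ≠ [v, rightNb v] := by
          intro h
          simp only [List.cons.injEq, and_true, true_and] at h
          have h4 := height_rightNb v
          rw [← h, height_nb_two] at h4
          omega
        have h5 : 2 ≤ (S 2 v).card := by
          calc 2 = ({[v, nb 2 v], [v, rightNb v]} : Finset (List Hex)).card :=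
                (Finset.card_pair hne).symm
            _ ≤ _ := Finset.card_le_card (by simp [Finset.insert_subset_iff, h2, h3])
        have h6 : (2 : ℝ) ≤ (S 2 v).card := by exact_mod_cast h5
        norm_num
        linarith
    | succ n ih =>
      refine ⟨ih.2, fun v => ?_⟩
      have h2 := hrec n v
      have h3 : ((S (n + 2) (rightNb v)).card : ℝ) + (S (n + 1) (rightNb (nb 2 v))).card ≤
        (S (n + 3) v).card := by exact_mod_cast h2
      have h4 := ih.2 (rightNb v)
      have h5 := ih.1 (rightNb (nb 2 v))
      have h6 : (0 : ℝ) < (8 / 5) ^ n := by positivity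
      have h7 : ((8 : ℝ) / 5) ^ (n + 1 + 1) = (8 / 5) ^ n * (64 / 25) := by ring
      have h8 : ((8 : ℝ) / 5) ^ (n + 1) = (8 / 5) ^ n * (8 / 5) := by ring
      rw [h7]
      rw [h8] at h4
      refine le_trans ?_ h3
      linarith
  exact (key n).1 v

lemma pow_le_card_saws' (n : ℕ) (v : Hex) :
    ((8 : ℝ) / 5) ^ n ≤ ((saws hexagonalLattice v (n + 1)).card : ℝ) :=
  (pow_le_card_saws n v).trans (by exact_mod_cast Finset.card_filter_le _ _)

lemma hexagonalLattice_saws_nonempty (v : Hex) (n : ℕ) :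
    (saws hexagonalLattice v (n + 1)).Nonempty := by
  rw [← Finset.card_pos]
  have h := pow_le_card_saws' n v
  have : (0 : ℝ) < (8 / 5) ^ n := by positivity
  exact_mod_cast this.trans_le h

lemma le_connectiveConstant_hexagonalLattice {μ : ℝ}
    (hμ : LoopModel.IsConnectiveConstant hexagonalLattice μ) : 8 / 5 ≤ μ := by
  refine ge_of_tendsto (hμ (0, 0, false)) ?_
  filter_upwards [eventually_ge_atTop 1] with n hn
  rw [ncard_selfAvoidingWalks, one_div]
  have h := pow_le_card_saws' n (0, 0, false)
  calc (8 : ℝ) / 5 = (((8 : ℝ) / 5) ^ n) ^ ((n : ℝ)⁻¹) := by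
        rw [Real.pow_rpow_inv_natCast (by norm_num) (by omega)]
    _ ≤ _ := by gcongr

/-! ### Surgery on the hexagonal lattice -/

/-- Two of the three edges at an unmarked vertex belong to the walk; the third one leads outside. -/
lemma nb_notMem {l : List Hex} (hl : l.Nodup) {p v q : Hex} (h : [p, v, q] <:+: l)
    (hv : v ∉ marked hexagonalLattice l) {k : Fin 3} (hp : nb k v ≠ p) (hq : nb k v ≠ q) :
    nb k v ∉ l := fun hm =>
  (eq_or_eq_of_not_mem_marked hl h hv (adj_nb k v) hm).elim hp hq

/-- A self-avoiding walk can only end at a vertex two of whose neighbours are not visited. -/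
lemma head_or_getLast_of_notMem {l : List Hex} (hl : IsSAW hexagonalLattice l) {t : Hex}
    (ht : t ∈ l) {i j : Fin 3} (hij : i ≠ j) (hi : nb i t ∉ l) (hj : nb j t ∉ l) :
    l.head? = some t ∨ l.getLast? = some t := by
  obtain ⟨A, B, rfl⟩ := List.append_of_mem ht
  rcases List.eq_nil_or_concat A with rfl | ⟨A, r, rfl⟩
  · simp
  rcases B with _ | ⟨s, B⟩
  · simp
  exfalso
  obtain ⟨h1, h2⟩ := hl.infix (l' := [r, t, s]) ⟨A, B, by simp⟩
  simp only [List.isChain_cons_cons, List.isChain_singleton, and_true] at h1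
  obtain ⟨k, rfl⟩ := hexagonalLattice_adj.1 h1.1.symm
  obtain ⟨m, rfl⟩ := hexagonalLattice_adj.1 h1.2
  have hkm : k ≠ m := by
    rintro rfl
    simp at h2
  obtain ⟨w, hwi, hwj⟩ := exists_third i j
  have key : ∀ n, nb n t ∈ A.concat (nb k t) ++ t :: nb m t :: B → n = w := by
    intro n hn
    rcases eq_third (k := n) hij hwi hwj with rfl | rfl | rfl
    · exact (hi hn).elim
    · exact (hj hn).elim
    · rfl
  exact hkm ((key k (by simp)).trans (key m (by simp)).symm)

/-- A vertex within two steps of an unmarked vertex is not an endpoint of the walk, so it is not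
visited when two of its neighbours are not. -/
lemma notMem_of_nb_notMem {l : List Hex} (hl : IsSAW hexagonalLattice l) {v s t : Hex} (hv : v ∈ l)
    (hv' : v ∉ marked hexagonalLattice l) (hvs : hexagonalLattice.Adj v s)
    (hst : hexagonalLattice.Adj s t) {i j : Fin 3} (hij : i ≠ j) (hi : nb i t ∉ l)
    (hj : nb j t ∉ l) : t ∉ l := fun ht =>
  hv' (mem_marked.2 ⟨hv, Or.inr ⟨t, head_or_getLast_of_notMem hl ht hij hi hj,
    Or.inr (Or.inr ⟨s, hvs, hst⟩)⟩⟩)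

/-- The vertices used to bypass the two hexagons on either side of the edge from `a` to `nb x a`. -/
lemma nodup_hexagons {x y w : Fin 3} (hxy : x ≠ y) (hwx : w ≠ x) (hwy : w ≠ y) (a : Hex) :
    [nb w (nb y a), nb x (nb w (nb y a)), nb w (nb x a), nb w a, nb y (nb w a),
      nb x (nb y (nb w a))].Nodup := by
  obtain ⟨m, n, s⟩ := a
  fin_cases x <;> fin_cases y <;> simp at hxy <;> fin_cases w <;> simp at hwx hwy <;> cases s <;>
    simp [nb] <;> omega

lemma nb_nb_ne {i j : Fin 3} (h : i ≠ j) (u : Hex) : nb i (nb j u) ≠ u := by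
  conv_rhs => rw [← nb_nb j u]
  exact fun h' => h (nb_inj.1 h')

/-- The segments containing four edges of directions `x, y, x, y`, followed by two more edges. -/
def HasZigzag (X : List Hex) : Prop :=
  ∃ (A B : List Hex) (a b c : Hex) (x y : Fin 3), x ≠ y ∧
    X = A ++ [nb x (nb y a), nb y a, a, nb x a, nb y (nb x a), b, c] ++ B

/-- Around a zigzag `p, z, a, u, v, b, c` without marked vertices, the edge `zu` is rerouted around
the hexagon on one side of `z, a, u`, then `a` is visited from `u`, and `v` is reached around the
hexagon on the other side of `a, u, v`. If `b`, or `b` and `c`, are on the latter hexagon, it is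
left at `b` or `c`. The edge `za` becomes a contact. -/
lemma exists_replace_zigzag {P Q : List Hex} {a b c : Hex} {x y : Fin 3} (hxy : x ≠ y)
    (hs : IsSAW hexagonalLattice
      (P ++ [nb x (nb y a), nb y a, a, nb x a, nb y (nb x a), b, c] ++ Q))
    (hun : ∀ v ∈ [nb x (nb y a), nb y a, a, nb x a, nb y (nb x a), b, c], v ∉ marked
      hexagonalLattice (P ++ [nb x (nb y a), nb y a, a, nb x a, nb y (nb x a), b, c] ++ Q)) :
    ∃ Y : List Hex, 7 < Y.length ∧ Y.length ≤ 7 + 6 ∧ Y.head? = some (nb x (nb y a)) ∧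
      Y.getLast? = some c ∧ IsSAW hexagonalLattice (P ++ Y ++ Q) ∧
      ∃ v ∈ Y, v ∈ marked hexagonalLattice (P ++ Y ++ Q) := by
  obtain ⟨w, hwx, hwy⟩ := exists_third x y
  obtain ⟨X, hX⟩ : ∃ X, X = [nb x (nb y a), nb y a, a, nb x a, nb y (nb x a), b, c] := ⟨_, rfl⟩
  rw [← hX] at hs hun
  obtain ⟨l, hl⟩ : ∃ l, l = P ++ X ++ Q := ⟨_, rfl⟩
  have hinf : X <:+: l := hl ▸ ⟨P, Q, rfl⟩
  have hXl : ∀ v ∈ X, v ∈ l := fun v hv => hinf.subset hv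
  obtain ⟨hc, hn⟩ := hs.infix (hl ▸ hinf)
  have hXne : X ≠ [] := by simp [hX]
  have hfirst : X.head? = some (nb x (nb y a)) := by simp [hX]
  have hlast : X.getLast? = some c := by simp [hX]
  have hub : hexagonalLattice.Adj (nb y (nb x a)) b ∧ hexagonalLattice.Adj b c := by
    rw [hX] at hc
    simp only [List.isChain_cons_cons] at hc
    exact ⟨hc.2.2.2.2.1, hc.2.2.2.2.2.1⟩
  have hnod := nodup_hexagons hxy hwx hwy a
  have i1 : [nb x (nb y a), nb y a, a] <:+: l :=
    List.IsInfix.trans ⟨[], [nb x a, nb y (nb x a), b, c], by simp [hX]⟩ hinf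
  have i2 : [nb y a, a, nb x a] <:+: l :=
    List.IsInfix.trans ⟨[nb x (nb y a)], [nb y (nb x a), b, c], by simp [hX]⟩ hinf
  have i3 : [a, nb x a, nb y (nb x a)] <:+: l :=
    List.IsInfix.trans ⟨[nb x (nb y a), nb y a], [b, c], by simp [hX]⟩ hinf
  have i4 : [nb x a, nb y (nb x a), b] <:+: l :=
    List.IsInfix.trans ⟨[nb x (nb y a), nb y a, a], [c], by simp [hX]⟩ hinf
  have i5 : [nb y (nb x a), b, c] <:+: l :=
    List.IsInfix.trans ⟨[nb x (nb y a), nb y a, a, nb x a], [], by simp [hX]⟩ hinf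
  have hln : l.Nodup := hl ▸ hs.2
  rw [← hl] at hun
  have f1 : nb w (nb y a) ∉ l := nb_notMem hln i1 (hun _ (by simp [hX])) (by simpa [nb_inj])
    (nb_nb_ne hwy a)
  have f2 : nb w a ∉ l := nb_notMem hln i2 (hun _ (by simp [hX])) (by simpa [nb_inj])
    (by simpa [nb_inj])
  have f3 : nb w (nb x a) ∉ l := nb_notMem hln i3 (hun _ (by simp [hX]))
    (nb_nb_ne hwx a) (by simpa [nb_inj])
  have e1 : nb x (nb w (nb y a)) = nb y (nb w (nb x a)) := nb_hexagon hwx.symm hwy hxy a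
  have f4 : nb x (nb w (nb y a)) ∉ l := by
    refine notMem_of_nb_notMem (hl ▸ hs) (hXl (nb x a) (by simp [hX])) (hun _ (by simp [hX]))
      (adj_nb w _) (t := nb x (nb w (nb y a))) (e1 ▸ adj_nb y _) hxy ?_ ?_
    · rwa [nb_nb]
    · rwa [e1, nb_nb]
  have e2 : nb x (nb y (nb w a)) = nb w (nb y (nb x a)) := nb_hexagon hxy hwy.symm hwx.symm a
  have finish : ∀ Y X₀ N : List Hex, 7 < Y.length → Y.length ≤ 7 + 6 →
      Y.head? = some (nb x (nb y a)) → Y.getLast? = some c → Y.IsChain hexagonalLattice.Adj →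
      Y.Perm (X₀ ++ N) → X₀.Sublist X → N.Nodup → (∀ v ∈ N, v ∉ l) → [nb x a, a, nb w a] <:+: Y →
      nb y a ∈ Y →
      ∃ Y : List Hex, 7 < Y.length ∧ Y.length ≤ 7 + 6 ∧ Y.head? = some (nb x (nb y a)) ∧
        Y.getLast? = some c ∧ IsSAW hexagonalLattice (P ++ Y ++ Q) ∧
        ∃ v ∈ Y, v ∈ marked hexagonalLattice (P ++ Y ++ Q) := by
    intro Y X₀ N h1 h2 h3 h4 h5 h6 hX₀ hN hNl h8 h9
    have h7 : Y.Nodup := by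
      rw [h6.nodup_iff, List.nodup_append']
      exact ⟨hn.sublist hX₀, hN, fun v hv hv' => hNl v hv' (hXl v (hX₀.subset hv))⟩
    have h10 : ∀ v ∈ Y, v ∈ X ∨ v ∉ l := fun v hv =>
      (List.mem_append.1 (h6.mem_iff.1 hv)).imp (fun h => hX₀.subset h) (hNl v)
    refine ⟨Y, h1, h2, h3, h4, isSAW_replace hs hXne (h3.trans hfirst.symm) (h4.trans hlast.symm) h5
      h7 (hl ▸ h10) (hasContact_of_infix h7 h8 h9 (adj_nb y a) ?_ ?_)⟩
    · simpa [nb_inj] using hxy.symm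
    · simpa [nb_inj] using hwy.symm
  obtain ⟨k, hk⟩ := hexagonalLattice_adj.1 hub.1
  have hky : k ≠ y := by
    rintro rfl
    rw [nb_nb] at hk
    rw [hX, hk] at hn
    simp at hn
  -- the edges of the two hexagons, with the vertices named from `a`
  have hchain : hexagonalLattice.Adj (nb x (nb y a)) (nb y a) ∧
      hexagonalLattice.Adj (nb y a) (nb w (nb y a)) ∧
      hexagonalLattice.Adj (nb w (nb y a)) (nb x (nb w (nb y a))) ∧
      hexagonalLattice.Adj (nb x (nb w (nb y a))) (nb w (nb x a)) ∧
      hexagonalLattice.Adj (nb w (nb x a)) (nb x a) ∧ hexagonalLattice.Adj (nb x a) a ∧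
      hexagonalLattice.Adj a (nb w a) ∧ hexagonalLattice.Adj (nb w a) (nb y (nb w a)) ∧
      hexagonalLattice.Adj (nb y (nb w a)) (nb x (nb y (nb w a))) ∧
      hexagonalLattice.Adj (nb x (nb y (nb w a))) (nb y (nb x a)) :=
    ⟨adj_nb' _ _, adj_nb _ _, adj_nb _ _, e1 ▸ adj_nb' _ _, adj_nb' _ _, adj_nb' _ _, adj_nb _ _,
      adj_nb _ _, adj_nb _ _, e2 ▸ adj_nb' _ _⟩
  rcases eq_third (k := k) hxy hwx hwy with rfl | rfl | rfl
  -- `b` is not on the second hexagon, which is followed as far as `v`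
  · have f5 : nb k (nb y (nb w a)) ∉ l := by
      rw [e2]
      refine nb_notMem hln i4 (hun _ (by simp [hX])) (nb_nb_ne hwy _) ?_
      rw [hk]
      simpa [nb_inj]
    have f6 : nb y (nb w a) ∉ l := by
      refine notMem_of_nb_notMem (hl ▸ hs) (hXl a (by simp [hX])) (hun _ (by simp [hX]))
        (adj_nb w a) (adj_nb y _) hxy f5 ?_
      rwa [nb_nb]
    refine finish [nb k (nb y a), nb y a, nb w (nb y a), nb k (nb w (nb y a)), nb w (nb k a),
      nb k a, a, nb w a, nb y (nb w a), nb k (nb y (nb w a)), nb y (nb k a), b, c] X _ (by simp)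
      (by simp) rfl rfl ?_ ?_ (List.Sublist.refl _) hnod ?_ ?_ (by simp)
    · simp only [List.isChain_cons_cons, List.isChain_singleton, and_true]
      tauto
    · rw [hX, List.perm_iff_count]
      intro v
      simp only [List.count_append, List.count_cons, List.count_nil]
      ring
    · simpa only [List.forall_mem_cons] using 
        ⟨f1, f4, f3, f2, f6, f5, by simp⟩
    · exact ⟨[nb k (nb y a), nb y a, nb w (nb y a), nb k (nb w (nb y a)), nb w (nb k a)],
        [nb y (nb w a), nb k (nb y (nb w a)), nb y (nb k a), b, c], by simp⟩
  · exact (hky rfl).elim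
  -- `b` is on the second hexagon
  · obtain ⟨m, hm⟩ := hexagonalLattice_adj.1 hub.2
    have hmk : m ≠ k := by
      rintro rfl
      rw [hk, nb_nb] at hm
      rw [hX, hm] at hn
      simp at hn
    have hk' : b = nb x (nb y (nb k a)) := hk.trans e2.symm
    rcases eq_third (k := m) hxy hwx hwy with rfl | rfl | rfl
    · have hc' : nb y (nb k a) = c := by rw [hm, hk', nb_nb]
      refine finish [nb m (nb y a), nb y a, nb k (nb y a), nb m (nb k (nb y a)), nb k (nb m a),
        nb m a, a, nb k a, c] [nb m (nb y a), nb y a, a, nb m a, c] _ (by simp) (by simp) rfl rfl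
        ?_ ?_ ?_ (hnod.sublist (List.take_sublist 4 _)) ?_ ?_ (by simp)
      · rw [hc'] at hchain
        simp only [List.isChain_cons_cons, List.isChain_singleton, and_true]
        tauto
      · rw [List.perm_iff_count]
        intro v
        simp only [List.take, List.count_append, List.count_cons, List.count_nil]
        ring
      · rw [hX]
        simp
      · simpa only [List.take, List.forall_mem_cons] using
          ⟨f1, f4, f3, f2, by simp⟩
      · exact ⟨[nb m (nb y a), nb y a, nb k (nb y a), nb m (nb k (nb y a)), nb k (nb m a)],
          [c], by simp⟩
    · have f6 : nb m (nb k a) ∉ l := by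
        have h := nb_notMem (k := x) hln i5 (hun _ (by simp [hX]))
          (by rw [hk]; exact nb_nb_ne hwx.symm _) (by rw [hm]; exact fun h => hxy (nb_inj.1 h))
        rwa [hk', nb_nb] at h
      have hvb : hexagonalLattice.Adj (nb m (nb k a)) b := hk' ▸ adj_nb x _
      refine finish [nb x (nb m a), nb m a, nb k (nb m a), nb x (nb k (nb m a)), nb k (nb x a),
        nb x a, a, nb k a, nb m (nb k a), b, c] [nb x (nb m a), nb m a, a, nb x a, b, c] _ (by simp)
        (by simp) rfl rfl ?_ ?_ ?_ (hnod.sublist (List.take_sublist 5 _)) ?_ ?_ (by simp)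
      · simp only [List.isChain_cons_cons, List.isChain_singleton, and_true]
        tauto
      · rw [List.perm_iff_count]
        intro v
        simp only [List.take, List.count_append, List.count_cons, List.count_nil]
        ring
      · rw [hX]
        simp
      · simpa only [List.take, List.forall_mem_cons] using
          ⟨f1, f4, f3, f2, f6, by simp⟩
      · exact ⟨[nb x (nb m a), nb m a, nb k (nb m a), nb x (nb k (nb m a)), nb k (nb x a)],
          [nb m (nb k a), b, c], by simp⟩
    · exact (hmk rfl).elim

/-- On the hexagonal lattice, the blocks with a zigzag have a surgery. -/
lemma hexagonalLattice_hasSurgery (b : ℕ) : HasSurgery hexagonalLattice HasZigzag b 6 := by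
  rintro P X Q hlen hs ⟨A, B, a, b, c, x, y, hxy, rfl⟩ hun
  obtain ⟨T, hT⟩ : ∃ T, T = [nb x (nb y a), nb y a, a, nb x a, nb y (nb x a), b, c] := ⟨_, rfl⟩
  have hl : P ++ (A ++ T ++ B) ++ Q = P ++ A ++ T ++ (B ++ Q) := by simp
  obtain ⟨Y, h1, h2, h3, h4, h5, v, hv, hv'⟩ := exists_replace_zigzag (P := P ++ A) (Q := B ++ Q)
    (a := a) (b := b) (c := c) hxy (by rw [← hT] at hs ⊢; rwa [← hl])
    (by
      rw [← hT] at hun ⊢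
      rw [← hl]
      exact fun v hv => hun v (by simp [hv]))
  have hTl : T.length = 7 := by simp [hT]
  rw [← hT] at hlen hun ⊢
  have e : P ++ (A ++ Y ++ B) ++ Q = P ++ A ++ Y ++ (B ++ Q) := by simp
  simp only [List.length_append] at hlen
  refine ⟨A ++ Y ++ B, ?_, ?_, ?_, ?_, by rwa [e], v, by simp [hv], by rwa [e]⟩
  · simp only [List.length_append]; omega
  · simp only [List.length_append]; omega
  · simp [List.head?_append, h3, hT]
  · have hTc : T.getLast? = some c := by simp [hT]
    simp [List.getLast?_append, h4, hTc]

/-! ### Blocks of hexagonal walks without contact and without zigzag -/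

/-- The walk from `u` with prescribed directions of the steps. -/
def walkOf (u : Hex) : List (Fin 3) → List Hex
  | [] => [u]
  | k :: w => u :: walkOf (nb k u) w

lemma exists_walkOf : ∀ {l : List Hex} {u : Hex}, l.IsChain hexagonalLattice.Adj →
    l.head? = some u → ∃ w, w.length + 1 = l.length ∧ walkOf u w = l
  | [], _, _, h => by simp at h
  | [a], u, _, h => ⟨[], by simp, by simpa [walkOf] using h.symm⟩
  | a :: b :: l, u, hc, h => by
    rw [List.isChain_cons_cons] at hc
    obtain ⟨k, rfl⟩ := hexagonalLattice_adj.1 hc.1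
    obtain ⟨w, h1, h2⟩ := exists_walkOf hc.2 rfl
    obtain rfl : a = u := by simpa using h
    exact ⟨k :: w, by simpa using h1, by rw [walkOf, h2]⟩

lemma walkOf_prefix : ∀ {f w : List (Fin 3)} (u : Hex), f <+: w → walkOf u f <+: walkOf u w
  | [], [], _, _ => List.prefix_rfl
  | [], k :: w, u, _ => ⟨walkOf (nb k u) w, rfl⟩
  | a :: f, [], _, h => by simp at h
  | a :: f, k :: w, u, h => by
    rw [List.cons_prefix_cons] at h
    obtain ⟨rfl, h⟩ := h
    exact List.cons_prefix_cons.2 ⟨rfl, walkOf_prefix _ h⟩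

lemma exists_walkOf_infix {f w : List (Fin 3)} (u : Hex) (h : f <:+: w) :
    ∃ v, walkOf v f <:+: walkOf u w := by
  induction w generalizing u with
  | nil =>
    obtain rfl : f = [] := by simpa using h
    exact ⟨u, List.infix_rfl⟩
  | cons k w ih =>
    rcases List.infix_cons_iff.1 h with h | h
    · exact ⟨u, (walkOf_prefix u h).isInfix⟩
    · obtain ⟨v, hv⟩ := ih (nb k u) h
      exact ⟨v, hv.trans (List.suffix_cons u _).isInfix⟩

/-- The words of directions which produce, respectively, an immediate return, a contact along a
hexagon, and a zigzag. -/
def Forbidden (f : List (Fin 3)) : Prop :=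
  (∃ x, f = [x, x]) ∨ (∃ x y z, x ≠ y ∧ y ≠ z ∧ x ≠ z ∧ f = [x, y, z, x, y]) ∨
    ∃ x y k m, x ≠ y ∧ f = [x, y, x, y, k, m]

/-- The words without forbidden factor. -/
def Admissible (w : List (Fin 3)) : Prop := ∀ f, f <:+: w → ¬ Forbidden f

lemma admissible_of_poor {u : Hex} {w : List (Fin 3)} (hn : (walkOf u w).Nodup)
    (hp : Poor hexagonalLattice HasZigzag (walkOf u w)) : Admissible w := by
  intro f hf hbad
  obtain ⟨v, hv⟩ := exists_walkOf_infix u hf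
  have hvn := hn.sublist hv.sublist
  rcases hbad with ⟨x, rfl⟩ | ⟨x, y, z, hxy, hyz, hxz, rfl⟩ | ⟨x, y, k, m, hxy, rfl⟩
  · simp [walkOf] at hvn
  · obtain ⟨e, he⟩ : ∃ e, e = nb y (nb x (nb z (nb y (nb x v)))) := ⟨_, rfl⟩
    have hve : e = nb z v := by rw [he, ← nb_hexagon hxy hyz hxz, nb_nb, nb_nb]
    simp only [walkOf] at hv hvn
    rw [← he] at hv hvn
    obtain ⟨S, T, hST⟩ := hv
    rw [← hST] at hn
    refine hp.1 v ⟨by simp [← hST], e, by simp [← hST], hve ▸ adj_nb z v, fun h => ?_, fun h => ?_⟩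
    · have := eq_of_pair_infix hn (hST ▸ h) (b := nb x v)
        ⟨S, [nb y (nb x v), nb z (nb y (nb x v)), nb x (nb z (nb y (nb x v))), e] ++ T, by simp⟩
      rw [hve, nb_inj] at this
      exact hxz this.symm
    · have := pair_infix_of_mem hn (by simp) (by simp) (hST ▸ h)
      simp only [List.nodup_cons, List.mem_cons, not_or] at hvn
      rcases List.infix_cons_iff.1 this with h' | h'
      · rw [List.cons_prefix_cons] at h'
        exact hvn.1.2.2.2.2.1 h'.1.symm
      · have := h'.subset (show v ∈ [e, v] by simp)
        simp [hvn.1] at this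
  · obtain ⟨S, T, hST⟩ := hv
    exact hp.2 ⟨S, T, nb y (nb x v), nb k (nb y (nb x (nb y (nb x v)))), _, x, y, hxy,
      by rw [← hST]; simp [walkOf]; rfl⟩

lemma Admissible.infix {f w : List (Fin 3)} (h : Admissible w) (hf : f <:+: w) : Admissible f :=
  fun g hg => h g (hg.trans hf)

/-- The admissible continuations of given length of a word. -/
def extensions (π : List (Fin 3)) (n : ℕ) : Set (List (Fin 3)) :=
  {w | w.length = n ∧ Admissible (π ++ w)}

lemma finite_extensions (π : List (Fin 3)) (n : ℕ) : (extensions π n).Finite :=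
  (List.finite_length_eq (Fin 3) n).subset fun _ h => h.1

lemma ncard_extensions_append_le (π σ : List (Fin 3)) (n : ℕ) :
    (extensions (π ++ σ) n).ncard ≤ (extensions σ n).ncard :=
  Set.ncard_le_ncard (fun w hw => ⟨hw.1, hw.2.infix ⟨π, [], by simp⟩⟩) (finite_extensions _ _)

lemma ncard_extensions_succ_le (π : List (Fin 3)) (n : ℕ) :
    (extensions π (n + 1)).ncard ≤ ∑ k, (extensions (π ++ [k]) n).ncard := by
  have h : extensions π (n + 1) ⊆ ⋃ k, List.cons k '' extensions (π ++ [k]) n := by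
    rintro w ⟨h1, h2⟩
    obtain ⟨k, w, rfl⟩ := List.exists_cons_of_ne_nil (List.ne_nil_of_length_eq_add_one h1)
    exact Set.mem_iUnion.2 ⟨k, w, ⟨by simpa using h1, by simpa using h2⟩, rfl⟩
  have hfin : (⋃ k, List.cons k '' extensions (π ++ [k]) n).Finite :=
    Set.finite_iUnion fun k => (finite_extensions _ _).image _
  refine (Set.ncard_le_ncard h hfin).trans ?_
  refine (Set.ncard_iUnion_le_of_fintype _).trans (Finset.sum_le_sum fun k _ => ?_)
  exact Set.ncard_image_le (finite_extensions _ _)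

lemma ncard_extensions_le_pow (π : List (Fin 3)) (n : ℕ) : (extensions π n).ncard ≤ 3 ^ n := by
  induction n generalizing π with
  | zero =>
    refine (Set.ncard_le_ncard (t := {[]}) (fun w hw => ?_)).trans (by simp)
    simpa using hw.1
  | succ n ih =>
    refine (ncard_extensions_succ_le π n).trans ?_
    calc _ ≤ ∑ _k : Fin 3, 3 ^ n := Finset.sum_le_sum fun k _ => ih _
      _ = 3 ^ (n + 1) := by simp; ring

lemma ncard_extensions_eq_zero {π : List (Fin 3)} {n : ℕ} (hf : ∀ w : List (Fin 3),
    w.length = n → ∃ f, Forbidden f ∧ f <:+: π ++ w) : (extensions π n).ncard = 0 := by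
  rw [Set.ncard_eq_zero (finite_extensions _ _), Set.eq_empty_iff_forall_notMem]
  rintro w ⟨h1, h2⟩
  obtain ⟨f, h3, h4⟩ := hf w h1
  exact h2 f h4 h3

lemma sum_eq_of_ne {x y z : Fin 3} (hxy : x ≠ y) (hyz : y ≠ z) (hxz : x ≠ z) (F : Fin 3 → ℕ) :
    ∑ k, F k = F x + F y + F z := by
  rw [Fin.sum_univ_three]
  fin_cases x <;> fin_cases y <;> simp at hxy <;> fin_cases z <;> simp at hyz hxz <;> simp <;> ring

/-- After `x, y, z` come `y`, or `x` and then `z`: the other words are forbidden. -/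
lemma ncard_extensions_of_ne_le {x y z : Fin 3} (hxy : x ≠ y) (hyz : y ≠ z) (hxz : x ≠ z) (n : ℕ) :
    (extensions [x, y, z] (n + 2)).ncard ≤
      (extensions [y, z, y] (n + 1)).ncard + (extensions [z, x, z] n).ncard := by
  have h1 : (extensions [x, y, z] (n + 2)).ncard ≤ _ := ncard_extensions_succ_le _ (n + 1)
  have h2 := ncard_extensions_succ_le [x, y, z, x] n
  rw [sum_eq_of_ne hxy hyz hxz] at h1 h2
  have h3 : (extensions [x, y, z, z] (n + 1)).ncard = 0 :=
    ncard_extensions_eq_zero fun w _ => ⟨[z, z], Or.inl ⟨z, rfl⟩, [x, y], w, by simp⟩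
  have h4 : (extensions [x, y, z, x, x] n).ncard = 0 :=
    ncard_extensions_eq_zero fun w _ => ⟨[x, x], Or.inl ⟨x, rfl⟩, [x, y, z], w, by simp⟩
  have h5 : (extensions [x, y, z, x, y] n).ncard = 0 :=
    ncard_extensions_eq_zero fun w _ =>
      ⟨[x, y, z, x, y], Or.inr (Or.inl ⟨x, y, z, hxy, hyz, hxz, rfl⟩), [], w, by simp⟩
  have h6 := ncard_extensions_append_le [x] [y, z, y] (n + 1)
  have h7 := ncard_extensions_append_le [x, y] [z, x, z] n
  simp only [List.cons_append, List.nil_append] at *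
  omega

/-- After `x, y, x` comes `z`, unless a zigzag is made at the end of the word. -/
lemma ncard_extensions_of_eq_le {x y z : Fin 3} (hxy : x ≠ y) (hyz : y ≠ z) (hxz : x ≠ z) (n : ℕ) :
    (extensions [x, y, x] (n + 3)).ncard ≤ (extensions [y, x, z] (n + 2)).ncard := by
  have h1 : (extensions [x, y, x] (n + 3)).ncard ≤ _ := ncard_extensions_succ_le _ (n + 2)
  rw [sum_eq_of_ne hxy hyz hxz] at h1
  have h2 : (extensions [x, y, x, x] (n + 2)).ncard = 0 :=
    ncard_extensions_eq_zero fun w _ => ⟨[x, x], Or.inl ⟨x, rfl⟩, [x, y], w, by simp⟩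
  have h3 : (extensions [x, y, x, y] (n + 2)).ncard = 0 := by
    refine ncard_extensions_eq_zero fun w hw => ?_
    obtain ⟨k, m, w, rfl⟩ : ∃ k m w', w = k :: m :: w' := by
      rcases w with _ | ⟨k, _ | ⟨m, w⟩⟩ <;> simp at hw
      exact ⟨k, m, w, rfl⟩
    exact ⟨[x, y, x, y, k, m], Or.inr (Or.inr ⟨x, y, k, m, hxy, rfl⟩), [], w, by simp⟩
  have h4 := ncard_extensions_append_le [x] [y, x, z] (n + 2)
  simp only [List.cons_append, List.nil_append] at *
  omega

/-- The growth rate of admissible words is the root of `β ^ 3 = β + 1`, which is below `7 / 5`. -/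
lemma ncard_extensions_le (n : ℕ) : ∀ x y z : Fin 3, x ≠ y → y ≠ z → x ≠ z →
    ((extensions [x, y, z] n).ncard : ℝ) ≤ 13 * (7 / 5) ^ n ∧
      (7 / 5) * ((extensions [x, y, x] n).ncard : ℝ) ≤ 13 * (7 / 5) ^ n := by
  induction n using Nat.strong_induction_on with
  | _ n ih =>
    intro x y z hxy hyz hxz
    by_cases hn : n < 3
    · have h1 : ((extensions [x, y, z] n).ncard : ℝ) ≤ 3 ^ n := by
        exact_mod_cast ncard_extensions_le_pow _ n
      have h2 : ((extensions [x, y, x] n).ncard : ℝ) ≤ 3 ^ n := by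
        exact_mod_cast ncard_extensions_le_pow _ n
      have h3 : (3 : ℝ) ^ n ≤ 3 ^ 2 := pow_le_pow_right₀ (by norm_num) (by omega)
      have h4 : (1 : ℝ) ≤ (7 / 5) ^ n := one_le_pow₀ (by norm_num)
      constructor <;> linarith
    · obtain ⟨m, rfl⟩ : ∃ m, n = m + 3 := ⟨n - 3, by omega⟩
      have h1 : ((extensions [x, y, z] (m + 3)).ncard : ℝ) ≤
          (extensions [y, z, y] (m + 2)).ncard + (extensions [z, x, z] (m + 1)).ncard := by
        exact_mod_cast ncard_extensions_of_ne_le hxy hyz hxz (m + 1)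
      have h2 : ((extensions [x, y, x] (m + 3)).ncard : ℝ) ≤
          (extensions [y, x, z] (m + 2)).ncard := by
        exact_mod_cast ncard_extensions_of_eq_le hxy hyz hxz m
      have h3 := (ih (m + 2) (by omega) y z x hyz hxz.symm hxy.symm).2
      have h4 := (ih (m + 1) (by omega) z x y hxz.symm hxy hyz.symm).2
      have h5 := (ih (m + 2) (by omega) y x z hxy.symm hxz hyz).1
      have h6 : (0 : ℝ) < (7 / 5) ^ m := by positivity
      simp only [pow_succ] at h3 h4 h5 ⊢
      constructor <;> linarith

lemma ncard_extensions_nil_le (n : ℕ) :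
    ((extensions [] (n + 3)).ncard : ℝ) ≤ 351 * (7 / 5) ^ n := by
  have h : ∀ x y z : Fin 3, ((extensions [x, y, z] n).ncard : ℝ) ≤ 13 * (7 / 5) ^ n := by
    intro x y z
    have h0 : (0 : ℝ) ≤ 13 * (7 / 5) ^ n := by positivity
    by_cases hxy : x = y
    · subst hxy
      rw [ncard_extensions_eq_zero fun w _ => ⟨[x, x], Or.inl ⟨x, rfl⟩, [], z :: w, by simp⟩]
      simpa using h0
    by_cases hyz : y = z
    · subst hyz
      rw [ncard_extensions_eq_zero fun w _ => ⟨[y, y], Or.inl ⟨y, rfl⟩, [x], w, by simp⟩]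
      simpa using h0
    by_cases hxz : x = z
    · subst hxz
      obtain ⟨w, hwx, hwy⟩ := exists_third x y
      have := (ncard_extensions_le n x y w hxy hwy.symm hwx.symm).2
      have h1 : (0 : ℝ) ≤ (extensions [x, y, x] n).ncard := by positivity
      linarith
    · exact (ncard_extensions_le n x y z hxy hyz hxz).1
  have h1 : (extensions [] (n + 3)).ncard ≤
      ∑ x, ∑ y, ∑ z, (extensions [x, y, z] n).ncard := by
    refine (ncard_extensions_succ_le [] _).trans (Finset.sum_le_sum fun x _ => ?_)
    refine (ncard_extensions_succ_le [x] _).trans (Finset.sum_le_sum fun y _ => ?_)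
    exact ncard_extensions_succ_le [x, y] n
  calc ((extensions [] (n + 3)).ncard : ℝ)
      ≤ ∑ x, ∑ y, ∑ z, ((extensions [x, y, z] n).ncard : ℝ) := by exact_mod_cast h1
    _ ≤ ∑ _x : Fin 3, ∑ _y : Fin 3, ∑ _z : Fin 3, 13 * (7 / 5 : ℝ) ^ n :=
        Finset.sum_le_sum fun x _ => Finset.sum_le_sum fun y _ => Finset.sum_le_sum fun z _ =>
          h x y z
    _ = 351 * (7 / 5) ^ n := by simp; ring

open Classical in
/-- Poor blocks are coded by admissible words. -/
lemma card_poor_le (u : Hex) (n : ℕ) :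
    {X ∈ saws hexagonalLattice u (n + 1) | Poor hexagonalLattice HasZigzag X}.card ≤
      (extensions [] n).ncard := by
  rw [← Set.ncard_coe_finset]
  refine le_trans (Set.ncard_le_ncard (t := walkOf u '' extensions [] n) (fun X hX => ?_)
    ((finite_extensions _ _).image _)) (Set.ncard_image_le (finite_extensions _ _))
  simp only [Finset.coe_filter, Set.mem_ofPred_eq] at hX
  obtain ⟨h1, h2, h3, h4⟩ := mem_saws.1 hX.1
  obtain ⟨w, h5, rfl⟩ := exists_walkOf h3 h1
  exact ⟨w, ⟨by omega, admissible_of_poor h4 hX.2⟩, rfl⟩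

open Classical in
/-- Poor blocks have a smaller growth rate than self-avoiding walks. -/
lemma exists_card_poor_lt {μ : ℝ} (hμ : 8 / 5 ≤ μ) (D : ℕ) : ∃ b r : ℕ, 1 ≤ b ∧
    (D * r : ℝ) < μ ^ b ∧
    ∀ u, {X ∈ saws hexagonalLattice u b | Poor hexagonalLattice HasZigzag X}.card ≤ r := by
  have hlim : Tendsto (fun n : ℕ => (D * 351 : ℝ) * (7 / 8) ^ n) atTop (𝓝 (D * 351 * 0)) :=
    (tendsto_pow_atTop_nhds_zero_of_lt_one (by norm_num) (by norm_num)).const_mul _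
  rw [mul_zero] at hlim
  obtain ⟨n, hn⟩ := (hlim.eventually_lt_const one_pos).exists
  refine ⟨n + 4, (extensions [] (n + 3)).ncard, by omega, ?_, fun u => card_poor_le u (n + 3)⟩
  have h1 : (7 / 5 : ℝ) ^ n = (7 / 8) ^ n * (8 / 5) ^ n := by rw [← mul_pow]; norm_num
  have h2 : (8 / 5 : ℝ) ^ (n + 4) ≤ μ ^ (n + 4) := by gcongr
  have h3 : (8 / 5 : ℝ) ^ n ≤ (8 / 5) ^ (n + 4) := by gcongr <;> norm_num
  have h4 : (0 : ℝ) < (8 / 5) ^ n := by positivity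
  calc (D * (extensions [] (n + 3)).ncard : ℝ) ≤ D * (351 * (7 / 5) ^ n) := by
        gcongr; exact ncard_extensions_nil_le n
    _ = D * 351 * (7 / 8) ^ n * (8 / 5) ^ n := by rw [h1]; ring
    _ < 1 * (8 / 5) ^ n := by gcongr
    _ ≤ μ ^ (n + 4) := by linarith

end SAW

open SAW in
theorem theorem1 :
    (∀ d : ℕ, 2 ≤ d →
      ∃ μ : ℝ, 0 < μ ∧ LoopModel.IsConnectiveConstant (cubicLattice d) μ ∧
        (∀ n : ℝ, 0 < n →
          ((1 / μ : ℝ) : EReal) < LoopModel.criticalThreshold (cubicLattice d) n) ∧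
        ∃ c₀ : ℝ, 0 < c₀ ∧ ∃ r : ℝ → ℝ, r =O[𝓝[>] (0 : ℝ)] (fun n : ℝ => n ^ 2) ∧
          ∀ n : ℝ, 0 < n →
            ((1 / μ + c₀ * n + r n : ℝ) : EReal) ≤
              LoopModel.criticalThreshold (cubicLattice d) n) ∧
    (∃ μ : ℝ, 0 < μ ∧ LoopModel.IsConnectiveConstant hexagonalLattice μ ∧
      (∀ n : ℝ, 0 < n →
        ((1 / μ : ℝ) : EReal) < LoopModel.criticalThreshold hexagonalLattice n) ∧
      ∃ c₀ : ℝ, 0 < c₀ ∧ ∃ r : ℝ → ℝ, r =O[𝓝[>] (0 : ℝ)] (fun n : ℝ => n ^ 2) ∧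
        ∀ n : ℝ, 0 < n →
          ((1 / μ + c₀ * n + r n : ℝ) : EReal) ≤
            LoopModel.criticalThreshold hexagonalLattice n) := by
  constructor
  · intro d hd
    have hne := cubicLattice_saws_nonempty hd
    obtain ⟨μ, hμ1, hμ⟩ := exists_connectiveConstant cubicLattice_transitive hne
    obtain ⟨D, hD⟩ := exists_degree_le (cubicLattice_transitive (d := d))
    obtain ⟨B, r, hB, hrμ, hr⟩ := exists_card_induced_lt cubicLattice_transitive hμ1 hμ
      (b := 4) (r := 0) (by norm_num) hD (cubicLattice_hasSurgery hd) (fun x => by simp [Poor])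
      (by simp only [Nat.cast_zero, mul_zero]; positivity) 0
    exact ⟨μ, by linarith, hμ, criticalThreshold_bounds cubicLattice_transitive hμ1 hμ hB hD hrμ hr⟩
  · obtain ⟨μ, hμ1, hμ⟩ := exists_connectiveConstant hexagonalLattice_transitive
      hexagonalLattice_saws_nonempty
    obtain ⟨D, hD⟩ := exists_degree_le hexagonalLattice_transitive
    obtain ⟨b, r, hb, hrμ, hr⟩ :=
      exists_card_poor_lt (le_connectiveConstant_hexagonalLattice hμ) D
    obtain ⟨B, r', hB, hrμ', hr'⟩ := exists_card_induced_lt hexagonalLattice_transitive hμ1 hμ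
      hb hD (hexagonalLattice_hasSurgery b) hr hrμ (0, 0, false)
    exact ⟨μ, by linarith, hμ,
      criticalThreshold_bounds hexagonalLattice_transitive hμ1 hμ hB hD hrμ' hr'⟩

end
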